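/- Let $\mathbb F_q$ be a finite field and $Q=(Q_0,Q_1)$ a finite acyclic quiver with an automorphism $\sigma$. Let $A=\mathfrak A(Q,\sigma;q)$ be the $\mathbb F_q$-algebra of fixed points of the Frobenius morphism $\sum_s x_sp_s\mapsto\sum_s x_s^q\,\sigma(p_s)$ ($p_s$ paths) of the path algebra $\overline{\mathbb F}_qQ$. Let $I$ (resp. $\Gamma_1$) be the set of $\sigma$-orbits in $Q_0$ (resp. $Q_1$), so that $\Gamma=(I,\Gamma_1)$ is a quiver; let $\varepsilon_i,\varepsilon_\rho$ be the cardinalities of the orbits, $t\rho$ and $h\rho$ the tail and head of $\rho\in\Gamma_1$, and $$\langle x,y\rangle=\sum_{i\in I}\varepsilon_ix_iy_i-\sum_{\rho\in\Gamma_1}\varepsilon_\rho x_{t\rho}y_{h\rho},\qquad (x,y)=\langle x,y\rangle+\langle y,x\rangle\qquad(x,y\in\mathbb ZI).$$ The fundamental set $\mathcal F_{Q,\sigma}$ consists of all $\mu\in\mathbb NI$ whose support is a non-empty connected full subquiver of $\Gamma$ and which satisfy $(\mu,i)\le 0$ for all $i\in I$. The dimension vector of a finite-dimensional $A$-module $M$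 is $\mathbf{dim}\,M=(\dim_{\mathbb F_{q^{\varepsilon_i}}}e_iM)_{i\in I}$, where $e_i$ is the idempotent of $A$ belonging to the orbit $i$. Let $v=\sqrt q$, let $a_M=|\mathrm{Aut}_A(M)|$, and let $F^M_{X,Y}$ be the number of submodules $U$ of $M$ with $U\cong Y$ and $M/U\cong X$. The Ringel--Hall algebra $\mathcal H=\mathcal H_v(Q,\sigma)$ has the isoclasses $[M]$ of finite-dimensional $A$-modules as a $\mathbb C$-basis, identity $1=[0]$, comultiplication $$\Delta([M])=\sum_{[X],[Y]}v^{\langle\mathbf{dim}\,X,\mathbf{dim}\,Y\rangle}\frac{a_Xa_Y}{a_M}F^M_{X,Y}\,[X]\otimes[Y],$$ and its component $\mathcal H_d$ $(d\in\mathbb NI)$ is spanned by the $[M]$ with $\mathbf{dim}\,M=d$. Put $\mathcal H_d^{\mathrm{prim}}=\{x\in\mathcal H_d\mid\Delta(x)=x\otimes1+1\otimes x\}$. An $A$-module is regular if none of its indecomposable direct summands is postprojective (of the form $\tau^{-m}P$, $m\ge0$, $P$ indecomposable projective) or preinjective (of the form $\tau^mJ$, $m\ge0$, $J$ indecomposable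 injective), $\tau$ being the Auslander--Reiten translation. Let $\mathscr R_A$ be the class of finite-dimensional regular $A$-modules, $\mathcal H(\mathscr R_A)\subseteq\mathcal H$ the span of the $[M]$ with $M\in\mathscr R_A$, $\mathcal H(\mathscr R_A)_d=\mathcal H(\mathscr R_A)\cap\mathcal H_d$, and $\Delta_{\mathscr R}$ the comultiplication on $\mathcal H(\mathscr R_A)$ given by the formula for $\Delta$ with the sum restricted to $X,Y\in\mathscr R_A$. Put $\mathcal H(\mathscr R_A)_d^{\mathrm{prim}}=\{x\in\mathcal H(\mathscr R_A)_d\mid\Delta_{\mathscr R}(x)=x\otimes1+1\otimes x\}$, and let $\mathbb I_d^{\mathrm{reg}}:\mathcal H(\mathscr R_A)_d\to\mathbb C$ be the linear map $[M]\mapsto 1/a_M$. Then for every $\alpha\in\mathcal F_{Q,\sigma}$: 1. if $x=\sum_{[M]}\mu_M[M]\in\mathcal H_\alpha^{\mathrm{prim}}$ and $\mu_M\ne0$, then $M$ is regular and $\mathbf{dim}\,M=\alpha$; 2. $\mathcal H_\alpha^{\mathrm{prim}}\subseteq\mathcal H(\mathscr R_A)_\alpha^{\mathrm{prim}}\cap\operatorname{Ker}\mathbb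 I_\alpha^{\mathrm{reg}}$. -/

import Mathlib

universe u

noncomputable section

open scoped TensorProduct

namespace HallPrim

/-! ## Path algebras -/

section PathAlgebra

variable (K : Type u) (V : Type u) [Quiver.{u} V]

/-- All paths of a quiver, each with its source and its target. -/
abbrev PathOf : Type u := Σ a b : V, Quiver.Path a b

/-- The path algebra `K Q`: the vector space with the paths of `Q` as basis. -/
def PathAlgebra [Field K] : Type u := PathOf V →₀ K

end PathAlgebra

namespace PathAlgebra

variable {K : Type u} {V : Type u} [Quiver.{u} V] [Field K]

instance : AddCommGroup (PathAlgebra K V) := inferInstanceAs (AddCommGroup (PathOf V →₀ K))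

instance {k : Type u} [Field k] [Algebra k K] : Module k (PathAlgebra K V) :=
  inferInstanceAs (Module k (PathOf V →₀ K))

/-- The scalar multiple `c p` of a path `p`. -/
def monomial (p : PathOf V) (c : K) : PathAlgebra K V := Finsupp.single p c

open Classical in
/-- The product `p * r` of two paths, "first `r`, then `p`"; it is `0` unless `r` ends where `p`
starts.  With this convention left modules are the representations of the quiver. -/
def pathMul (p r : PathOf V) : PathAlgebra K V :=
  if h : r.2.1 = p.1 then monomial ⟨r.1, p.2.1, (r.2.2.cast rfl h).comp p.2.2⟩ 1 else 0

/-- Left multiplication by a path, extended linearly. -/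
def mulPath (p : PathOf V) : PathAlgebra K V →ₗ[K] PathAlgebra K V :=
  (Finsupp.linearCombination K fun r : PathOf V => (pathMul p r : PathAlgebra K V) :
    (PathOf V →₀ K) →ₗ[K] PathAlgebra K V)

/-- The bilinear extension of the multiplication of paths. -/
def mulLin : PathAlgebra K V →ₗ[K] PathAlgebra K V →ₗ[K] PathAlgebra K V :=
  (Finsupp.linearCombination K fun p : PathOf V => (mulPath p : PathAlgebra K V →ₗ[K] _) :
    (PathOf V →₀ K) →ₗ[K] PathAlgebra K V →ₗ[K] PathAlgebra K V)

instance : Mul (PathAlgebra K V) := ⟨fun x y => mulLin x y⟩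

/-- The unit element: the sum of the trivial paths `e_a`. -/
instance [Fintype V] : One (PathAlgebra K V) :=
  ⟨∑ a : V, monomial ⟨a, a, Quiver.Path.nil⟩ 1⟩

lemma mul_def (x y : PathAlgebra K V) : x * y = mulLin x y := rfl

lemma one_def [Fintype V] :
    (1 : PathAlgebra K V) = ∑ a : V, monomial ⟨a, a, Quiver.Path.nil⟩ 1 := rfl

lemma monomial_mul_monomial (p r : PathOf V) (c d : K) :
    (monomial p c * monomial r d : PathAlgebra K V) = (c * d) • pathMul p r := by
  have h1 : mulLin (monomial p c : PathAlgebra K V) = c • mulPath p :=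
    Finsupp.linearCombination_single K c p
  have h2 : mulPath p (monomial r d : PathAlgebra K V) = d • pathMul p r :=
    Finsupp.linearCombination_single K d r
  rw [mul_def, h1, LinearMap.smul_apply, h2, smul_smul]

@[elab_as_elim]
lemma induction_on {P : PathAlgebra K V → Prop} (x : PathAlgebra K V) (h0 : P 0)
    (hadd : ∀ x y, P x → P y → P (x + y)) (hs : ∀ p c, P (monomial p c)) : P x :=
  Finsupp.induction_linear (motive := P) x h0 hadd hs

lemma smul_monomial {k : Type u} [Field k] [Algebra k K] (a : k) (p : PathOf V) (c : K) :
    (a • monomial p c : PathAlgebra K V) = monomial p (a • c) :=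
  Finsupp.smul_single a p c

lemma pathMul_of_comp {a b c : V} (p : Quiver.Path b c) (r : Quiver.Path a b) :
    (pathMul ⟨b, c, p⟩ ⟨a, b, r⟩ : PathAlgebra K V) = monomial ⟨a, c, r.comp p⟩ 1 := by
  simp [pathMul]

lemma pathMul_of_ne {p r : PathOf V} (h : r.2.1 ≠ p.1) :
    (pathMul p r : PathAlgebra K V) = 0 := by
  simp [pathMul, h]

protected lemma left_distrib (x y z : PathAlgebra K V) : x * (y + z) = x * y + x * z := by
  simp [mul_def]

protected lemma right_distrib (x y z : PathAlgebra K V) : (x + y) * z = x * z + y * z := by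
  simp [mul_def]

protected lemma zero_mul (x : PathAlgebra K V) : 0 * x = 0 := by simp [mul_def]

protected lemma mul_zero (x : PathAlgebra K V) : x * 0 = 0 := by simp [mul_def]

protected lemma smul_mul' (a : K) (x y : PathAlgebra K V) : (a • x) * y = a • (x * y) := by
  simp [mul_def]

protected lemma mul_smul' (a : K) (x y : PathAlgebra K V) : x * (a • y) = a • (x * y) := by
  simp [mul_def]

lemma pathMul_assoc (p r s : PathOf V) :
    (pathMul p r * monomial s 1 : PathAlgebra K V) = monomial p 1 * pathMul r s := by
  obtain ⟨p1, p2, p⟩ := p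
  obtain ⟨r1, r2, r⟩ := r
  obtain ⟨s1, s2, s⟩ := s
  by_cases h1 : r2 = p1
  · subst h1
    rw [pathMul_of_comp, monomial_mul_monomial]
    by_cases h2 : s2 = r1
    · subst h2
      rw [pathMul_of_comp, pathMul_of_comp, monomial_mul_monomial, pathMul_of_comp,
        Quiver.Path.comp_assoc]
    · rw [pathMul_of_ne (by exact h2), pathMul_of_ne (by exact h2), PathAlgebra.mul_zero, smul_zero]
  · rw [pathMul_of_ne (by exact h1), PathAlgebra.zero_mul]
    by_cases h2 : s2 = r1
    · subst h2
      rw [pathMul_of_comp, monomial_mul_monomial, pathMul_of_ne (by exact h1), smul_zero]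
    · rw [pathMul_of_ne (by exact h2), PathAlgebra.mul_zero]

lemma monomial_eq_smul (p : PathOf V) (c : K) :
    (monomial p c : PathAlgebra K V) = c • monomial p 1 := by
  rw [smul_monomial, smul_eq_mul, mul_one]

protected lemma mul_assoc (x y z : PathAlgebra K V) : x * y * z = x * (y * z) := by
  induction x using PathAlgebra.induction_on with
  | h0 => simp only [PathAlgebra.zero_mul]
  | hadd x x' hx hx' => simp only [PathAlgebra.right_distrib, hx, hx']
  | hs p c =>
    induction y using PathAlgebra.induction_on with
    | h0 => simp only [PathAlgebra.zero_mul, PathAlgebra.mul_zero]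
    | hadd y y' hy hy' => simp only [PathAlgebra.right_distrib, PathAlgebra.left_distrib, hy, hy']
    | hs r d =>
      induction z using PathAlgebra.induction_on with
      | h0 => simp only [PathAlgebra.mul_zero]
      | hadd z z' hz hz' => simp only [PathAlgebra.left_distrib, hz, hz']
      | hs s e =>
        rw [monomial_mul_monomial, monomial_mul_monomial, PathAlgebra.smul_mul',
          PathAlgebra.mul_smul', monomial_eq_smul s, monomial_eq_smul p, PathAlgebra.smul_mul',
          PathAlgebra.mul_smul', pathMul_assoc, smul_smul, smul_smul]
        congr 1
        ring

variable [Fintype V]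

protected lemma one_mul (x : PathAlgebra K V) : 1 * x = x := by
  induction x using PathAlgebra.induction_on with
  | h0 => exact PathAlgebra.mul_zero _
  | hadd x y hx hy => rw [PathAlgebra.left_distrib, hx, hy]
  | hs p c =>
    obtain ⟨a, b, p⟩ := p
    rw [one_def, mul_def, map_sum, LinearMap.sum_apply, Finset.sum_eq_single b]
    · rw [← mul_def, monomial_mul_monomial, pathMul_of_comp, smul_monomial]
      simp
    · intro d _ hd
      rw [← mul_def, monomial_mul_monomial, pathMul_of_ne (by exact hd.symm), smul_zero]
    · intro h
      exact absurd (Finset.mem_univ b) h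

protected lemma mul_one (x : PathAlgebra K V) : x * 1 = x := by
  induction x using PathAlgebra.induction_on with
  | h0 => exact PathAlgebra.zero_mul _
  | hadd x y hx hy => rw [PathAlgebra.right_distrib, hx, hy]
  | hs p c =>
    obtain ⟨a, b, p⟩ := p
    rw [one_def, mul_def, map_sum, Finset.sum_eq_single a]
    · rw [← mul_def, monomial_mul_monomial, pathMul_of_comp, smul_monomial]
      simp
    · intro d _ hd
      rw [← mul_def, monomial_mul_monomial, pathMul_of_ne (by exact hd), smul_zero]
    · intro h
      exact absurd (Finset.mem_univ a) h

instance : Ring (PathAlgebra K V) :=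
  { (inferInstance : AddCommGroup (PathAlgebra K V)) with
    mul := (· * ·)
    one := 1
    left_distrib := PathAlgebra.left_distrib
    right_distrib := PathAlgebra.right_distrib
    zero_mul := PathAlgebra.zero_mul
    mul_zero := PathAlgebra.mul_zero
    mul_assoc := PathAlgebra.mul_assoc
    one_mul := PathAlgebra.one_mul
    mul_one := PathAlgebra.mul_one }

lemma smul_eq_algebraMap_smul {k : Type u} [Field k] [Algebra k K] (a : k)
    (x : PathAlgebra K V) : a • x = algebraMap k K a • x := by
  induction x using PathAlgebra.induction_on with
  | h0 => rw [smul_zero, smul_zero]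
  | hadd x y hx hy => rw [smul_add, smul_add, hx, hy]
  | hs p c => rw [smul_monomial, smul_monomial, Algebra.smul_def, smul_eq_mul]

instance {k : Type u} [Field k] [Algebra k K] : Algebra k (PathAlgebra K V) :=
  Algebra.ofModule
    (fun a x y => by
      rw [smul_eq_algebraMap_smul, PathAlgebra.smul_mul', ← smul_eq_algebraMap_smul])
    (fun a x y => by
      rw [smul_eq_algebraMap_smul, PathAlgebra.mul_smul', ← smul_eq_algebraMap_smul])

end PathAlgebra

/-! ## Quivers with automorphism -/

/-- A quiver is acyclic if it has no oriented cycles. -/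
def IsAcyclicQuiver (V : Type u) [Quiver.{u} V] : Prop :=
  ∀ (a : V) (p : Quiver.Path a a), p.length = 0

/-- An automorphism of a quiver. -/
structure QuiverAut (V : Type u) [Quiver.{u} V] where
  hom : V ⥤q V
  inv : V ⥤q V
  hom_inv : hom ⋙q inv = 𝟭q V
  inv_hom : inv ⋙q hom = 𝟭q V

namespace QuiverAut

variable {V : Type u} [Quiver.{u} V] (σ : QuiverAut V)

/-- The set `Q₁` of all arrows of a quiver. -/
abbrev ArrowOf (V : Type u) [Quiver.{u} V] : Type u := Σ a b : V, (a ⟶ b)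

lemma map_eq_of_eq_id {F : V ⥤q V} (h : F = 𝟭q V) (r : ArrowOf V) :
    (⟨F.obj r.1, F.obj r.2.1, F.map r.2.2⟩ : ArrowOf V) = r := by
  subst h; rfl

/-- The permutation of the vertices given by `σ`. -/
def vertexPerm : Equiv.Perm V where
  toFun := σ.hom.obj
  invFun := σ.inv.obj
  left_inv a := congrArg (fun F : V ⥤q V => F.obj a) σ.hom_inv
  right_inv a := congrArg (fun F : V ⥤q V => F.obj a) σ.inv_hom

/-- The permutation of the arrows given by `σ`. -/
def arrowPerm : Equiv.Perm (ArrowOf V) where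
  toFun r := ⟨σ.hom.obj r.1, σ.hom.obj r.2.1, σ.hom.map r.2.2⟩
  invFun r := ⟨σ.inv.obj r.1, σ.inv.obj r.2.1, σ.inv.map r.2.2⟩
  left_inv r := map_eq_of_eq_id σ.hom_inv r
  right_inv r := map_eq_of_eq_id σ.inv_hom r

/-- The action of `σ` on paths. -/
def onPath (p : PathOf V) : PathOf V := ⟨σ.hom.obj p.1, σ.hom.obj p.2.1, σ.hom.mapPath p.2.2⟩

/-! ### The valued quiver of `(Q, σ)` -/

/-- The set `I = Γ₀` of `σ`-orbits of vertices. -/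
def Orbit : Type u := Quotient (Equiv.Perm.SameCycle.setoid σ.vertexPerm)

/-- The set `Γ₁` of `σ`-orbits of arrows. -/
def ArrowOrbit : Type u := Quotient (Equiv.Perm.SameCycle.setoid σ.arrowPerm)

/-- The orbit of a vertex. -/
def orbit (a : V) : σ.Orbit := Quotient.mk _ a

/-- The orbit of an arrow. -/
def arrowOrbit (r : ArrowOf V) : σ.ArrowOrbit := Quotient.mk _ r

lemma orbit_hom (a : V) : σ.orbit (σ.hom.obj a) = σ.orbit a :=
  Quotient.sound (s := Equiv.Perm.SameCycle.setoid σ.vertexPerm)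
    ((Equiv.Perm.sameCycle_apply_left (f := σ.vertexPerm)).2 (Equiv.Perm.SameCycle.refl _ a))

lemma arrowPerm_zpow_fst (n : ℤ) (r : ArrowOf V) :
    ((σ.arrowPerm ^ n) r).1 = (σ.vertexPerm ^ n) r.1 ∧
      ((σ.arrowPerm ^ n) r).2.1 = (σ.vertexPerm ^ n) r.2.1 := by
  induction n using Int.induction_on generalizing r with
  | zero => exact ⟨rfl, rfl⟩
  | succ n ih =>
    rw [zpow_add_one, zpow_add_one, Equiv.Perm.mul_apply, Equiv.Perm.mul_apply,
      Equiv.Perm.mul_apply]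
    exact ih _
  | pred n ih =>
    rw [zpow_sub_one, zpow_sub_one, Equiv.Perm.mul_apply, Equiv.Perm.mul_apply,
      Equiv.Perm.mul_apply]
    exact ih _

/-- The tail (source) of an arrow of the valued quiver. -/
def tail : σ.ArrowOrbit → σ.Orbit :=
  Quotient.lift (fun r => σ.orbit r.1) fun r s ⟨n, h⟩ =>
    Quotient.sound (s := Equiv.Perm.SameCycle.setoid σ.vertexPerm)
      ⟨n, by rw [← (σ.arrowPerm_zpow_fst n r).1, h]⟩

/-- The head (target) of an arrow of the valued quiver. -/
def head : σ.ArrowOrbit → σ.Orbit :=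
  Quotient.lift (fun r => σ.orbit r.2.1) fun r s ⟨n, h⟩ =>
    Quotient.sound (s := Equiv.Perm.SameCycle.setoid σ.vertexPerm)
      ⟨n, by rw [← (σ.arrowPerm_zpow_fst n r).2, h]⟩

/-- `ε_i`, the number of vertices in the orbit `i`. -/
def eps (i : σ.Orbit) : ℕ := Nat.card {a : V // σ.orbit a = i}

/-- `ε_ρ`, the number of arrows in the orbit `ρ`. -/
def arrowEps (r : σ.ArrowOrbit) : ℕ := Nat.card {s : ArrowOf V // σ.arrowOrbit s = r}

instance [Fintype V] : Fintype σ.Orbit :=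
  @Fintype.ofFinite _ (inferInstanceAs (Finite (Quotient _)))

instance [Fintype V] [∀ a b : V, Fintype (a ⟶ b)] : Fintype σ.ArrowOrbit :=
  @Fintype.ofFinite _ (inferInstanceAs (Finite (Quotient _)))

section Euler

variable [Fintype V] [∀ a b : V, Fintype (a ⟶ b)]

/-- The Euler form of the valued quiver on `ℤ I`. -/
def euler (x y : σ.Orbit → ℤ) : ℤ :=
  ∑ i, (σ.eps i : ℤ) * x i * y i - ∑ r, (σ.arrowEps r : ℤ) * x (σ.tail r) * y (σ.head r)

/-- The symmetric Euler form. -/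
def symEuler (x y : σ.Orbit → ℤ) : ℤ := σ.euler x y + σ.euler y x

/-- The underlying simple graph of the valued quiver. -/
def graph : SimpleGraph σ.Orbit :=
  SimpleGraph.fromRel fun i j => ∃ r : σ.ArrowOrbit, σ.tail r = i ∧ σ.head r = j

open Classical in
/-- The fundamental set: the dimension vectors `μ` with (non-empty) connected support such that
`(μ, i) ≤ 0` for all `i`. -/
def fundamentalSet : Set (σ.Orbit → ℕ) :=
  {μ | (σ.graph.induce {i | μ i ≠ 0}).Connected ∧
    ∀ i, σ.symEuler (fun j => (μ j : ℤ)) (Pi.single i 1) ≤ 0}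

end Euler

end QuiverAut

/-! ## The algebra of fixed points of the Frobenius morphism -/

section FixedPoints

variable (k : Type u) [Field k] [Fintype k] {V : Type u} [Quiver.{u} V] [Fintype V]
  (σ : QuiverAut V)

/-- The Frobenius morphism as a map: `∑ x_s p_s ↦ ∑ x_s ^ q σ(p_s)`, `q = |k|`, on the path algebra
over the algebraic closure of `k`. -/
def frobFun (x : PathAlgebra (AlgebraicClosure k) V) : PathAlgebra (AlgebraicClosure k) V :=
  Finsupp.sum (x : PathOf V →₀ AlgebraicClosure k) fun p c =>
    PathAlgebra.monomial (σ.onPath p) (c ^ Fintype.card k)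

lemma frobFun_zero : frobFun k σ 0 = 0 := Finsupp.sum_zero_index

lemma pow_card_add (c d : AlgebraicClosure k) :
    (c + d) ^ Fintype.card k = c ^ Fintype.card k + d ^ Fintype.card k :=
  map_add (FiniteField.frobeniusAlgHom k (AlgebraicClosure k)) c d

lemma frobFun_add (x y : PathAlgebra (AlgebraicClosure k) V) :
    frobFun k σ (x + y) = frobFun k σ x + frobFun k σ y := by
  refine Finsupp.sum_add_index' (fun p => ?_) (fun p c d => ?_)
  · rw [zero_pow Fintype.card_ne_zero]
    exact Finsupp.single_zero _
  · rw [pow_card_add]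
    exact Finsupp.single_add _ _ _

lemma frobFun_monomial (p : PathOf V) (c : AlgebraicClosure k) :
    frobFun k σ (PathAlgebra.monomial p c) =
      PathAlgebra.monomial (σ.onPath p) (c ^ Fintype.card k) := by
  refine Finsupp.sum_single_index ?_
  rw [zero_pow Fintype.card_ne_zero]
  exact Finsupp.single_zero _

lemma frobFun_smul (c : AlgebraicClosure k) (x : PathAlgebra (AlgebraicClosure k) V) :
    frobFun k σ (c • x) = (c ^ Fintype.card k) • frobFun k σ x := by
  induction x using PathAlgebra.induction_on with
  | h0 => rw [smul_zero, frobFun_zero, smul_zero]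
  | hadd x y hx hy => rw [smul_add, frobFun_add, frobFun_add, hx, hy, smul_add]
  | hs p d =>
    rw [PathAlgebra.smul_monomial, frobFun_monomial, frobFun_monomial, PathAlgebra.smul_monomial,
      smul_eq_mul, smul_eq_mul, mul_pow]

lemma frobFun_pathMul (p r : PathOf V) :
    frobFun k σ (PathAlgebra.pathMul p r) = PathAlgebra.pathMul (σ.onPath p) (σ.onPath r) := by
  obtain ⟨p1, p2, p⟩ := p
  obtain ⟨r1, r2, r⟩ := r
  by_cases h : r2 = p1
  · subst h
    rw [PathAlgebra.pathMul_of_comp, frobFun_monomial, one_pow]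
    simp only [QuiverAut.onPath, Prefunctor.mapPath_comp]
    rw [PathAlgebra.pathMul_of_comp]
  · rw [PathAlgebra.pathMul_of_ne (by exact h), frobFun_zero, PathAlgebra.pathMul_of_ne]
    exact fun h' => h (σ.vertexPerm.injective h')

lemma frobFun_mul (x y : PathAlgebra (AlgebraicClosure k) V) :
    frobFun k σ (x * y) = frobFun k σ x * frobFun k σ y := by
  induction x using PathAlgebra.induction_on with
  | h0 => rw [zero_mul, frobFun_zero, zero_mul]
  | hadd x x' hx hx' => rw [add_mul, frobFun_add, frobFun_add, hx, hx', add_mul]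
  | hs p c =>
    induction y using PathAlgebra.induction_on with
    | h0 => rw [mul_zero, frobFun_zero, mul_zero]
    | hadd y y' hy hy' => rw [mul_add, frobFun_add, frobFun_add, hy, hy', mul_add]
    | hs r d =>
      rw [PathAlgebra.monomial_mul_monomial, frobFun_smul, frobFun_pathMul, frobFun_monomial,
        frobFun_monomial, PathAlgebra.monomial_mul_monomial, mul_pow]

lemma frobFun_sum {ι : Type u} (s : Finset ι) (f : ι → PathAlgebra (AlgebraicClosure k) V) :
    frobFun k σ (∑ i ∈ s, f i) = ∑ i ∈ s, frobFun k σ (f i) :=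
  map_sum (AddMonoidHom.mk' (frobFun k σ) (frobFun_add k σ)) f s

lemma frobFun_one : frobFun k σ 1 = 1 := by
  rw [PathAlgebra.one_def, frobFun_sum]
  simp only [frobFun_monomial, one_pow]
  exact Equiv.sum_comp σ.vertexPerm fun a =>
    (PathAlgebra.monomial ⟨a, a, Quiver.Path.nil⟩ 1 : PathAlgebra (AlgebraicClosure k) V)

/-- The Frobenius morphism `F_{Q,σ;q}` of the path algebra over the algebraic closure of `k`. -/
def frob : PathAlgebra (AlgebraicClosure k) V →ₐ[k] PathAlgebra (AlgebraicClosure k) V :=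
  AlgHom.ofLinearMap
    { toFun := frobFun k σ
      map_add' := frobFun_add k σ
      map_smul' := fun c x => by
        rw [PathAlgebra.smul_eq_algebraMap_smul, frobFun_smul, ← map_pow, FiniteField.pow_card,
          ← PathAlgebra.smul_eq_algebraMap_smul, RingHom.id_apply] }
    (frobFun_one k σ) (frobFun_mul k σ)

/-- The `k`-algebra `𝔄(Q,σ;q)` of fixed points of the Frobenius morphism. -/
def FixedAlg : Type u := AlgHom.equalizer (frob k σ) (AlgHom.id k _)

instance : Ring (FixedAlg k σ) :=
  inferInstanceAs (Ring (AlgHom.equalizer (frob k σ) (AlgHom.id k _)))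

instance : Algebra k (FixedAlg k σ) :=
  inferInstanceAs (Algebra k (AlgHom.equalizer (frob k σ) (AlgHom.id k _)))

/-! ### Dimension vectors -/

/-- The field `D_i` of `q ^ ε_i` elements attached to an orbit `i`, as the set of families
`(f_a)_{a ∈ i}` with `f_{σ a} = f_a ^ q`; each coordinate identifies it with the subfield of
`q ^ ε_i` elements of the algebraic closure. -/
def orbitField (i : σ.Orbit) : Subring ({a : V // σ.orbit a = i} → AlgebraicClosure k) where
  carrier := {f | ∀ a, f ⟨σ.hom.obj a.1, (σ.orbit_hom a.1).trans a.2⟩ = f a ^ Fintype.card k}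
  mul_mem' {f g} hf hg a := by simp only [Pi.mul_apply, hf a, hg a, mul_pow]
  one_mem' a := by simp only [Pi.one_apply, one_pow]
  add_mem' {f g} hf hg a := by simp only [Pi.add_apply, hf a, hg a, pow_card_add]
  zero_mem' a := by simp only [Pi.zero_apply, zero_pow Fintype.card_ne_zero]
  neg_mem' {f} hf a := by
    simp only [Pi.neg_apply, hf a]
    exact (map_neg (FiniteField.frobeniusAlgHom k (AlgebraicClosure k)) (f a)).symm

open Classical in
/-- The element `∑_{a ∈ i} f_a e_a` of the path algebra. -/
def diag (i : σ.Orbit) (f : {a : V // σ.orbit a = i} → AlgebraicClosure k) :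
    PathAlgebra (AlgebraicClosure k) V :=
  ∑ a : {a : V // σ.orbit a = i}, PathAlgebra.monomial ⟨a.1, a.1, Quiver.Path.nil⟩ (f a)

lemma frob_diag (i : σ.Orbit) (f : orbitField k σ i) :
    frob k σ (diag k σ i f.1) = diag k σ i f.1 := by
  classical
  change frobFun k σ (diag k σ i f.1) = diag k σ i f.1
  rw [diag, frobFun_sum]
  let e : Equiv.Perm {a : V // σ.orbit a = i} :=
    σ.vertexPerm.subtypePerm fun a => by
      change σ.orbit (σ.hom.obj a) = i ↔ _
      rw [σ.orbit_hom]
  refine Eq.trans (Finset.sum_congr rfl fun a _ => ?_)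
    (Equiv.sum_comp e fun a : {a : V // σ.orbit a = i} => (PathAlgebra.monomial ⟨a.1, a.1, Quiver.Path.nil⟩ (f.1 a) :
      PathAlgebra (AlgebraicClosure k) V))
  rw [frobFun_monomial, ← f.2 a]
  rfl

/-- The embedding of `D_i` in the fixed-point algebra, `f ↦ ∑_{a ∈ i} f_a e_a`. -/
def orbitEmb (i : σ.Orbit) (f : orbitField k σ i) : FixedAlg k σ :=
  ⟨diag k σ i f.1, frob_diag k σ i f⟩

/-- The idempotent `e_i`, the sum of the trivial paths at the vertices of the orbit `i`. -/
def idem (i : σ.Orbit) : FixedAlg k σ := orbitEmb k σ i 1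

lemma idem_def (i : σ.Orbit) : idem k σ i = orbitEmb k σ i 1 := rfl

lemma orbitEmb_add (i : σ.Orbit) (f g : orbitField k σ i) :
    orbitEmb k σ i (f + g) = orbitEmb k σ i f + orbitEmb k σ i g := by
  classical
  refine Subtype.ext ?_
  change diag k σ i (f.1 + g.1) = diag k σ i f.1 + diag k σ i g.1
  rw [diag, diag, diag, ← Finset.sum_add_distrib]
  exact Finset.sum_congr rfl fun a _ => Finsupp.single_add _ _ _

lemma orbitEmb_zero (i : σ.Orbit) : orbitEmb k σ i 0 = 0 := by
  have h := orbitEmb_add k σ i 0 0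
  rw [add_zero] at h
  exact left_eq_add.1 h

lemma orbitEmb_mul (i : σ.Orbit) (f g : orbitField k σ i) :
    orbitEmb k σ i (f * g) = orbitEmb k σ i f * orbitEmb k σ i g := by
  classical
  refine Subtype.ext ?_
  change diag k σ i (f.1 * g.1) = diag k σ i f.1 * diag k σ i g.1
  rw [diag, diag, diag, Finset.sum_mul]
  refine Finset.sum_congr rfl fun a _ => ?_
  rw [Finset.mul_sum, Finset.sum_eq_single a]
  · rw [PathAlgebra.monomial_mul_monomial, PathAlgebra.pathMul_of_comp, PathAlgebra.smul_monomial,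
      smul_eq_mul, mul_one]
    rfl
  · intro b _ hb
    rw [PathAlgebra.monomial_mul_monomial,
      PathAlgebra.pathMul_of_ne (by exact fun h => hb (Subtype.ext h)), smul_zero]
  · intro h
    exact absurd (Finset.mem_univ a) h

lemma idem_smul_orbitEmb_smul {M : Type u} [AddCommGroup M] [Module (FixedAlg k σ) M]
    (i : σ.Orbit) (f : orbitField k σ i) (m : M) :
    idem k σ i • orbitEmb k σ i f • m = orbitEmb k σ i f • m := by
  rw [smul_smul, idem_def, ← orbitEmb_mul, one_mul]

variable (M : Type u) [AddCommGroup M] [Module (FixedAlg k σ) M]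

/-- The space `e_i M`. -/
def VertexSpace (i : σ.Orbit) : Type u :=
  (DistribSMul.toAddMonoidHom M (idem k σ i)).range

instance (i : σ.Orbit) : AddCommGroup (VertexSpace k σ M i) :=
  inferInstanceAs (AddCommGroup (DistribSMul.toAddMonoidHom M (idem k σ i)).range)

/-- `e_i M` as a vector space over `D_i`. -/
instance (i : σ.Orbit) : Module (orbitField k σ i) (VertexSpace k σ M i) where
  smul f m := ⟨orbitEmb k σ i f • m.1, orbitEmb k σ i f • m.1, idem_smul_orbitEmb_smul k σ i f m.1⟩
  one_smul m := by
    obtain ⟨_, m, rfl⟩ := m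
    refine Subtype.ext ?_
    exact idem_smul_orbitEmb_smul k σ i 1 m
  mul_smul f g m := Subtype.ext (by
    change orbitEmb k σ i (f * g) • m.1 = orbitEmb k σ i f • orbitEmb k σ i g • m.1
    rw [smul_smul, ← orbitEmb_mul])
  smul_zero f := Subtype.ext (smul_zero (orbitEmb k σ i f))
  smul_add f m n := Subtype.ext (smul_add (orbitEmb k σ i f) m.1 n.1)
  add_smul f g m := Subtype.ext (by
    change orbitEmb k σ i (f + g) • m.1 = orbitEmb k σ i f • m.1 + orbitEmb k σ i g • m.1
    rw [orbitEmb_add, add_smul])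
  zero_smul m := Subtype.ext (by
    change orbitEmb k σ i 0 • m.1 = 0
    rw [orbitEmb_zero, zero_smul])

/-- The dimension vector `i ↦ dim_{D_i} e_i M`. -/
def dimVec : σ.Orbit → ℕ := fun i => Module.finrank (orbitField k σ i) (VertexSpace k σ M i)

end FixedPoints

/-! ## Finite modules, Auslander--Reiten translation, regular modules -/

section Modules

/-- The finite modules over a ring.  Over a finite-dimensional (or any) algebra over a finite field
these are the finite-dimensional modules. -/
def FinMod (A : Type u) [Ring A] : Type (u + 1) := {M : ModuleCat.{u} A // Finite M}

/-- Isomorphism of finite modules. -/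
instance isoSetoid (A : Type u) [Ring A] : Setoid (FinMod A) where
  r M N := Nonempty (M.1 ≃ₗ[A] N.1)
  iseqv := ⟨fun _ => ⟨LinearEquiv.refl _ _⟩, fun ⟨e⟩ => ⟨e.symm⟩, fun ⟨e⟩ ⟨f⟩ => ⟨e.trans f⟩⟩

/-- The isoclasses `[M]` of finite modules. -/
def IsoClass (A : Type u) [Ring A] : Type (u + 1) := Quotient (isoSetoid A)

variable {A : Type u} [Ring A]

/-- The isoclass of a finite module. -/
def isoClass (M : Type u) [AddCommGroup M] [Module A M] [h : Finite M] : IsoClass A :=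
  Quotient.mk _ ⟨ModuleCat.of A M, h⟩

/-- A module in a given isoclass. -/
def IsoClass.rep (m : IsoClass A) : ModuleCat.{u} A := (Quotient.out m).1

instance (m : IsoClass A) : Finite m.rep := (Quotient.out m).2

/-- Indecomposable modules. -/
def IsIndecomposable (A : Type u) [Ring A] (M : Type u) [AddCommGroup M] [Module A M] : Prop :=
  Nontrivial M ∧ ∀ N N' : Submodule A M, IsCompl N N' → N = ⊥ ∨ N' = ⊥

variable (k : Type u) [Field k] [Algebra k A]

/-- The left module `D Hom_A(P, A)`, where `D = Hom_k(-, k)`. -/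
def NakayamaDual (A : Type u) [Ring A] [Algebra k A] (P : Type u) [AddCommGroup P] [Module A P] :
    Type u := Module.Dual k (P →ₗ[A] A)

instance (P : Type u) [AddCommGroup P] [Module A P] : AddCommGroup (NakayamaDual k A P) :=
  inferInstanceAs (AddCommGroup (Module.Dual k (P →ₗ[A] A)))

/-- An element of `D Hom_A(P, A)` as a linear form. -/
def NakayamaDual.form {P : Type u} [AddCommGroup P] [Module A P] (φ : NakayamaDual k A P) :
    (P →ₗ[A] A) →ₗ[k] k := φ

/-- Right multiplication `g ↦ g a` on `Hom_A(P, A)`, where `(g a)(x) = g(x) a`. -/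
def rightMul (P : Type u) [AddCommGroup P] [Module A P] (a : A) :
    (P →ₗ[A] A) →ₗ[k] (P →ₗ[A] A) where
  toFun g := MulOpposite.op a • g
  map_add' g h := smul_add _ g h
  map_smul' c g := smul_comm (MulOpposite.op a) c g

/-- The left module structure `(a φ)(g) = φ(g a)`. -/
instance (P : Type u) [AddCommGroup P] [Module A P] : Module A (NakayamaDual k A P) where
  smul a φ := (NakayamaDual.form k φ ∘ₗ rightMul k P a : (P →ₗ[A] A) →ₗ[k] k)
  one_smul φ := LinearMap.ext fun g => congrArg (NakayamaDual.form k φ) (one_smul Aᵐᵒᵖ g)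
  mul_smul a b φ := LinearMap.ext fun g => congrArg (NakayamaDual.form k φ)
    (mul_smul (MulOpposite.op b) (MulOpposite.op a) g)
  smul_zero _ := LinearMap.ext fun _ => rfl
  smul_add _ _ _ := LinearMap.ext fun _ => rfl
  add_smul a b φ := LinearMap.ext fun g =>
    (congrArg (NakayamaDual.form k φ) (add_smul (MulOpposite.op a) (MulOpposite.op b) g)).trans
      (map_add (NakayamaDual.form k φ) _ _)
  zero_smul φ := LinearMap.ext fun g =>
    (congrArg (NakayamaDual.form k φ) (zero_smul Aᵐᵒᵖ g)).trans
      (map_zero (NakayamaDual.form k φ))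

/-- For `f : P₁ → P₀`, the dual of the cokernel of `Hom_A(P₀, A) → Hom_A(P₁, A)`, that is, the
`k`-linear forms on `Hom_A(P₁, A)` that vanish on all `g ∘ f`. -/
def dualCoker {P₁ P₀ : Type u} [AddCommGroup P₁] [Module A P₁] [AddCommGroup P₀] [Module A P₀]
    (f : P₁ →ₗ[A] P₀) : Submodule A (NakayamaDual k A P₁) where
  carrier := {φ | ∀ g : P₀ →ₗ[A] A, NakayamaDual.form k φ (g ∘ₗ f) = 0}
  add_mem' {φ ψ} hφ hψ g := by
    change NakayamaDual.form k φ (g ∘ₗ f) + NakayamaDual.form k ψ (g ∘ₗ f) = 0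
    rw [hφ g, hψ g, add_zero]
  zero_mem' g := rfl
  smul_mem' a φ hφ g := hφ (MulOpposite.op a • g)

/-- `N ≅ τ M` for the Auslander--Reiten translation `τ = D Tr` over a hereditary algebra, where
`τ M = D Ext¹_A(M, A)` is computed by a resolution `0 → P₁ → P₀ → M → 0` of `M` by finite
projective modules. -/
def IsARTranslate (N M : Type u) [AddCommGroup N] [Module A N] [AddCommGroup M] [Module A M] :
    Prop :=
  ∃ (P₁ P₀ : ModuleCat.{u} A) (f : P₁ →ₗ[A] P₀) (p : P₀ →ₗ[A] M),
    Finite P₁ ∧ Finite P₀ ∧ Module.Projective A P₁ ∧ Module.Projective A P₀ ∧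
    Function.Injective f ∧ Function.Exact f p ∧ Function.Surjective p ∧
    Nonempty (N ≃ₗ[A] dualCoker k f)

/-- Indecomposable postprojective modules: those of the form `τ⁻ᵐ P` with `P` indecomposable
projective and `m ≥ 0`. -/
inductive IsIndecPostprojective (k : Type u) [Field k] {A : Type u} [Ring A] [Algebra k A] :
    ModuleCat.{u} A → Prop
  | projective (P : ModuleCat.{u} A) (hf : Finite P) (hi : IsIndecomposable A P)
      (hp : Module.Projective A P) : IsIndecPostprojective k P
  | step (N M : ModuleCat.{u} A) (hf : Finite M) (hi : IsIndecomposable A M)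
      (ht : IsARTranslate (A := A) k N M) (hN : IsIndecPostprojective k N) : IsIndecPostprojective k M

/-- Indecomposable preinjective modules: those of the form `τᵐ J` with `J` indecomposable
injective and `m ≥ 0`. -/
inductive IsIndecPreinjective (k : Type u) [Field k] {A : Type u} [Ring A] [Algebra k A] :
    ModuleCat.{u} A → Prop
  | injective (J : ModuleCat.{u} A) (hf : Finite J) (hi : IsIndecomposable A J)
      (hj : Module.Injective A J) : IsIndecPreinjective k J
  | step (N M : ModuleCat.{u} A) (hf : Finite N) (hi : IsIndecomposable A N)
      (ht : IsARTranslate (A := A) k N M) (hM : IsIndecPreinjective k M) : IsIndecPreinjective k N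

/-- A module is regular if none of its indecomposable direct summands is postprojective or
preinjective. -/
def IsRegularModule (k : Type u) [Field k] {A : Type u} [Ring A] [Algebra k A]
    (M : ModuleCat.{u} A) : Prop :=
  ∀ N N' : Submodule A M, IsCompl N N' → IsIndecomposable A N →
    ¬ IsIndecPostprojective k (ModuleCat.of A N) ∧ ¬ IsIndecPreinjective k (ModuleCat.of A N)

/-! ## Hall numbers -/

/-- The Hall number `F^L_{M,N}`: the number of submodules `X` of `L` with `X ≅ N` and
`L / X ≅ M`. -/
def hallNumber (L M N : IsoClass A) : ℕ :=
  Nat.card {X : Submodule A L.rep // Nonempty (X ≃ₗ[A] N.rep) ∧ Nonempty ((L.rep ⧸ X) ≃ₗ[A] M.rep)}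

/-- The number `a_M` of automorphisms of `M`. -/
def autCard (M : IsoClass A) : ℕ := Nat.card (M.rep ≃ₗ[A] M.rep)

lemma IsoClass.eq_of_equiv {m n : IsoClass A} (e : Nonempty (m.rep ≃ₗ[A] n.rep)) : m = n := by
  rw [← Quotient.out_eq m, ← Quotient.out_eq n]
  exact Quotient.sound e

/-- Only finitely many Hall numbers `F^L_{M,N}` with a given `L` are non-zero. -/
lemma finite_hallNumber_ne_zero (L : IsoClass A) :
    {p : IsoClass A × IsoClass A | hallNumber L p.1 p.2 ≠ 0}.Finite := by
  have hS : Finite (Submodule A L.rep) :=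
    Finite.of_injective (fun X : Submodule A L.rep => (X : Set L.rep)) SetLike.coe_injective
  have key : ∀ p : {p : IsoClass A × IsoClass A | hallNumber L p.1 p.2 ≠ 0},
      ∃ X : Submodule A L.rep, Nonempty (X ≃ₗ[A] p.1.2.rep) ∧
        Nonempty ((L.rep ⧸ X) ≃ₗ[A] p.1.1.rep) := by
    rintro ⟨p, hp⟩
    obtain ⟨⟨X, hX⟩⟩ := (Nat.card_ne_zero.1 hp).1
    exact ⟨X, hX⟩
  choose X hX using key
  refine Set.finite_coe_iff.1 ?_
  exact Finite.of_injective X fun p p' h => by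
    obtain ⟨⟨e⟩, ⟨f⟩⟩ := hX p
    obtain ⟨⟨e'⟩, ⟨f'⟩⟩ := hX p'
    rw [← h] at e' f'
    exact Subtype.ext (Prod.ext (IsoClass.eq_of_equiv ⟨f.symm.trans f'⟩)
      (IsoClass.eq_of_equiv ⟨e.symm.trans e'⟩))

end Modules

/-! ## The Ringel--Hall algebra as a graded coalgebra -/

section Hall

variable (k : Type u) [Field k] [Fintype k] {V : Type u} [Quiver.{u} V] [Fintype V]
  [∀ a b : V, Fintype (a ⟶ b)] (σ : QuiverAut V)

/-- The isoclasses of finite-dimensional modules over `A = 𝔄(Q,σ;q)`. -/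
abbrev Iso : Type (u + 1) := IsoClass (FixedAlg k σ)

/-- The underlying complex vector space of the Ringel--Hall algebra of `(Q,σ)`, with the isoclasses
as basis. -/
abbrev Hall : Type (u + 1) := Iso k σ →₀ ℂ

/-- The dimension vector of an isoclass. -/
def Iso.dim (m : Iso k σ) : σ.Orbit → ℕ := dimVec k σ m.rep

/-- The Euler form of the dimension vectors of two isoclasses. -/
def eulerIso (m n : Iso k σ) : ℤ :=
  σ.euler (fun i => (Iso.dim k σ m i : ℤ)) (fun i => (Iso.dim k σ n i : ℤ))

/-- `v = √q`. -/
def v : ℂ := (Real.sqrt (Fintype.card k) : ℂ)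

/-- The identity element `[0]`. -/
def hallOne : Hall k σ := Finsupp.single (isoClass PUnit) 1

open Classical in
/-- For a class `C` of modules, the map
`[M] ↦ ∑_{[X],[Y], X,Y ∈ C} v ^ ⟨dim X, dim Y⟩ (a_X a_Y / a_M) F^M_{X,Y} [X] ⊗ [Y]`. -/
def comulOn (C : Set (Iso k σ)) : Hall k σ →ₗ[ℂ] Hall k σ ⊗[ℂ] Hall k σ :=
  Finsupp.linearCombination ℂ fun m =>
    ∑ p ∈ (finite_hallNumber_ne_zero m).toFinset with p.1 ∈ C ∧ p.2 ∈ C,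
      (v k ^ eulerIso k σ p.1 p.2 * ((autCard p.1 : ℂ) * (autCard p.2 : ℂ) / (autCard m : ℂ)) *
        (hallNumber m p.1 p.2 : ℂ)) •
        ((Finsupp.single p.1 1 : Hall k σ) ⊗ₜ[ℂ] (Finsupp.single p.2 1 : Hall k σ))

/-- The comultiplication of the Ringel--Hall algebra. -/
def comul : Hall k σ →ₗ[ℂ] Hall k σ ⊗[ℂ] Hall k σ := comulOn k σ Set.univ

/-- The homogeneous component of degree `d`, spanned by the `[M]` with `dim M = d`. -/
def hallDeg (d : σ.Orbit → ℕ) : Submodule ℂ (Hall k σ) :=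
  Finsupp.supported ℂ ℂ {m | Iso.dim k σ m = d}

/-- The map `x ↦ x ⊗ 1 + 1 ⊗ x`. -/
def primPart : Hall k σ →ₗ[ℂ] Hall k σ ⊗[ℂ] Hall k σ :=
  (TensorProduct.mk ℂ (Hall k σ) (Hall k σ)).flip (hallOne k σ) +
    TensorProduct.mk ℂ (Hall k σ) (Hall k σ) (hallOne k σ)

/-- The primitive elements of degree `d` of the Ringel--Hall algebra. -/
def prim (d : σ.Orbit → ℕ) : Submodule ℂ (Hall k σ) :=
  hallDeg k σ d ⊓ LinearMap.eqLocus (comul k σ) (primPart k σ)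

/-- The isoclasses of regular modules. -/
def regIso : Set (Iso k σ) := {m | IsRegularModule k m.rep}

/-- The degree `d` component of the subspace `H(R_A)` spanned by the regular modules. -/
def regDeg (d : σ.Orbit → ℕ) : Submodule ℂ (Hall k σ) :=
  Finsupp.supported ℂ ℂ (regIso k σ) ⊓ hallDeg k σ d

/-- The regular primitive elements of degree `d`: the `x` of degree `d` in `H(R_A)` with
`Δ_R(x) = x ⊗ 1 + 1 ⊗ x`, where `Δ_R` is the comultiplication of `H(R_A)`. -/
def regPrim (d : σ.Orbit → ℕ) : Submodule ℂ (Hall k σ) :=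
  regDeg k σ d ⊓ LinearMap.eqLocus (comulOn k σ (regIso k σ)) (primPart k σ)

/-- The linear map `[M] ↦ 1 / a_M`. -/
def integral : Hall k σ →ₗ[ℂ] ℂ :=
  Finsupp.linearCombination ℂ fun m => 1 / (autCard m : ℂ)

/-- The linear map `I^reg_d` on the degree `d` component of `H(R_A)`, `[M] ↦ 1 / a_M`. -/
def regIntegral (d : σ.Orbit → ℕ) : regDeg k σ d →ₗ[ℂ] ℂ := (integral k σ).domRestrict _

/-- The kernel of `I^reg_d`, as a subspace of the Ringel--Hall algebra. -/
def kerRegIntegral (d : σ.Orbit → ℕ) : Submodule ℂ (Hall k σ) :=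
  (LinearMap.ker (regIntegral k σ d)).map (regDeg k σ d).subtype

end Hall

end HallPrim

end

noncomputable section

open scoped TensorProduct
open Function

namespace HallPrim

/-! ## Derivations and extensions -/

/-! Let x = ∑ μ_M [M] be primitive of degree α, and give each M in its support the weight c_M = μ_M
/ a_M. Comparing coefficients at [X] ⊗ [Y], primitivity says that ∑ c_M F^M_{X,Y} = 0 for all
non-zero X and Y (`sum_hallNumber_eq_zero`). So the support never contains exactly one extension of
X by Y (`IsHallFamily.false_of_unique`). Moreover every M in the support has self-extensions: ⟨α, α⟩
≤ 0 on the fundamental set (`euler_le_zero_of_mem_fundamentalSet`), whereas ⟨dim L, dim L⟩ > 0 for L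
≠ 0 with Ext¹(L, L) = 0 (`ExtZero.euler_pos`). `IsHallFamily` collects these facts.

Regularity. If Ext¹(N, M) = 0 for all M in the support, then Hom(M, N) = 0 for all of them
(`IsHallFamily.hom_eq_zero`). Indeed let f : M → N be non-zero with image I and kernel K. As A is
hereditary, Ext¹(I, M') = 0 for each M' in the support. If K = 0, then M embeds in N and Ext¹(M, M)
= 0, which is excluded. Otherwise any M' in the support that is an extension of I by K is isomorphic
to M, by a pushout and cancellation (`nonempty_equiv_of_extZero_left`), and the relation at (I, K)
has a single non-zero term. This applies to projective N. Since Hom(M, τN) = 0 implies Ext¹(N, M) =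
0 (`extZero_of_hom_dualCoker`), induction reaches all postprojective N. The preinjective case is
dual, so no M in the support has a summand of either kind.

Kernel of the integral. Let i be a sink of the support of α. Then e_i M is a non-zero proper
submodule of every M in the support, and it is recognised by the isoclasses of e_i M and M / e_i M.
The Hall numbers for such pairs are 0 or 1, and summing the relations over the pairs that occur
gives ∑ c_M = 0 (`IsHallFamily.sum_eq_zero`).

Ext¹ is handled throughout by derivations of A in Hom_k(X, Y) modulo inner ones. Heredity and
positivity of the Euler form come from the path algebra, whose derivations are free on the arrows,
and descend to A along `descent`. -/

/-- A finite projective module has a finite dual basis. -/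
lemma exists_dualBasis (A : Type*) [Ring A] (P : Type*) [AddCommGroup P] [Module A P] [Fintype P]
    [Module.Projective A P] : ∃ d : P → P →ₗ[A] A, ∀ x, ∑ y, d y x • y = x := by
  -- Projectivity gives a section of the canonical map from the free module on the set P; its
  -- coordinates are a dual basis indexed by P itself.
  obtain ⟨d, hd⟩ := Module.projective_def.1 ‹Module.Projective A P›
  refine ⟨fun y => Finsupp.lapply y ∘ₗ d, fun x => ?_⟩
  conv_rhs => rw [← hd x]
  rw [Finsupp.linearCombination_apply, Finsupp.sum_fintype _ _ fun y => by rw [zero_smul]]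
  rfl

section Extensions

variable (k A : Type u) [Field k] [Ring A] [Algebra k A]

/-- Derivations of `A` with values in the bimodule `Hom_k(X, Y)`. -/
def IsDer {X Y : Type u} [AddCommGroup X] [Module k X] [Module A X]
    [AddCommGroup Y] [Module k Y] [Module A Y] (δ : A →ₗ[k] X →ₗ[k] Y) : Prop :=
  ∀ a b x, δ (a * b) x = a • δ b x + δ a (b • x)

/-- The vanishing of `Ext¹_A(X, Y)`: all derivations of `A` in `Hom_k(X, Y)` are inner. -/
def ExtZero (X Y : Type u) [AddCommGroup X] [Module k X] [Module A X]
    [AddCommGroup Y] [Module k Y] [Module A Y] : Prop :=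
  ∀ δ : A →ₗ[k] X →ₗ[k] Y, IsDer k A δ →
    ∃ s : X →ₗ[k] Y, ∀ a x, δ a x = a • s x - s (a • x)

variable {k A}

variable {X Y E : Type u} [AddCommGroup X] [Module k X] [Module A X] [IsScalarTower k A X]
  [AddCommGroup Y] [Module k Y] [Module A Y] [IsScalarTower k A Y]
  [AddCommGroup E] [Module k E] [Module A E] [IsScalarTower k A E]

variable {C : Type u} [AddCommGroup C] [Module k C] [Module A C] [IsScalarTower k A C]

/-- If `Ext¹(X, Y) = 0`, then morphisms from `X` lift along surjections with kernel `Y`. -/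
lemma ExtZero.exists_lift (h : ExtZero k A X Y) (i : Y →ₗ[A] E) (p : E →ₗ[A] C)
    (hi : Injective i) (hip : Exact i p) (hp : Surjective p) (g : X →ₗ[A] C) :
    ∃ u : X →ₗ[A] E, ∀ x, p (u x) = g x := by
  obtain ⟨t₀, ht₀⟩ := (p.restrictScalars k).exists_rightInverse_of_surjective
    (LinearMap.range_eq_top.2 hp)
  -- A k-linear lift of g. Its defect a t(x) - t(a x) lies in the kernel Y and is a derivation; if s
  -- makes it inner, then t - i ∘ s is A-linear.
  let t := t₀ ∘ₗ g.restrictScalars k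
  have ht : ∀ x, p (t x) = g x := fun x => LinearMap.congr_fun ht₀ (g x)
  obtain ⟨r, hr⟩ := (i.restrictScalars k).exists_leftInverse_of_injective
    (LinearMap.ker_eq_bot.2 hi)
  replace hr : ∀ z, p z = 0 → i (r z) = z := fun z hz => by
    obtain ⟨y, rfl⟩ := (hip z).1 hz
    exact congrArg i (LinearMap.congr_fun hr y)
  let δ : A →ₗ[k] X →ₗ[k] Y := LinearMap.mk₂ k (fun a x => r (a • t x - t (a • x)))
    (fun a b x => by simp only [add_smul, map_add, map_sub]; abel)
    (fun c a x => by simp only [smul_assoc, map_smul, ← smul_sub])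
    (fun a x y => by simp only [smul_add, map_add, map_sub]; abel)
    (fun c a x => by
      rw [map_smul, smul_comm a c x, map_smul, smul_comm a c (t x), ← smul_sub, map_smul])
  have hδ : ∀ a x, i (δ a x) = a • t x - t (a • x) := fun a x =>
    hr _ (by rw [map_sub, map_smul, ht, ht, map_smul, sub_self])
  obtain ⟨s, hs⟩ := h δ fun a b x => hi (by
    rw [map_add, map_smul, hδ, hδ, hδ, mul_smul, smul_sub, mul_smul]; abel)
  refine ⟨{ toFun := fun x => t x - i (s x)
            map_add' := fun x y => by rw [map_add, map_add, map_add]; abel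
            map_smul' := fun a x => ?_ }, fun x => ?_⟩
  · have := hδ a x
    rw [hs, map_sub, map_smul] at this
    rw [RingHom.id_apply, smul_sub]
    rw [sub_eq_sub_iff_add_eq_add] at this ⊢
    rw [add_comm, add_comm (a • t x), add_comm (i _), this, add_comm]
  · change p (t x - i (s x)) = g x
    rw [map_sub, ht, hip.apply_apply_eq_zero, sub_zero]

/-- If `Ext¹(X, Y) = 0`, then morphisms to `Y` extend along injections with cokernel `X`. -/
lemma ExtZero.exists_extend (h : ExtZero k A X Y) (i : C →ₗ[A] E) (p : E →ₗ[A] X)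
    (hi : Injective i) (hip : Exact i p) (hp : Surjective p) (g : C →ₗ[A] Y) :
    ∃ u : E →ₗ[A] Y, ∀ x, u (i x) = g x := by
  obtain ⟨t, ht⟩ := (p.restrictScalars k).exists_rightInverse_of_surjective
    (LinearMap.range_eq_top.2 hp)
  replace ht : ∀ x, p (t x) = x := fun x => LinearMap.congr_fun ht x
  obtain ⟨r₀, hr₀⟩ := (i.restrictScalars k).exists_leftInverse_of_injective
    (LinearMap.ker_eq_bot.2 hi)
  -- A k-linear extension of g. Its defect a r(z) - r(a z) vanishes on the image of i, so it
  -- descends to a derivation on X; if s makes it inner, then r - s ∘ p is A-linear.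
  let r := g.restrictScalars k ∘ₗ r₀
  have hr : ∀ x, r (i x) = g x := fun x => congrArg g (LinearMap.congr_fun hr₀ x)
  have hrz : ∀ (a : A) z, p z = 0 → a • r z = r (a • z) := fun a z hz => by
    obtain ⟨y, rfl⟩ := (hip z).1 hz
    rw [← i.map_smul, hr, hr, g.map_smul]
  let δ : A →ₗ[k] X →ₗ[k] Y := LinearMap.mk₂ k (fun a x => a • r (t x) - r (a • t x))
    (fun a b x => by simp only [add_smul, map_add]; abel)
    (fun c a x => by simp only [smul_assoc, map_smul, ← smul_sub])
    (fun a x y => by simp only [smul_add, map_add]; abel)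
    (fun c a x => by
      rw [map_smul, map_smul, smul_comm a c, smul_comm a c (t x), map_smul, ← smul_sub])
  have hδ : ∀ a z, δ a (p z) = a • r z - r (a • z) := fun a z => by
    have := hrz a (z - t (p z)) (by rw [p.map_sub, ht, sub_self])
    rw [r.map_sub, smul_sub, smul_sub, map_sub, sub_eq_sub_iff_sub_eq_sub] at this
    exact this.symm
  obtain ⟨s, hs⟩ := h δ fun a b x => by
    have h1 := hδ (a * b) (t x)
    have h2 := hδ b (t x)
    have h3 := hδ a (b • t x)
    rw [map_smul] at h3
    rw [ht] at h1 h2 h3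
    rw [h1, h2, h3, mul_smul, mul_smul, smul_sub]
    abel
  refine ⟨{ toFun := fun x => r x - s (p x)
            map_add' := fun x y => by rw [map_add, map_add, map_add]; abel
            map_smul' := fun a x => ?_ }, fun x => ?_⟩
  · have := hδ a x
    rw [hs] at this
    rw [RingHom.id_apply, smul_sub, p.map_smul]
    rw [sub_eq_sub_iff_add_eq_add] at this ⊢
    rw [add_comm, this, add_comm]
  · change r (i x) - s (p (i x)) = g x
    rw [hip.apply_apply_eq_zero, map_zero, sub_zero, hr]

/-- `Ext¹` vanishes on a finite projective module. -/
lemma extZero_of_projective [Finite X] [Module.Projective A X] : ExtZero k A X Y := by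
  have := Fintype.ofFinite X
  obtain ⟨d, hd⟩ := exists_dualBasis A X
  intro δ hδ
  -- The derivation rule gives ∑ δ(a d_y(x)) y = a ∑ δ(d_y(x)) y + δ(a)(∑ d_y(x) y), and the last
  -- term is δ(a) x.
  refine ⟨-∑ y, (δ.flip y ∘ₗ (d y).restrictScalars k), fun a x => ?_⟩
  simp only [LinearMap.neg_apply, LinearMap.sum_apply, LinearMap.comp_apply, LinearMap.flip_apply,
    LinearMap.restrictScalars_apply, map_smul, smul_eq_mul, hδ a]
  rw [Finset.sum_add_distrib, ← map_sum, hd, ← Finset.smul_sum]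
  simp

/-- The coinduced module `Hom_k(A, Y)`. -/
def Coind (k A Y : Type u) [Field k] [Ring A] [Algebra k A] [AddCommGroup Y] [Module k Y] : Type u :=
  A →ₗ[k] Y

instance : AddCommGroup (Coind k A Y) := inferInstanceAs (AddCommGroup (A →ₗ[k] Y))

/-- An element of the coinduced module as a linear map. -/
def Coind.toLin (f : Coind k A Y) : A →ₗ[k] Y := f

/-- A linear map as an element of the coinduced module. -/
def Coind.of : (A →ₗ[k] Y) →+ Coind k A Y := AddMonoidHom.id (A →ₗ[k] Y)

instance : Module A (Coind k A Y) where
  smul a f := (Coind.toLin f ∘ₗ LinearMap.mulRight k a : A →ₗ[k] Y)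
  one_smul f := LinearMap.ext fun b => congrArg f.toLin (mul_one b)
  mul_smul a b f := LinearMap.ext fun c => congrArg f.toLin (mul_assoc c a b).symm
  smul_zero _ := LinearMap.ext fun _ => rfl
  smul_add _ _ _ := LinearMap.ext fun _ => rfl
  add_smul a b f := LinearMap.ext fun c => (congrArg f.toLin (mul_add c a b)).trans (map_add _ _ _)
  zero_smul f := LinearMap.ext fun c => (congrArg f.toLin (mul_zero c)).trans (map_zero _)

/-- `Ext¹` vanishes on an injective module. -/
lemma extZero_of_injective (hY : Module.Injective A Y) : ExtZero k A X Y := by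
  intro δ hδ
  -- The map y ↦ (b ↦ b y) embeds Y in Hom_k(A, Y). A retraction r of it exists by injectivity, and
  -- s(x) = r(b ↦ δ(b) x) makes δ inner.
  let ι : Y →ₗ[A] Coind k A Y :=
    { toFun := fun y => ((Algebra.lsmul k k Y).toLinearMap.flip y : A →ₗ[k] Y)
      map_add' := fun y z => map_add (Algebra.lsmul k k Y).toLinearMap.flip y z
      map_smul' := fun a y => LinearMap.ext fun b => (mul_smul b a y).symm }
  have hι : Injective ι := fun y z h => by
    have : (1 : A) • y = (1 : A) • z := LinearMap.congr_fun (f := ι y) (g := ι z) h 1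
    rwa [one_smul, one_smul] at this
  obtain ⟨r, hr⟩ := hY.out ι hι LinearMap.id
  have key : ∀ a x, a • Coind.of (δ.flip x) = ι (δ a x) + Coind.of (δ.flip (a • x)) :=
    fun a x => LinearMap.ext fun b => (hδ b a x : _)
  have hsm : ∀ (c : k) (f : A →ₗ[k] Y), r (Coind.of (c • f)) = c • r (Coind.of f) := fun c f => by
    rw [← algebraMap_smul A c (r _), ← map_smul]
    refine congrArg r (LinearMap.ext fun b => ?_)
    change c • f b = f (b * algebraMap k A c)
    rw [← Algebra.commutes, ← Algebra.smul_def, map_smul]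
  refine ⟨{ toFun := fun x => r (Coind.of (δ.flip x))
            map_add' := fun x y => by rw [map_add, map_add, map_add]
            map_smul' := fun c x => by rw [map_smul, hsm]; rfl }, fun a x => ?_⟩
  change _ = a • r (Coind.of (δ.flip x)) - r (Coind.of (δ.flip (a • x)))
  rw [← map_smul, key, map_add, hr]
  simp

end Extensions

/-! ## The Auslander--Reiten formula -/

section AuslanderReiten

variable {k A : Type u} [Field k] [Ring A] [Algebra k A]
variable {P₁ P₀ M L N : Type u} [AddCommGroup P₁] [Module k P₁] [Module A P₁] [IsScalarTower k A P₁]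
  [AddCommGroup P₀] [Module k P₀] [Module A P₀] [IsScalarTower k A P₀]
  [AddCommGroup M] [Module k M] [Module A M] [IsScalarTower k A M]
  [AddCommGroup L] [Module k L] [Module A L] [IsScalarTower k A L]
  [AddCommGroup N] [Module k N] [Module A N] [IsScalarTower k A N]

/-- The linear map `l ↦ (h ↦ λ(h(-) l))` attached to a form `λ` on `Hom_A(P, L)`. -/
def toNakayama (lam : (P₁ →ₗ[A] L) →ₗ[k] k) : L →ₗ[A] NakayamaDual k A P₁ where
  toFun l := (lam ∘ₗ
    { toFun := fun h => LinearMap.toSpanSingleton A L l ∘ₗ h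
      map_add' := fun g h => LinearMap.comp_add _ _ _
      map_smul' := fun c h => LinearMap.ext fun x => smul_assoc c (h x) l } :
        (P₁ →ₗ[A] A) →ₗ[k] k)
  map_add' l m := LinearMap.ext fun h => by
    refine Eq.trans (congrArg lam ?_) (map_add lam _ _)
    exact LinearMap.ext fun x => smul_add (h x) l m
  map_smul' a l := LinearMap.ext fun h => by
    refine congrArg lam (LinearMap.ext fun x => ?_)
    exact smul_smul (h x) a l

/-- Precomposition with `f`. -/
def precomp (k : Type u) [Field k] [Algebra k A] (L : Type u) [AddCommGroup L] [Module k L]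
    [Module A L] [IsScalarTower k A L] (f : P₁ →ₗ[A] P₀) : (P₀ →ₗ[A] L) →ₗ[k] (P₁ →ₗ[A] L) where
  toFun g := g ∘ₗ f
  map_add' _ _ := LinearMap.add_comp _ _ _
  map_smul' _ _ := rfl

/-- If `Hom(L, τM) = 0`, then `Ext¹(M, L) = 0`. -/
lemma extZero_of_hom_dualCoker [Finite P₁] [Finite P₀] [Module.Projective A P₁]
    [Module.Projective A P₀] (f : P₁ →ₗ[A] P₀) (p : P₀ →ₗ[A] M)
    (hfp : Exact f p) (hp : Surjective p) (h : ∀ g : L →ₗ[A] dualCoker k f, g = 0) :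
    ExtZero k A M L := by
  have := Fintype.ofFinite P₁
  intro δ hδ
  -- Pulled back to the projective module P₀, the derivation becomes inner, by s. As p ∘ f = 0, the
  -- composite s ∘ f is A-linear.
  obtain ⟨s, hs⟩ := extZero_of_projective (X := P₀) (Y := L)
    ((LinearMap.lcomp k L (p.restrictScalars k)) ∘ₗ δ) fun a b x => by
      simpa using hδ a b (p x)
  replace hs : ∀ a x, δ a (p x) = a • s x - s (a • x) := hs
  let g : P₁ →ₗ[A] L :=
    { toFun := fun x => s (f x)
      map_add' := fun x y => by rw [map_add, map_add]
      map_smul' := fun a x => by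
        have := hs a (f x)
        rw [hfp.apply_apply_eq_zero, map_zero, eq_comm, sub_eq_zero] at this
        rw [map_smul, ← this]; rfl }
  -- Otherwise some form λ on Hom(P₁, L) vanishes on all maps through f but not on g. It induces a
  -- map L → τM, which is zero by hypothesis. A dual basis of P₁ writes g as a sum of maps x ↦
  -- d_y(x) g(y), and λ vanishes on each of these.
  have hg : g ∈ LinearMap.range (precomp k L f) := by
    by_contra hg
    obtain ⟨lam, hlam, hker⟩ := Submodule.exists_le_ker_of_notMem hg
    have hmem : ∀ l, toNakayama lam l ∈ dualCoker k f := fun l h' =>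
      hker ⟨LinearMap.toSpanSingleton A L l ∘ₗ h', rfl⟩
    have h0 := h ((toNakayama lam).codRestrict _ hmem)
    obtain ⟨d, hd⟩ := exists_dualBasis A P₁
    apply hlam
    have : g = ∑ y, LinearMap.toSpanSingleton A L (g y) ∘ₗ d y := LinearMap.ext fun x => by
      conv_lhs => rw [← hd x, map_sum]
      simp
    rw [this, map_sum]
    refine Finset.sum_eq_zero fun y _ => ?_
    have := congrArg (NakayamaDual.form k) (congrArg Subtype.val (LinearMap.congr_fun h0 (g y)))
    exact LinearMap.congr_fun this (d y)
  obtain ⟨h', hh'⟩ := hg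
  replace hh' : ∀ x, h' (f x) = s (f x) := fun x => LinearMap.congr_fun hh' x
  have hq : ∀ x, p x = 0 → s x = h' x := fun x hx => by
    obtain ⟨y, rfl⟩ := (hfp x).1 hx
    exact (hh' y).symm
  obtain ⟨t, ht⟩ := (p.restrictScalars k).exists_rightInverse_of_surjective
    (LinearMap.range_eq_top.2 hp)
  replace ht : ∀ x, p (t x) = x := fun x => LinearMap.congr_fun ht x
  -- Subtracting the A-linear h' does not change the inner derivation, and s - h' vanishes on the
  -- kernel of p, so it descends to M.
  refine ⟨(s - h'.restrictScalars k) ∘ₗ t, fun a x => ?_⟩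
  have h1 := hq (t (a • x) - a • t x) (by rw [map_sub, ht, map_smul, ht, sub_self])
  have h2 := hs a (t x)
  rw [ht] at h2
  simp only [LinearMap.comp_apply, LinearMap.sub_apply, LinearMap.restrictScalars_apply, h2,
    map_sub, map_smul, smul_sub] at h1 ⊢
  rw [sub_eq_iff_eq_add] at h1
  rw [h1]; abel

lemma NakayamaDual.smul_form (a : A) (φ : NakayamaDual k A P₁) (h : P₁ →ₗ[A] A) :
    (a • φ).form k h = φ.form k (MulOpposite.op a • h) := rfl

lemma NakayamaDual.add_form (φ ψ : NakayamaDual k A P₁) (h : P₁ →ₗ[A] A) :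
    (φ + ψ).form k h = φ.form k h + ψ.form k h := rfl

lemma NakayamaDual.ext {φ ψ : NakayamaDual k A P₁} (h : ∀ g, φ.form k g = ψ.form k g) : φ = ψ :=
  LinearMap.ext h

lemma NakayamaDual.algebraMap_smul_form (c : k) (φ : NakayamaDual k A P₁) (h : P₁ →ₗ[A] A) :
    (algebraMap k A c • φ).form k h = c • φ.form k h := by
  rw [NakayamaDual.smul_form, ← map_smul]
  refine congrArg _ (LinearMap.ext fun x => ?_)
  change h x * algebraMap k A c = c • h x
  rw [← Algebra.commutes, ← Algebra.smul_def]

/-- The expansion of a linear map `P → A` in terms of a dual basis. -/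
lemma eq_sum_dualBasis [Fintype P₁] {d : P₁ → P₁ →ₗ[A] A} (hd : ∀ x, ∑ y, d y x • y = x)
    (h : P₁ →ₗ[A] A) : h = ∑ y, MulOpposite.op (h y) • d y := LinearMap.ext fun x => by
  conv_lhs => rw [← hd x, map_sum]
  simp

lemma IsDer.algebraMap {δ : A →ₗ[k] M →ₗ[k] L} (hδ : IsDer k A δ) (c : k) (x : M) :
    δ (algebraMap k A c) x = 0 := by
  have h1 : δ 1 x = 0 := by
    have := hδ 1 1 x
    rwa [mul_one, one_smul, one_smul, left_eq_add] at this
  rw [Algebra.algebraMap_eq_smul_one, map_smul, LinearMap.smul_apply, h1, smul_zero]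

/-- If `Hom(M, L) = 0`, then `Ext¹(L, τM) = 0`. -/
lemma extZero_dualCoker [Finite P₁] [Finite P₀] [Module.Projective A P₁]
    [Module.Projective A P₀] (f : P₁ →ₗ[A] P₀) (p : P₀ →ₗ[A] M)
    (hfp : Exact f p) (hp : Surjective p) (e : N ≃ₗ[A] dualCoker k f)
    (h : ∀ g : M →ₗ[A] L, g = 0) : ExtZero k A L N := by
  have := Fintype.ofFinite P₁
  have := Fintype.ofFinite P₀
  obtain ⟨d, hd⟩ := exists_dualBasis A P₁
  obtain ⟨d', hd'⟩ := exists_dualBasis A P₀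
  intro δ hδ
  have he : ∀ (c : k) n h, (e (c • n)).1.form k h = c • (e n).1.form k h := fun c n h => by
    rw [← algebraMap_smul A c n, map_smul]
    exact NakayamaDual.algebraMap_smul_form c _ _
  -- In the larger module D Hom(P₁, A) the derivation is inner, by this explicit s built from a dual
  -- basis of P₁. What remains is to move s into the submodule τM.
  let s₀ : L → NakayamaDual k A P₁ := fun l => (
    { toFun := fun h => ∑ y, (e (δ (h y) l)).1.form k (d y)
      map_add' := fun g h => by
        rw [← Finset.sum_add_distrib]
        exact Finset.sum_congr rfl fun y _ => by
          rw [LinearMap.add_apply, map_add, LinearMap.add_apply, map_add]; rfl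
      map_smul' := fun c g => by
        rw [RingHom.id_apply, Finset.smul_sum]
        exact Finset.sum_congr rfl fun y _ => by
          rw [LinearMap.smul_apply, map_smul, LinearMap.smul_apply, he] } : (P₁ →ₗ[A] A) →ₗ[k] k)
  have hs : ∀ l h, (s₀ l).form k h = ∑ y, (e (δ (h y) l)).1.form k (d y) := fun _ _ => rfl
  let s : L →+ NakayamaDual k A P₁ := AddMonoidHom.mk' s₀ fun l m => NakayamaDual.ext fun h => by
    rw [NakayamaDual.add_form, hs, hs, hs, ← Finset.sum_add_distrib]
    exact Finset.sum_congr rfl fun y _ => by rw [map_add, map_add]; rfl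
  replace hs : ∀ l h, (s l).form k h = ∑ y, (e (δ (h y) l)).1.form k (d y) := hs
  have hsd : ∀ a l, a • s l = (e (δ a l)).1 + s (a • l) := fun a l => NakayamaDual.ext fun h => by
    rw [NakayamaDual.smul_form, hs, NakayamaDual.add_form, hs]
    have h1 := congrArg ((e (δ a l)).1.form k) (eq_sum_dualBasis hd h)
    rw [map_sum] at h1
    rw [h1, ← Finset.sum_add_distrib]
    refine Finset.sum_congr rfl fun y _ => ?_
    have : (MulOpposite.op a • h) y = h y * a := rfl
    rw [this, hδ, map_add, map_smul]
    rfl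
  have hsf : ∀ a l (h : P₀ →ₗ[A] A), (s (a • l)).form k (h ∘ₗ f) =
      (a • s l).form k (h ∘ₗ f) := fun a l h => by
    rw [hsd, NakayamaDual.add_form, (e (δ a l)).2 h, zero_add]
  have hsc : ∀ (c : k) l, s (c • l) = algebraMap k A c • s l := fun c l => by
    rw [hsd, hδ.algebraMap, map_zero, ← algebraMap_smul A c l]
    exact (zero_add _).symm
  -- On forms h ∘ f the map s is A-linear, since the values of δ vanish there; this data amounts to
  -- a form on Hom(P₀, L). Because Hom(M, L) = 0, restriction Hom(P₀, L) → Hom(P₁, L) is injective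
  -- and the form extends to Hom(P₁, L). The extension yields an A-linear t : L → D Hom(P₁, A)
  -- agreeing with s on all h ∘ f, so s - t has values in τM and induces the same derivation.
  let lam₀ : (P₀ →ₗ[A] L) →ₗ[k] k :=
    { toFun := fun g => ∑ y, (s (g y)).form k (d' y ∘ₗ f)
      map_add' := fun g h => by
        rw [← Finset.sum_add_distrib]
        exact Finset.sum_congr rfl fun y _ => by
          rw [LinearMap.add_apply, map_add, NakayamaDual.add_form]
      map_smul' := fun c g => by
        rw [RingHom.id_apply, Finset.smul_sum]
        exact Finset.sum_congr rfl fun y _ => by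
          rw [LinearMap.smul_apply, hsc, NakayamaDual.algebraMap_smul_form] }
  have hinj : Injective (precomp k L f) := (injective_iff_map_eq_zero _).2 fun g hg => by
    have hker : LinearMap.ker p ≤ LinearMap.ker g := fun x hx => by
      obtain ⟨y, rfl⟩ := (hfp x).1 hx
      exact LinearMap.congr_fun hg y
    have h0 := h ((LinearMap.ker p).liftQ g hker ∘ₗ (p.quotKerEquivOfSurjective hp).symm)
    refine LinearMap.ext fun x => ?_
    have := LinearMap.congr_fun h0 (p x)
    rw [LinearMap.comp_apply, LinearEquiv.coe_coe, LinearMap.quotKerEquivOfSurjective_symm_apply]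
      at this
    exact this
  obtain ⟨r, hr⟩ := (precomp k L f).exists_leftInverse_of_injective (LinearMap.ker_eq_bot.2 hinj)
  let t := toNakayama (lam₀ ∘ₗ r)
  have ht : ∀ l (h : P₀ →ₗ[A] A), (t l).form k (h ∘ₗ f) = (s l).form k (h ∘ₗ f) := fun l h => by
    have h1 : (t l).form k (h ∘ₗ f) = lam₀ (LinearMap.toSpanSingleton A L l ∘ₗ h) :=
      congrArg lam₀ (LinearMap.congr_fun hr (LinearMap.toSpanSingleton A L l ∘ₗ h))
    rw [h1]
    have h2 : h ∘ₗ f = ∑ y, (MulOpposite.op (h y) • d' y) ∘ₗ f := LinearMap.ext fun x => by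
      conv_lhs => rw [eq_sum_dualBasis hd' h]
      simp only [LinearMap.comp_apply, LinearMap.sum_apply]
    rw [h2, map_sum]
    refine Finset.sum_congr rfl fun y _ => ?_
    exact hsf _ _ _
  have hmem : ∀ l, s l - t l ∈ dualCoker k f := fun l h => by
    change (s l).form k _ - (t l).form k _ = 0
    rw [ht, sub_self]
  obtain ⟨w, hw⟩ : ∃ w : L → N, ∀ l, (e (w l)).1 = s l - t l :=
    ⟨fun l => e.symm ⟨_, hmem l⟩, fun l => by rw [e.apply_symm_apply]⟩
  have hinj' : ∀ x y, (e x).1 = (e y).1 → x = y := fun x y h => e.injective (Subtype.ext h)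
  refine ⟨{ toFun := w
            map_add' := fun l m => hinj' _ _ ?_
            map_smul' := fun c l => hinj' _ _ ?_ }, fun a l => hinj' _ _ ?_⟩
  · rw [map_add, Submodule.coe_add, hw, hw, hw, map_add, map_add]; abel
  · rw [RingHom.id_apply, ← algebraMap_smul A c (w l), map_smul, Submodule.coe_smul, hw, hw, hsc,
      ← algebraMap_smul A c l, t.map_smul, smul_sub]
  · change _ = (e (a • w l - w (a • l))).1
    rw [map_sub, map_smul, Submodule.coe_sub, Submodule.coe_smul, hw, hw, smul_sub, hsd,
      t.map_smul]
    abel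

end AuslanderReiten

/-! ## Cancellation and uniqueness of extensions -/

section Cancellation

variable {A : Type u} [Ring A]

/-- A homomorphism amounts to its kernel U together with the injection that it induces on X / U. -/
lemma card_hom_eq_sum (X L : Type u) [AddCommGroup X] [Module A X] [Finite X] [AddCommGroup L]
    [Module A L] [Finite L] [Fintype (Submodule A X)] : Nat.card (X →ₗ[A] L) =
      ∑ U : Submodule A X, Nat.card {f : X ⧸ U →ₗ[A] L // Injective f} := by
  have : ∀ U : Submodule A X, Finite {f : X ⧸ U →ₗ[A] L // Injective f} := fun U =>
    have : Finite (X ⧸ U) := Finite.of_surjective _ U.mkQ_surjective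
    have : Finite (X ⧸ U →ₗ[A] L) := DFunLike.finite _
    inferInstance
  rw [← Nat.card_sigma]
  refine Nat.card_congr ⟨fun f => ⟨LinearMap.ker f, (LinearMap.ker f).liftQ f le_rfl,
    LinearMap.ker_eq_bot.1 (Submodule.ker_liftQ_eq_bot _ _ _ le_rfl)⟩,
    fun g => g.2.1 ∘ₗ g.1.mkQ, fun f => Submodule.liftQ_mkQ _ _ _, ?_⟩
  rintro ⟨U, g, hg⟩
  have hU : LinearMap.ker (g ∘ₗ U.mkQ) = U := by
    rw [LinearMap.ker_comp, LinearMap.ker_eq_bot.2 hg]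
    exact U.ker_mkQ
  have key : ∀ (W : Submodule A X) (hW : W = U) (g' : {f : X ⧸ W →ₗ[A] L // Injective f}),
      g'.1 ∘ₗ W.mkQ = g ∘ₗ U.mkQ → 
        (⟨W, g'⟩ : Σ U : Submodule A X, {f : X ⧸ U →ₗ[A] L // Injective f}) = ⟨U, g, hg⟩ := by
    rintro W rfl ⟨g', hg'⟩ h
    have : g' = g := Submodule.linearMap_qext _ h
    subst this
    rfl
  exact key _ hU ⟨_, _⟩ (Submodule.liftQ_mkQ _ _ le_rfl)

/-- Induction on |X|: in `card_hom_eq_sum` the terms with U ≠ 0 concern smaller modules and agree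
for L and L', so the terms with U = 0 agree too. -/
lemma card_injective_eq {L L' : Type u} [AddCommGroup L] [Module A L] [Finite L]
    [AddCommGroup L'] [Module A L'] [Finite L']
    (h : ∀ (X : Type u) [AddCommGroup X] [Module A X] [Finite X],
      Nat.card (X →ₗ[A] L) = Nat.card (X →ₗ[A] L')) (n : ℕ) :
    ∀ (X : Type u) [AddCommGroup X] [Module A X] [Finite X], Nat.card X = n →
      Nat.card {f : X →ₗ[A] L // Injective f} = Nat.card {f : X →ₗ[A] L' // Injective f} := by
  classical
  induction n using Nat.strong_induction_on with
  | _ n ih =>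
    intro X _ _ _ hn
    have : Finite (Submodule A X) :=
      Finite.of_injective (fun U : Submodule A X => (U : Set X)) SetLike.coe_injective
    have := Fintype.ofFinite (Submodule A X)
    have hsum : ∀ U ∈ Finset.univ.erase (⊥ : Submodule A X),
        Nat.card {f : X ⧸ U →ₗ[A] L // Injective f} =
          Nat.card {f : X ⧸ U →ₗ[A] L' // Injective f} := fun U hU => by
      have : Finite (X ⧸ U) := Finite.of_surjective _ U.mkQ_surjective
      have hU' : Nontrivial U := Submodule.nontrivial_iff_ne_bot.2 (Finset.ne_of_mem_erase hU)
      refine ih _ ?_ (X ⧸ U) rfl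
      have h0 := Submodule.card_eq_card_quotient_mul_card U
      have h1 : 1 < Nat.card U := Finite.one_lt_card
      have h2 : 0 < Nat.card (X ⧸ U) := Nat.card_pos
      rw [← hn, h0]
      nlinarith
    have h1 := h X
    rw [card_hom_eq_sum, card_hom_eq_sum, ← Finset.add_sum_erase _ _ (Finset.mem_univ ⊥),
      ← Finset.add_sum_erase Finset.univ _ (Finset.mem_univ ⊥),
      Finset.sum_congr rfl hsum, add_left_inj] at h1
    have e : ∀ (L : Type u) [AddCommGroup L] [Module A L],
          Nat.card {f : X →ₗ[A] L // Injective f} =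
            Nat.card {f : (X ⧸ (⊥ : Submodule A X)) →ₗ[A] L // Injective f} := fun L _ _ =>
        Nat.card_congr (Equiv.subtypeEquiv
          ((Submodule.quotEquivOfEqBot ⊥ rfl).symm.arrowCongrAddEquiv (LinearEquiv.refl A L)).toEquiv
          fun f => by
            change _ ↔ Injective (f ∘ (Submodule.quotEquivOfEqBot ⊥ rfl))
            exact ((Submodule.quotEquivOfEqBot ⊥ rfl).toEquiv.injective_comp f).symm)
    rw [e, e, h1]
/-- Cancellation of direct summands for finite modules. -/
lemma nonempty_equiv_of_prod {L L' I : Type u} [AddCommGroup L] [Module A L] [Finite L]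
    [AddCommGroup L'] [Module A L'] [Finite L'] [AddCommGroup I] [Module A I] [Finite I]
    (e : (L × I) ≃ₗ[A] (L' × I)) : Nonempty (L ≃ₗ[A] L') := by
  have hI : 0 < Nat.card I := Nat.card_pos
  -- Lovász's argument: dividing by |Hom(X, I)| shows that L and L' receive equally many
  -- homomorphisms, hence equally many injections, from every X. With X = L this gives an injection
  -- L → L', and |L| = |L'|.
  have h : ∀ (X : Type u) [AddCommGroup X] [Module A X] [Finite X],
      Nat.card (X →ₗ[A] L) = Nat.card (X →ₗ[A] L') := fun X _ _ _ => by
    have h1 : ∀ (L : Type u) [AddCommGroup L] [Module A L],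
        Nat.card (X →ₗ[A] L × I) = Nat.card (X →ₗ[A] L) * Nat.card (X →ₗ[A] I) := fun L _ _ => by
      rw [← Nat.card_prod]
      exact Nat.card_congr (LinearMap.prodEquiv ℕ).symm.toEquiv
    have : Finite (X →ₗ[A] I) := DFunLike.finite _
    have h2 : 0 < Nat.card (X →ₗ[A] I) := Nat.card_pos
    refine Nat.eq_of_mul_eq_mul_right h2 ?_
    rw [← h1, ← h1]
    exact Nat.card_congr ((LinearEquiv.refl A X).arrowCongrAddEquiv e).toEquiv
  have h1 := card_injective_eq h _ L rfl
  have : Finite {f : L →ₗ[A] L // Injective f} :=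
    have : Finite (L →ₗ[A] L) := DFunLike.finite _
    inferInstance
  have h2 : 0 < Nat.card {f : L →ₗ[A] L // Injective f} :=
    Nat.card_pos_iff.2 ⟨⟨LinearMap.id, injective_id⟩, this⟩
  obtain ⟨⟨f, hf⟩⟩ := (Nat.card_pos_iff.1 (h1 ▸ h2)).1
  have hc := Nat.card_congr e.toEquiv
  rw [Nat.card_prod, Nat.card_prod] at hc
  exact ⟨LinearEquiv.ofBijective f
    (hf.bijective_of_nat_card_le (Nat.eq_of_mul_eq_mul_right hI hc).ge)⟩

variable {k : Type u} [Field k] [Algebra k A]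
variable {K I L L' : Type u} [AddCommGroup K] [Module k K] [Module A K] [IsScalarTower k A K]
  [AddCommGroup I] [Module k I] [Module A I] [IsScalarTower k A I]
  [AddCommGroup L'] [Module k L'] [Module A L'] [IsScalarTower k A L']
  [AddCommGroup L] [Module k L] [Module A L] [IsScalarTower k A L]

/-- Extensions `L`, `L'` of `I` by `K` with `Ext¹(I, L) = Ext¹(I, L') = 0` are isomorphic. -/
lemma nonempty_equiv_of_extZero_left [Finite I] [Finite L] [Finite L']
    (i : K →ₗ[A] L) (p : L →ₗ[A] I) (hi : Injective i) (hip : Exact i p) (hp : Surjective p)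
    (i' : K →ₗ[A] L') (p' : L' →ₗ[A] I) (hi' : Injective i') (hip' : Exact i' p')
    (hp' : Surjective p') (h : ExtZero k A I L) (h' : ExtZero k A I L') :
    Nonempty (L ≃ₗ[A] L') := by
  obtain ⟨u, hu⟩ := h'.exists_extend i p hi hip hp i'
  obtain ⟨v, hv⟩ := h.exists_extend i' p' hi' hip' hp' i
  -- The pushout of i and i' is an extension of I by L' and also of I by L; u and v split both. Thus
  -- α and β have the same kernel, the antidiagonal copy of K, and L × I ≅ L' × I.
  let α : L × L' →ₗ[A] L' × I := (u.coprod LinearMap.id).prod (p ∘ₗ LinearMap.fst A L L')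
  let β : L × L' →ₗ[A] L × I := (LinearMap.id.coprod v).prod (p' ∘ₗ LinearMap.snd A L L')
  have hα : Surjective α := fun ⟨y, x⟩ => by
    obtain ⟨l, rfl⟩ := hp x
    exact ⟨(l, y - u l), by simp [α]⟩
  have hβ : Surjective β := fun ⟨y, x⟩ => by
    obtain ⟨l, rfl⟩ := hp' x
    exact ⟨(y - v l, l), by simp [β]⟩
  have hker : LinearMap.ker β = LinearMap.ker α := by
    ext ⟨l, l'⟩
    have h1 : α (l, l') = (u l + l', p l) := rfl
    have h2 : β (l, l') = (l + v l', p' l') := rfl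
    rw [LinearMap.mem_ker, LinearMap.mem_ker, h1, h2, Prod.mk_eq_zero, Prod.mk_eq_zero]
    constructor
    · rintro ⟨h1, h2⟩
      obtain ⟨x, rfl⟩ := (hip' l').1 h2
      rw [hv, add_eq_zero_iff_eq_neg, ← map_neg] at h1
      subst h1
      rw [hu, map_neg, neg_add_cancel]
      exact ⟨rfl, hip.apply_apply_eq_zero _⟩
    · rintro ⟨h1, h2⟩
      obtain ⟨x, rfl⟩ := (hip l).1 h2
      rw [hu, add_comm, add_eq_zero_iff_eq_neg, ← map_neg] at h1
      subst h1
      rw [hv, map_neg, add_neg_cancel]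
      exact ⟨rfl, hip'.apply_apply_eq_zero _⟩
  exact nonempty_equiv_of_prod (I := I) ((β.quotKerEquivOfSurjective hβ).symm ≪≫ₗ
    Submodule.quotEquivOfEq _ _ hker ≪≫ₗ α.quotKerEquivOfSurjective hα)

/-- Extensions `L`, `L'` of `K` by `I` with `Ext¹(L, I) = Ext¹(L', I) = 0` are isomorphic. -/
lemma nonempty_equiv_of_extZero_right [Finite I] [Finite L] [Finite L']
    (i : I →ₗ[A] L) (p : L →ₗ[A] K) (hi : Injective i) (hip : Exact i p) (hp : Surjective p)
    (i' : I →ₗ[A] L') (p' : L' →ₗ[A] K) (hi' : Injective i') (hip' : Exact i' p')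
    (hp' : Surjective p') (h : ExtZero k A L I) (h' : ExtZero k A L' I) :
    Nonempty (L ≃ₗ[A] L') := by
  obtain ⟨u, hu⟩ := h.exists_lift i' p' hi' hip' hp' p
  obtain ⟨v, hv⟩ := h'.exists_lift i p hi hip hp p'
  -- Dually, α and β have the same image, the fibre product of L and L' over K, whose two
  -- projections are split by v and u.
  let α : L' × I →ₗ[A] L × L' := (v.coprod i).prod (LinearMap.fst A L' I)
  let β : L × I →ₗ[A] L × L' := (LinearMap.fst A L I).prod (u.coprod i')
  have hα : Injective α := (injective_iff_map_eq_zero α).2 fun ⟨l, x⟩ h => by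
    obtain ⟨h1, rfl⟩ := Prod.mk_eq_zero.1 (show (v l + i x, l) = 0 from h)
    rw [map_zero, zero_add] at h1
    rw [(injective_iff_map_eq_zero i).1 hi x h1]
    rfl
  have hβ : Injective β := (injective_iff_map_eq_zero β).2 fun ⟨l, x⟩ h => by
    obtain ⟨rfl, h1⟩ := Prod.mk_eq_zero.1 (show (l, u l + i' x) = 0 from h)
    rw [map_zero, zero_add] at h1
    rw [(injective_iff_map_eq_zero i').1 hi' x h1]
    rfl
  have hrange : LinearMap.range β = LinearMap.range α := by
    ext ⟨l, l'⟩
    have h1 : ∀ l x, α (l, x) = (v l + i x, l) := fun _ _ => rfl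
    have h2 : ∀ l x, β (l, x) = (l, u l + i' x) := fun _ _ => rfl
    simp only [LinearMap.mem_range, Prod.exists, h1, h2, Prod.mk.injEq]
    constructor
    · rintro ⟨l, x, rfl, rfl⟩
      obtain ⟨y, hy⟩ := (hip (l - v (u l + i' x))).1 (by
        rw [map_sub, hv, map_add, hu, hip'.apply_apply_eq_zero, add_zero, sub_self])
      exact ⟨_, y, by rw [hy, add_sub_cancel], rfl⟩
    · rintro ⟨l', x, rfl, rfl⟩
      obtain ⟨y, hy⟩ := (hip' (l' - u (v l' + i x))).1 (by
        rw [map_sub, hu, map_add, hv, hip.apply_apply_eq_zero, add_zero, sub_self])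
      exact ⟨_, y, rfl, by rw [hy, add_sub_cancel]⟩
  exact nonempty_equiv_of_prod (I := I) (LinearEquiv.ofInjective β hβ ≪≫ₗ
    LinearEquiv.ofEq _ _ hrange ≪≫ₗ (LinearEquiv.ofInjective α hα).symm)

end Cancellation

open Function

/-! ## Paths of acyclic quivers -/

section Paths

variable {V : Type u} [Quiver.{u} V]

/-- The paths with a given target. -/
abbrev PathTo (b : V) : Type u := Σ a : V, Quiver.Path a b

/-- Concatenation makes the relation transitive and acyclicity makes it irreflexive, which suffices
on a finite set. -/
lemma wellFounded_path [Finite V] (hQ : IsAcyclicQuiver V) :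
    WellFounded fun a b : V => ∃ p : Quiver.Path a b, 0 < p.length := by
  let r : V → V → Prop := fun a b => ∃ p : Quiver.Path a b, 0 < p.length
  have : IsTrans V r := ⟨fun a b c ⟨p, hp⟩ ⟨s, _⟩ =>
    ⟨p.comp s, by rw [Quiver.Path.length_comp]; omega⟩⟩
  have : Std.Irrefl r := ⟨fun a ⟨p, hp⟩ => by rw [hQ a p] at hp; omega⟩
  exact Finite.wellFounded_of_trans_of_irrefl r

lemma finite_pathTo [Finite V] [∀ a b : V, Finite (a ⟶ b)] (hQ : IsAcyclicQuiver V) (b : V) :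
    Finite (PathTo b) := by
  induction b using (wellFounded_path hQ).induction with
  | _ b ih =>
    have h : ∀ x : Σ c : V, (c ⟶ b), Finite (PathTo x.1) := fun x =>
      ih x.1 ⟨x.2.toPath, by simp⟩
    refine Finite.of_surjective (α := Option (Σ x : Σ c : V, (c ⟶ b), PathTo x.1))
      (fun o => o.elim ⟨b, Quiver.Path.nil⟩ fun y => ⟨y.2.1, y.2.2.cons y.1.2⟩) ?_
    rintro ⟨a, p⟩
    cases p with
    | nil => exact ⟨none, rfl⟩
    | cons p f => exact ⟨some ⟨⟨_, f⟩, _, p⟩, rfl⟩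

lemma finite_pathOf [Finite V] [∀ a b : V, Finite (a ⟶ b)] (hQ : IsAcyclicQuiver V) :
    Finite (PathOf V) := by
  have := finite_pathTo hQ
  exact Finite.of_injective (β := Σ b : V, PathTo b) (fun p => ⟨p.2.1, p.1, p.2.2⟩)
    fun ⟨a, b, p⟩ ⟨a', b', p'⟩ h => by cases h; rfl

/-- The number of paths with target `b`. -/
def depth (b : V) : ℕ := Nat.card (PathTo b)

/-- Appending f embeds the paths to a in the paths to b and misses the trivial one. Since depth is
also σ-invariant, it orders the orbits; it serves to find a sink and to exclude arrows within an
orbit. -/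
lemma depth_lt [Finite V] [∀ a b : V, Finite (a ⟶ b)] (hQ : IsAcyclicQuiver V) {a b : V}
    (f : a ⟶ b) : depth a < depth b := by
  have := finite_pathTo hQ
  have := Fintype.ofFinite (PathTo a)
  have := Fintype.ofFinite (PathTo b)
  rw [depth, depth, Nat.card_eq_fintype_card, Nat.card_eq_fintype_card]
  refine Fintype.card_lt_of_injective_of_notMem
    (fun p : PathTo a => (⟨p.1, p.2.cons f⟩ : PathTo b)) ?_ (b := ⟨b, Quiver.Path.nil⟩) ?_
  · rintro ⟨c, p⟩ ⟨c', p'⟩ h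
    cases h; rfl
  · rintro ⟨⟨c, p⟩, h⟩
    cases h

lemma depth_lt_of_path [Finite V] [∀ a b : V, Finite (a ⟶ b)] (hQ : IsAcyclicQuiver V) {a b : V}
    (p : Quiver.Path a b) : a = b ∨ depth a < depth b := by
  induction p with
  | nil => exact Or.inl rfl
  | cons p f ih =>
    rcases ih with rfl | h
    · exact Or.inr (depth_lt hQ f)
    · exact Or.inr (h.trans (depth_lt hQ f))

namespace QuiverAut

variable (σ : QuiverAut V)

lemma onPath_eq_of_eq_id {F : V ⥤q V} (h : F = 𝟭q V) (p : PathOf V) :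
    (⟨F.obj p.1, F.obj p.2.1, F.mapPath p.2.2⟩ : PathOf V) = p := by
  subst h
  rw [Prefunctor.mapPath_id]
  rfl

/-- The permutation of the paths given by `σ`. -/
def pathPerm : Equiv.Perm (PathOf V) where
  toFun := σ.onPath
  invFun p := ⟨σ.inv.obj p.1, σ.inv.obj p.2.1, σ.inv.mapPath p.2.2⟩
  left_inv p := by
    have := onPath_eq_of_eq_id σ.hom_inv p
    rwa [Prefunctor.mapPath_comp_apply] at this
  right_inv p := by
    have := onPath_eq_of_eq_id σ.inv_hom p
    rwa [Prefunctor.mapPath_comp_apply] at this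

lemma depth_eq_card (b : V) : depth b = Nat.card {p : PathOf V // p.2.1 = b} :=
  Nat.card_congr
    { toFun := fun x => ⟨⟨x.1, b, x.2⟩, rfl⟩
      invFun := fun y => ⟨y.1.1, y.1.2.2.cast rfl y.2⟩
      left_inv := fun x => rfl
      right_inv := by rintro ⟨⟨a, b, p⟩, rfl⟩; rfl }

lemma depth_hom (b : V) : depth (σ.hom.obj b) = depth b := by
  rw [depth_eq_card, depth_eq_card]
  refine (Nat.card_congr (σ.pathPerm.subtypeEquiv fun p => ?_)).symm
  exact (σ.vertexPerm.injective.eq_iff (a := p.2.1) (b := b)).symm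

lemma depth_zpow (n : ℤ) (b : V) : depth ((σ.vertexPerm ^ n) b) = depth b := by
  induction n using Int.induction_on generalizing b with
  | zero => rfl
  | succ n ih =>
    rw [zpow_add_one, Equiv.Perm.mul_apply, ih]
    exact σ.depth_hom b
  | pred n ih =>
    rw [zpow_sub_one, Equiv.Perm.mul_apply, ih]
    conv_rhs => rw [← σ.vertexPerm.apply_symm_apply b]
    exact (σ.depth_hom _).symm

lemma depth_eq_of_orbit_eq {a b : V} (h : σ.orbit a = σ.orbit b) : depth a = depth b := by
  obtain ⟨n, rfl⟩ : Equiv.Perm.SameCycle σ.vertexPerm a b := Quotient.exact h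
  exact (σ.depth_zpow n a).symm

end QuiverAut

end Paths

/-! ## Bimodules and derivations -/

/-- A bimodule over a `K`-algebra `R`, in terms of its left and right multiplications. -/
structure Bimod (K R M : Type*) [Field K] [Ring R] [Algebra K R] [AddCommGroup M] [Module K M] where
  l : R →ₗ[K] M →ₗ[K] M
  r : R →ₗ[K] M →ₗ[K] M
  l_one : ∀ m, l 1 m = m
  r_one : ∀ m, r 1 m = m
  l_mul : ∀ a b m, l (a * b) m = l a (l b m)
  r_mul : ∀ a b m, r (a * b) m = r b (r a m)
  comm : ∀ a b m, l a (r b m) = r b (l a m)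

namespace Bimod

variable {K R M : Type*} [Field K] [Ring R] [Algebra K R] [AddCommGroup M] [Module K M]

/-- Derivations with values in a bimodule. -/
def IsDer (B : Bimod K R M) (δ : R →ₗ[K] M) : Prop := ∀ a b, δ (a * b) = B.l a (δ b) + B.r b (δ a)

/-- The inner derivation `a ↦ a m - m a`. -/
def inner (B : Bimod K R M) (m : M) : R →ₗ[K] M := B.l.flip m - B.r.flip m

lemma inner_apply (B : Bimod K R M) (m : M) (a : R) : B.inner m a = B.l a m - B.r a m := rfl

lemma isDer_inner (B : Bimod K R M) (m : M) : B.IsDer (B.inner m) := fun a b => by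
  rw [inner_apply, inner_apply, inner_apply, map_sub, map_sub, B.l_mul, B.r_mul, B.comm]
  abel

lemma IsDer.sub {B : Bimod K R M} {δ δ' : R →ₗ[K] M} (h : B.IsDer δ) (h' : B.IsDer δ') :
    B.IsDer (δ - δ') := fun a b => by
  rw [LinearMap.sub_apply, h, h', LinearMap.sub_apply, LinearMap.sub_apply, map_sub, map_sub]
  abel

lemma IsDer.add {B : Bimod K R M} {δ δ' : R →ₗ[K] M} (h : B.IsDer δ) (h' : B.IsDer δ') :
    B.IsDer (δ + δ') := fun a b => by
  rw [LinearMap.add_apply, h, h', LinearMap.add_apply, LinearMap.add_apply, map_add, map_add]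
  abel

end Bimod

/-! ### Derivations of a path algebra -/

namespace PathAlgebra

variable {K V : Type u} [Field K] [Quiver.{u} V]

/-- A path as an element of the path algebra. -/
def path {a b : V} (p : Quiver.Path a b) : PathAlgebra K V := monomial ⟨a, b, p⟩ 1

lemma path_mul_path {a b c : V} (p : Quiver.Path b c) (r : Quiver.Path a b) :
    (path p * path r : PathAlgebra K V) = path (r.comp p) := by
  rw [path, path, monomial_mul_monomial, pathMul_of_comp, mul_one, one_smul, path]

lemma path_mul_path_of_ne {a b c d : V} (p : Quiver.Path c d) (r : Quiver.Path a b) (h : b ≠ c) :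
    (path p * path r : PathAlgebra K V) = 0 := by
  rw [path, path, monomial_mul_monomial, pathMul_of_ne (by exact h), smul_zero]

/-- The trivial path at a vertex, as an element of the path algebra. -/
def triv (K : Type u) [Field K] (a : V) : PathAlgebra K V := path (Quiver.Path.nil (a := a))

/-- An arrow as an element of the path algebra. -/
def arrow (K : Type u) [Field K] {a b : V} (f : a ⟶ b) : PathAlgebra K V := path f.toPath

lemma triv_mul_path {a b : V} (p : Quiver.Path a b) : (triv K b * path p : PathAlgebra K V) = path p := by
  rw [triv, path_mul_path, Quiver.Path.comp_nil]

lemma path_mul_triv {a b : V} (p : Quiver.Path a b) : (path p * triv K a : PathAlgebra K V) = path p := by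
  rw [triv, path_mul_path, Quiver.Path.nil_comp]

open Classical in
lemma triv_mul_triv (a b : V) : (triv K a * triv K b : PathAlgebra K V) =
    if b = a then triv K a else 0 := by
  split_ifs with h
  · subst h; exact triv_mul_path _
  · exact path_mul_path_of_ne _ _ h

lemma path_cons {a b c : V} (p : Quiver.Path a b) (f : b ⟶ c) :
    (path (p.cons f) : PathAlgebra K V) = arrow K f * path p := by
  rw [arrow, path_mul_path]; rfl

/-- Linear maps on the path algebra agree if they agree on paths. -/
lemma hom_ext {M : Type*} [AddCommGroup M] [Module K M] {f g : PathAlgebra K V →ₗ[K] M}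
    (h : ∀ (a b : V) (p : Quiver.Path a b), f (path p) = g (path p)) : f = g :=
  Finsupp.lhom_ext' fun ⟨a, b, p⟩ => LinearMap.ext_ring (h a b p)

variable [Fintype V]

lemma one_eq_sum_triv : (1 : PathAlgebra K V) = ∑ a : V, triv K a := rfl

variable {M : Type*} [AddCommGroup M] [Module K M] (B : Bimod K (PathAlgebra K V) M)

/-- The value on a path of the derivation with prescribed values on arrows. -/
def pathDer (w : ∀ a b : V, (a ⟶ b) → M) {a : V} : ∀ {b : V}, Quiver.Path a b → M
  | _, Quiver.Path.nil => 0
  | _, Quiver.Path.cons p f => B.l (arrow K f) (pathDer w p) + B.r (path p) (w _ _ f)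

variable (w : ∀ a b : V, (a ⟶ b) → M)

lemma pathDer_nil (a : V) : pathDer B w (Quiver.Path.nil (a := a)) = 0 := by rw [pathDer]

lemma pathDer_cons {a b c : V} (p : Quiver.Path a b) (f : b ⟶ c) : pathDer B w (p.cons f) =
    B.l (arrow K f) (pathDer B w p) + B.r (path p) (w _ _ f) := by rw [pathDer]

lemma l_triv_pathDer (hw : ∀ a b f, B.l (triv K b) (w a b f) = w a b f) {a b : V}
    (p : Quiver.Path a b) : B.l (triv K b) (pathDer B w p) = pathDer B w p := by
  cases p with
  | nil => rw [pathDer_nil, map_zero]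
  | cons p f =>
    rw [pathDer_cons, map_add, ← B.l_mul, B.comm, hw, arrow, triv_mul_path]

lemma r_triv_pathDer {a b : V}
    (p : Quiver.Path a b) : B.r (triv K a) (pathDer B w p) = pathDer B w p := by
  induction p with
  | nil => rw [pathDer_nil, map_zero]
  | cons p f ih =>
    rw [pathDer_cons, map_add, ← B.comm, ih, ← B.r_mul, path_mul_triv]

lemma pathDer_comp (hw : ∀ a b f, B.l (triv K b) (w a b f) = w a b f) {a b c : V}
    (p : Quiver.Path a b) (s : Quiver.Path b c) :
    pathDer B w (p.comp s) = B.l (path s) (pathDer B w p) + B.r (path p) (pathDer B w s) := by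
  induction s with
  | nil =>
    have := l_triv_pathDer B w hw p
    rw [triv] at this
    rw [pathDer_nil, map_zero, add_zero, Quiver.Path.comp_nil, this]
  | cons s f ih =>
    rw [Quiver.Path.comp_cons, pathDer_cons, pathDer_cons, ih, map_add, map_add, path_cons, B.l_mul,
      ← B.comm, ← path_mul_path, B.r_mul, add_assoc]

/-- Derivations of the path algebra may be prescribed on arrows. -/
lemma exists_der (hl : ∀ a b f, B.l (triv K b) (w a b f) = w a b f)
    (hr : ∀ a b f, B.r (triv K a) (w a b f) = w a b f) :
    ∃ δ : PathAlgebra K V →ₗ[K] M, B.IsDer δ ∧ (∀ a, δ (triv K a) = 0) ∧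
      ∀ a b (f : a ⟶ b), δ (arrow K f) = w a b f := by
  let δ : PathAlgebra K V →ₗ[K] M :=
    (Finsupp.linearCombination K fun p : PathOf V => pathDer B w p.2.2 : (PathOf V →₀ K) →ₗ[K] M)
  have hδ : ∀ (a b : V) (p : Quiver.Path a b), δ (path p) = pathDer B w p := fun a b p =>
    (Finsupp.linearCombination_single K 1 _).trans (one_smul K _)
  refine ⟨δ, ?_, fun a => (hδ _ _ _).trans (pathDer_nil B w a), fun a b f => ?_⟩
  · intro x y
    have key : (LinearMap.mul K (PathAlgebra K V)).compr₂ δ =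
        B.l.compl₂ δ + (B.r.compl₂ δ).flip := by
      refine hom_ext fun c d p => hom_ext fun a b s => ?_
      change δ (path p * path s) = B.l (path p) (δ (path s)) + B.r (path s) (δ (path p))
      rw [hδ, hδ]
      by_cases h : b = c
      · subst h
        rw [path_mul_path, hδ, pathDer_comp B w hl]
      -- For non-composable paths all terms vanish, because the value at a path is fixed by the
      -- trivial paths at its two ends.
      · rw [path_mul_path_of_ne _ _ h, map_zero, ← l_triv_pathDer B w hl s, ← B.l_mul, triv,
          path_mul_path_of_ne _ _ h, map_zero, ← r_triv_pathDer B w p, ← B.r_mul, triv,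
          path_mul_path_of_ne _ _ h, map_zero]
        simp
    exact LinearMap.congr_fun (LinearMap.congr_fun key x) y
  · rw [arrow, hδ, Quiver.Hom.toPath, pathDer_cons, pathDer_nil, map_zero, zero_add]
    exact hr a b f

lemma der_path {δ : PathAlgebra K V →ₗ[K] M} (hδ : B.IsDer δ) (h0 : ∀ a, δ (triv K a) = 0)
    (ha : ∀ a b (f : a ⟶ b), δ (arrow K f) = 0) : δ = 0 := by
  refine hom_ext fun a b p => ?_
  rw [LinearMap.zero_apply]
  induction p with
  | nil => exact h0 a
  | cons p f ih => rw [path_cons, hδ, ih, ha, map_zero, map_zero, add_zero]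

/-- Up to inner derivations, derivations vanish on the trivial paths. -/
lemma exists_inner_triv {δ : PathAlgebra K V →ₗ[K] M} (hδ : B.IsDer δ) :
    ∃ m, ∀ a, (δ - B.inner m) (triv K a) = 0 := by
  classical
  -- The witness is -∑ δ(e_a) e_a. Expanding δ(e_b e_a) and multiplying by e_a on the right computes
  -- e_b δ(e_a) e_a; then sum over a.
  refine ⟨-∑ a, B.r (triv K a) (δ (triv K a)), fun b => ?_⟩
  have h1 : ∀ a, B.l (triv K b) (B.r (triv K a) (δ (triv K a))) =
      (if a = b then B.r (triv K a) (δ (triv K a)) else 0) - B.r (triv K a) (δ (triv K b)) :=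
    fun a => by
    have h := congrArg (B.r (triv K a)) (hδ (triv K b) (triv K a))
    rw [map_add, ← B.comm, ← B.r_mul, triv_mul_triv a a, if_pos rfl, triv_mul_triv] at h
    rw [eq_sub_iff_add_eq, ← h]
    split_ifs with h'
    · rw [h']
    · rw [map_zero, map_zero]
  have h2 : ∀ a, B.r (triv K b) (B.r (triv K a) (δ (triv K a))) =
      if a = b then B.r (triv K a) (δ (triv K a)) else 0 := fun a => by
    rw [← B.r_mul, triv_mul_triv]
    by_cases h' : a = b
    · rw [if_pos h'.symm, if_pos h']
    · rw [if_neg (Ne.symm h'), if_neg h', map_zero, LinearMap.zero_apply]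
  have h3 : ∑ a, B.r (triv K a) (δ (triv K b)) = δ (triv K b) := by
    rw [← LinearMap.sum_apply, ← map_sum, ← one_eq_sum_triv, B.r_one]
  rw [LinearMap.sub_apply, Bimod.inner_apply, map_neg, map_neg, map_sum, map_sum,
    Finset.sum_congr rfl fun a _ => h1 a, Finset.sum_congr rfl fun a _ => h2 a,
    Finset.sum_sub_distrib, h3]
  abel

/-- Derivations of the path algebra lift along surjections of bimodules. -/
lemma exists_lift_der {M' : Type*} [AddCommGroup M'] [Module K M']
    (B' : Bimod K (PathAlgebra K V) M') (π : M →ₗ[K] M') (hπ : Surjective π)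
    (hl : ∀ a m, π (B.l a m) = B'.l a (π m)) (hr : ∀ a m, π (B.r a m) = B'.r a (π m))
    {δ : PathAlgebra K V →ₗ[K] M'} (hδ : B'.IsDer δ) :
    ∃ δ' : PathAlgebra K V →ₗ[K] M, B.IsDer δ' ∧ ∀ a, π (δ' a) = δ a := by
  obtain ⟨m', hm'⟩ := exists_inner_triv B' hδ
  obtain ⟨m, rfl⟩ := hπ m'
  -- Now δ₁ kills the trivial paths, so its value on an arrow a → b lies in e_b M' e_a and lifts to
  -- e_b M e_a. Arrows may be prescribed freely, and the subtracted inner derivation lifts with m.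
  set δ₁ := δ - B'.inner (π m) with hδ₁
  have hd₁ : B'.IsDer δ₁ := hδ.sub (B'.isDer_inner _)
  choose s hs using hπ
  have hlr : ∀ a b (f : a ⟶ b), B'.l (triv K b) (B'.r (triv K a) (δ₁ (arrow K f))) =
      δ₁ (arrow K f) := fun a b f => by
    have h1 := hd₁ (triv K b) (arrow K f)
    have h2 := hd₁ (arrow K f) (triv K a)
    rw [arrow, triv_mul_path, hm', map_zero, add_zero] at h1
    rw [arrow, path_mul_triv, hm', map_zero, zero_add] at h2
    rw [arrow, ← h2, ← h1]
  obtain ⟨δ₂, hd₂, ht, ha⟩ := exists_der B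
    (fun a b f => B.l (triv K b) (B.r (triv K a) (s (δ₁ (arrow K f)))))
    (fun a b f => by rw [← B.l_mul, triv_mul_triv, if_pos rfl])
    (fun a b f => by rw [← B.comm, ← B.r_mul, triv_mul_triv, if_pos rfl])
  refine ⟨δ₂ + B.inner m, hd₂.add (B.isDer_inner m), fun a => ?_⟩
  have key : π ∘ₗ δ₂ - δ₁ = 0 := der_path B'
    (Bimod.IsDer.sub (fun a b => by
      rw [LinearMap.comp_apply, hd₂, map_add, hl, hr]; rfl) hd₁)
    (fun a => by rw [LinearMap.sub_apply, hm', LinearMap.comp_apply, ht, map_zero, sub_zero])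
    (fun a b f => by
      rw [LinearMap.sub_apply, LinearMap.comp_apply, ha, hl, hr, hs, hlr, sub_self])
  have := LinearMap.congr_fun key a
  rw [LinearMap.sub_apply, LinearMap.zero_apply, sub_eq_zero, LinearMap.comp_apply, hδ₁,
    LinearMap.sub_apply] at this
  rw [LinearMap.add_apply, map_add, this, Bimod.inner_apply, Bimod.inner_apply, map_sub, hl, hr]
  abel

end PathAlgebra

/-! ## Descent from the path algebra to the algebra of fixed points -/

section Frobenius

variable (k : Type u) [Field k] [Fintype k]

local notation "q" => Fintype.card k
local notation "kbar" => AlgebraicClosure k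

variable {k} in
-- The polynomial T^q - T has at most q roots, and the elements of k already provide q of them.
lemma exists_algebraMap_eq {c : kbar} (hc : c ^ q = c) : ∃ a : k, algebraMap k kbar a = c := by
  classical
  have h0 : (Polynomial.X ^ q - Polynomial.X : Polynomial kbar) ≠ 0 :=
    FiniteField.X_pow_card_sub_X_ne_zero _ Fintype.one_lt_card
  have hmem : ∀ x : kbar, x ∈ (Polynomial.X ^ q - Polynomial.X : Polynomial kbar).roots.toFinset ↔
      x ^ q = x := fun x => by
    rw [Multiset.mem_toFinset, Polynomial.mem_roots h0, Polynomial.IsRoot.def, Polynomial.eval_sub,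
      Polynomial.eval_pow, Polynomial.eval_X, sub_eq_zero]
  have hsub : Finset.univ.image (algebraMap k kbar) ⊆
      (Polynomial.X ^ q - Polynomial.X : Polynomial kbar).roots.toFinset := fun x hx => by
    obtain ⟨a, -, rfl⟩ := Finset.mem_image.1 hx
    rw [hmem, ← map_pow, FiniteField.pow_card]
  have heq := Finset.eq_of_subset_of_card_le hsub (by
    rw [Finset.card_image_of_injective _ (algebraMap k kbar).injective, Finset.card_univ]
    refine (Multiset.toFinset_card_le _).trans ((Polynomial.card_roots' _).trans ?_)
    rw [FiniteField.X_pow_card_sub_X_natDegree_eq _ Fintype.one_lt_card])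
  have := (hmem c).2 hc
  rw [← heq] at this
  obtain ⟨a, -, ha⟩ := Finset.mem_image.1 this
  exact ⟨a, ha⟩

lemma one_lt_pow_card {n : ℕ} (hn : n ≠ 0) : 1 < q ^ n := Nat.one_lt_pow hn Fintype.one_lt_card

/-- The elements fixed by the `n`-th power of the Frobenius automorphism. -/
abbrev FrobFixed (n : ℕ) : Type u :=
  {c : kbar // c ^ q ^ n = c}

/-- The polynomial T^(q^n) - T is separable and splits over the algebraic closure. -/
lemma card_frobFixed {n : ℕ} (hn : n ≠ 0) : Nat.card (FrobFixed k n) = q ^ n := by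
  obtain ⟨p, hp⟩ := CharP.exists k
  obtain ⟨m, hpr, hm⟩ := FiniteField.card k p
  have : CharP kbar p := charP_of_injective_algebraMap (algebraMap k kbar).injective p
  have hsep : (Polynomial.X ^ q ^ n - Polynomial.X : Polynomial kbar).Separable :=
    galois_poly_separable p _ (by rw [hm]; exact (dvd_pow_self p m.ne_zero).trans (dvd_pow_self _ hn))
  have h := Polynomial.card_rootSet_eq_natDegree (K := kbar) hsep (IsAlgClosed.splits _)
  rw [FiniteField.X_pow_card_sub_X_natDegree_eq _ (one_lt_pow_card k hn)] at h
  rw [← h, ← Nat.card_eq_fintype_card]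
  refine Nat.card_congr (Equiv.subtypeEquivRight fun c => ?_)
  rw [Polynomial.mem_rootSet]
  simp [FiniteField.X_pow_card_sub_X_ne_zero _ (one_lt_pow_card k hn), sub_eq_zero]

lemma frob_pow_injective (i : ℕ) : Injective fun c : kbar => c ^ q ^ i := by
  induction i with
  | zero => intro a b h; simpa using h
  | succ i ih =>
    intro a b h
    refine ih ((FiniteField.frobeniusAlgHom k kbar).toRingHom.injective ?_)
    change (a ^ q ^ i) ^ q = (b ^ q ^ i) ^ q
    rw [← pow_mul, ← pow_mul, ← pow_succ]
    exact h

/-- The vectors `(c, c ^ q, c ^ (q ^ 2), …)` span. -/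
lemma span_frobPow (n : ℕ) :
    Submodule.span kbar (Set.range fun c : FrobFixed k n => fun j : Fin n => c.1 ^ q ^ (j : ℕ)) =
      ⊤ := by
  rcases Nat.eq_zero_or_pos n with rfl | hn
  · exact Subsingleton.elim _ _
  by_contra hne
  obtain ⟨f, hf, hle⟩ := Submodule.exists_le_ker_of_lt_top _ (lt_top_iff_ne_top.2 hne)
  -- A form vanishing on all these vectors is a linear relation between the characters c ↦ c^(q^j),
  -- j < n, of the fixed elements. Distinct characters are independent (Dedekind). If two of these
  -- coincided, all q^n elements would satisfy c^(q^m) = c for some 0 < m < n, which has only q^m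
  -- solutions.
  let S : Submonoid kbar :=
    { carrier := {c | c ^ q ^ n = c}
      mul_mem' := fun {a b} ha hb => by
        change (a * b) ^ q ^ n = a * b
        rw [mul_pow, show a ^ q ^ n = a from ha, show b ^ q ^ n = b from hb]
      one_mem' := one_pow _ }
  let χ : Fin n → (S →* kbar) := fun j => (powMonoidHom (q ^ (j : ℕ))).comp S.subtype
  have hlt : ∀ i j : Fin n, i < j → χ i ≠ χ j := fun i j hij h => by
    have hc : ∀ c : FrobFixed k n, c.1 ^ q ^ ((j : ℕ) - i) = c.1 := fun c => by
      refine frob_pow_injective k i ?_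
      have := DFunLike.congr_fun h (⟨c.1, c.2⟩ : S)
      change c.1 ^ q ^ (i : ℕ) = c.1 ^ q ^ (j : ℕ) at this
      change (c.1 ^ q ^ ((j : ℕ) - i)) ^ q ^ (i : ℕ) = c.1 ^ q ^ (i : ℕ)
      rw [← pow_mul, ← pow_add, Nat.sub_add_cancel (by exact_mod_cast hij.le), this]
    have hm : (j : ℕ) - i ≠ 0 := by
      have : (i : ℕ) < j := hij
      omega
    have hinj : Injective (fun c : FrobFixed k n => (⟨c.1, hc c⟩ : FrobFixed k ((j : ℕ) - i))) :=
      fun a b h => Subtype.ext (congrArg (fun x => x.1) h)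
    have hfin : Finite (FrobFixed k ((j : ℕ) - i)) := Nat.finite_of_card_ne_zero (by
      rw [card_frobFixed k hm]
      exact (Nat.zero_lt_of_lt (one_lt_pow_card k hm)).ne')
    have hle := Nat.card_le_card_of_injective _ hinj
    rw [card_frobFixed k hn.ne', card_frobFixed k hm] at hle
    have hlt : (j : ℕ) - i < n := by have := j.2; omega
    exact absurd hle (not_le.2 (Nat.pow_lt_pow_right Fintype.one_lt_card hlt))
  have hχ : Injective χ := fun i j h => by
    rcases lt_trichotomy i j with h' | h' | h'
    · exact absurd h (hlt i j h')
    · exact h'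
    · exact absurd h.symm (hlt j i h')
  have hind := (linearIndependent_monoidHom S kbar).comp χ hχ
  rw [Fintype.linearIndependent_iff] at hind
  have h0 := hind (fun j => f (Pi.single j 1)) (funext fun c => by
    have : f (fun j => c.1 ^ q ^ (j : ℕ)) = 0 := hle (Submodule.subset_span ⟨⟨c.1, c.2⟩, rfl⟩)
    rw [LinearMap.pi_apply_eq_sum_univ] at this
    rw [Finset.sum_apply, Pi.zero_apply, ← this]
    refine Finset.sum_congr rfl fun j _ => ?_
    change f (Pi.single j 1) * c.1 ^ q ^ (j : ℕ) = _
    rw [mul_comm, smul_eq_mul]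
    congr 2
    ext i
    simp [Pi.single_apply, eq_comm])
  exact hf (LinearMap.pi_ext' fun j => LinearMap.ext_ring (h0 j))

end Frobenius

/-! ### The base change of the fixed-point algebra is the path algebra -/

section Descent

variable (k : Type u) [Field k] [Fintype k] {V : Type u} [Quiver.{u} V] [Fintype V]
  (σ : QuiverAut V)

local notation "q" => Fintype.card k
local notation "kbar" => AlgebraicClosure k

instance : IsScalarTower k kbar (PathAlgebra kbar V) :=
  IsScalarTower.of_algebraMap_smul fun c x => (PathAlgebra.smul_eq_algebraMap_smul c x).symm

/-- The inclusion of the algebra of fixed points in the path algebra. -/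
def fixedVal : FixedAlg k σ →ₐ[k] PathAlgebra kbar V :=
  (AlgHom.equalizer (frob k σ) (AlgHom.id k (PathAlgebra kbar V))).val

lemma fixedVal_injective : Injective (fixedVal k σ) := Subtype.val_injective

lemma frobFun_fixedVal (a : FixedAlg k σ) : frobFun k σ (fixedVal k σ a) = fixedVal k σ a := a.2

lemma exists_fixedVal_eq {x : PathAlgebra kbar V} (hx : frobFun k σ x = x) :
    ∃ a, fixedVal k σ a = x := ⟨⟨x, hx⟩, rfl⟩

/-- The trace `∑ c ^ (q ^ j) σ ^ j (p)` of a multiple of a path. -/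
def pathTrace (n : ℕ) (p : PathOf V) (c : kbar) : PathAlgebra kbar V :=
  ∑ j ∈ Finset.range n, PathAlgebra.monomial ((σ.pathPerm ^ j) p) (c ^ q ^ j)

/-- The Frobenius morphism shifts the index j by one, and the new last term is the old first one, as
σ^n fixes p and c^(q^n) = c. -/
lemma frobFun_pathTrace {n : ℕ} (hn : σ.pathPerm ^ n = 1) (p : PathOf V) (c : FrobFixed k n) :
    frobFun k σ (pathTrace k σ n p c.1) = pathTrace k σ n p c.1 := by
  have h1 : frobFun k σ (pathTrace k σ n p c.1) = ∑ j ∈ Finset.range n,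
      PathAlgebra.monomial ((σ.pathPerm ^ (j + 1)) p) (c.1 ^ q ^ (j + 1)) := by
    refine (map_sum (AddMonoidHom.mk' (frobFun k σ) (frobFun_add k σ)) _ _).trans
      (Finset.sum_congr rfl fun j _ => ?_)
    refine (frobFun_monomial k σ _ _).trans ?_
    rw [← pow_mul, ← pow_succ, pow_succ' σ.pathPerm]
    rfl
  have h2 := Finset.sum_range_succ
    (fun j => (PathAlgebra.monomial ((σ.pathPerm ^ j) p) (c.1 ^ q ^ j) : PathAlgebra kbar V)) n
  rw [Finset.sum_range_succ', hn, c.2] at h2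
  rw [h1, pathTrace]
  simpa using h2

/-- Every path is in the span of its traces. -/
lemma path_mem_span_trace {n : ℕ} (hn : 0 < n) (p : PathOf V) :
    (PathAlgebra.monomial p 1 : PathAlgebra kbar V) ∈
      Submodule.span kbar (Set.range fun c : FrobFixed k n => pathTrace k σ n p c.1) := by
  -- The first unit vector is sent to p and the vectors (c, c^q, …) to traces; by `span_frobPow` the
  -- latter span.
  let g : (Fin n → kbar) →ₗ[kbar] PathAlgebra kbar V :=
    Fintype.linearCombination kbar fun j : Fin n =>
      (PathAlgebra.monomial ((σ.pathPerm ^ (j : ℕ)) p) 1 : PathAlgebra kbar V)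
  have hg : ∀ c : FrobFixed k n, g (fun j => c.1 ^ q ^ (j : ℕ)) = pathTrace k σ n p c.1 := fun c => by
    rw [pathTrace, Finset.sum_range]
    refine (Fintype.linearCombination_apply _ _ _).trans (Finset.sum_congr rfl fun j _ => ?_)
    rw [PathAlgebra.smul_monomial, smul_eq_mul, mul_one]
  have h1 : g (Pi.single ⟨0, hn⟩ 1) = PathAlgebra.monomial p 1 := by
    rw [Fintype.linearCombination_apply_single, one_smul]
    rfl
  rw [← h1]
  have h2 := Submodule.mem_map_of_mem (f := g)
    ((span_frobPow k n).symm ▸ Submodule.mem_top : Pi.single ⟨0, hn⟩ 1 ∈ Submodule.span kbar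
      (Set.range fun c : FrobFixed k n => fun j : Fin n => c.1 ^ q ^ (j : ℕ)))
  rw [Submodule.map_span, ← Set.range_comp] at h2
  convert h2 using 3
  exact funext fun c => (hg c).symm

/-- Vectors fixed by the Frobenius morphism that are independent over `k` are independent over the
algebraic closure. -/
lemma linearIndependent_of_fixed {ι : Type*} (b : ι → PathAlgebra kbar V)
    (hfix : ∀ i, frobFun k σ (b i) = b i) (hb : LinearIndependent k b) :
    LinearIndependent kbar b := by
  classical
  rw [linearIndependent_iff']
  intro s
  induction s using Finset.induction_on with
  | empty => simp
  | insert j s hj ih =>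
    intro g hg
    by_cases h0 : g j = 0
    · rw [Finset.sum_insert hj, h0, zero_smul, zero_add] at hg
      intro i hi
      rcases Finset.mem_insert.1 hi with rfl | hi
      · exact h0
      · exact ih g hg i hi
    · exfalso
      -- Normalise the coefficient at j to 1, apply the Frobenius morphism and subtract: the shorter
      -- relation is trivial by induction, so every normalised coefficient satisfies c^q = c and
      -- lies in k.
      have h1 : ∑ i ∈ insert j s, ((g j)⁻¹ * g i) • b i = 0 := by
        simp only [mul_smul, ← Finset.smul_sum, hg, smul_zero]
      have h2 : ∑ i ∈ insert j s, (((g j)⁻¹ * g i) ^ q) • b i = 0 := by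
        have := congrArg (AddMonoidHom.mk' (frobFun k σ) (frobFun_add k σ)) h1
        rw [map_sum, map_zero] at this
        rw [← this]
        exact Finset.sum_congr rfl fun i _ => by
          rw [AddMonoidHom.mk'_apply, frobFun_smul, hfix]
      have h3 : ∑ i ∈ s, (((g j)⁻¹ * g i) ^ q - (g j)⁻¹ * g i) • b i = 0 := by
        simp only [sub_smul, Finset.sum_sub_distrib]
        rw [Finset.sum_insert hj, inv_mul_cancel₀ h0] at h1 h2
        rw [one_pow] at h2
        exact sub_eq_zero.2 (add_left_cancel (h2.trans h1.symm))
      have h4 := ih _ h3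
      have h5 : ∀ i : ι, ∃ a : k, i ∈ insert j s → algebraMap k kbar a = (g j)⁻¹ * g i := fun i => by
        by_cases hi : i ∈ insert j s
        · obtain ⟨a, ha⟩ := exists_algebraMap_eq (k := k) (c := (g j)⁻¹ * g i) (by
            rcases Finset.mem_insert.1 hi with rfl | hi
            · rw [inv_mul_cancel₀ h0, one_pow]
            · exact sub_eq_zero.1 (h4 i hi))
          exact ⟨a, fun _ => ha⟩
        · exact ⟨0, fun h => absurd h hi⟩
      choose a ha using h5
      have h6 : ∑ i ∈ insert j s, a i • b i = 0 := by
        rw [← h1]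
        exact Finset.sum_congr rfl fun i hi => by
          rw [PathAlgebra.smul_eq_algebraMap_smul, ha i hi]
      have h7 := linearIndependent_iff'.1 hb _ a h6 j (Finset.mem_insert_self _ _)
      have h8 := ha j (Finset.mem_insert_self _ _)
      rw [h7, map_zero, inv_mul_cancel₀ h0] at h8
      exact zero_ne_one h8

/-- The base change map `kbar ⊗ A → kbar Q`. -/
def descentHom : kbar ⊗[k] FixedAlg k σ →ₐ[kbar] PathAlgebra kbar V :=
  Algebra.TensorProduct.lift (Algebra.ofId kbar _) (fixedVal k σ)
    fun c _ => Algebra.commutes c _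

lemma descentHom_tmul (c : kbar) (a : FixedAlg k σ) :
    descentHom k σ (c ⊗ₜ a) = c • fixedVal k σ a := by
  rw [Algebra.smul_def]
  rfl

variable [∀ a b : V, Fintype (a ⟶ b)]

lemma exists_pathPerm_pow (hQ : IsAcyclicQuiver V) : ∃ n, 0 < n ∧ σ.pathPerm ^ n = 1 := by
  have := finite_pathOf hQ
  exact ⟨_, orderOf_pos σ.pathPerm, pow_orderOf_eq_one _⟩

/-- Injective because independent fixed vectors stay independent over the algebraic closure;
surjective because every path is a combination of traces, which are fixed. -/
lemma descentHom_bijective (hQ : IsAcyclicQuiver V) : Bijective (descentHom k σ) := by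
  constructor
  · let b := Module.Basis.ofVectorSpace k (FixedAlg k σ)
    have h1 : LinearIndependent kbar (fun i => fixedVal k σ (b i)) :=
      linearIndependent_of_fixed k σ _ (fun i => frobFun_fixedVal k σ _)
        (b.linearIndependent.map' (fixedVal k σ).toLinearMap
          (LinearMap.ker_eq_bot.2 (fixedVal_injective k σ)))
    let B := b.baseChange kbar
    intro x y hxy
    refine B.repr.injective (h1 ?_)
    have h2 : ∀ z, Finsupp.linearCombination kbar (fun i => fixedVal k σ (b i)) (B.repr z) =
        descentHom k σ z := fun z => by
      conv_rhs => rw [← B.linearCombination_repr z]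
      rw [Finsupp.linearCombination_apply, Finsupp.linearCombination_apply, Finsupp.sum,
        Finsupp.sum, map_sum]
      refine Finset.sum_congr rfl fun i _ => ?_
      rw [map_smul, Module.Basis.baseChange_apply, descentHom_tmul, one_smul]
    rw [h2, h2, hxy]
  · obtain ⟨n, hn, hσ⟩ := exists_pathPerm_pow σ hQ
    rw [← AlgHom.coe_toLinearMap, ← LinearMap.range_eq_top, eq_top_iff]
    intro x _
    induction x using PathAlgebra.induction_on with
    | h0 => exact zero_mem _
    | hadd x y hx hy => exact add_mem (hx trivial) (hy trivial)
    | hs p c =>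
      rw [PathAlgebra.monomial_eq_smul]
      refine Submodule.smul_mem _ _ (Submodule.span_le.2 ?_ (path_mem_span_trace k σ hn p))
      rintro _ ⟨c, rfl⟩
      obtain ⟨a, ha⟩ := exists_fixedVal_eq k σ (frobFun_pathTrace k σ hσ p c)
      exact ⟨1 ⊗ₜ a, (descentHom_tmul k σ 1 a).trans ((one_smul _ _).trans ha)⟩

/-- The path algebra is the base change of the algebra of fixed points. -/
def descent (hQ : IsAcyclicQuiver V) : (kbar ⊗[k] FixedAlg k σ) ≃ₐ[kbar] PathAlgebra kbar V :=
  AlgEquiv.ofBijective (descentHom k σ) (descentHom_bijective k σ hQ)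

lemma descent_tmul (hQ : IsAcyclicQuiver V) (c : kbar) (a : FixedAlg k σ) :
    descent k σ hQ (c ⊗ₜ a) = c • fixedVal k σ a := descentHom_tmul k σ c a

lemma descent_symm_fixedVal (hQ : IsAcyclicQuiver V) (a : FixedAlg k σ) :
    (descent k σ hQ).symm (fixedVal k σ a) = 1 ⊗ₜ a := by
  rw [AlgEquiv.symm_apply_eq, descent_tmul, one_smul]

lemma finite_fixedAlg (hQ : IsAcyclicQuiver V) : Finite (FixedAlg k σ) := by
  have : Finite (PathOf V) := finite_pathOf hQ
  have : Module.Finite kbar (PathAlgebra kbar V) :=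
    inferInstanceAs (Module.Finite kbar (PathOf V →₀ kbar))
  have : Module.Finite kbar (kbar ⊗[k] FixedAlg k σ) :=
    Module.Finite.equiv (descent k σ hQ).symm.toLinearEquiv
  have : Module.Finite k (FixedAlg k σ) :=
    Module.Finite.of_finite_tensorProduct_of_faithfullyFlat kbar
  exact Module.finite_of_finite k

end Descent

/-! ## Base change of bimodules and lifting of derivations -/

namespace Bimod

section BaseChange

variable {k A M : Type u} [Field k] [Ring A] [Algebra k A] [AddCommGroup M] [Module k M]
variable (K : Type u) [Field K] [Algebra k K]

/-- The base change of a family of endomorphisms. -/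
def actBaseChange (f : A →ₗ[k] M →ₗ[k] M) : K ⊗[k] A →ₗ[K] K ⊗[k] M →ₗ[K] K ⊗[k] M :=
  LinearMap.liftBaseChange K (LinearMap.baseChangeHom k K M M ∘ₗ f)

lemma actBaseChange_tmul (f : A →ₗ[k] M →ₗ[k] M) (c d : K) (a : A) (m : M) :
    actBaseChange K f (c ⊗ₜ a) (d ⊗ₜ m) = (c * d) ⊗ₜ f a m := by
  simp [actBaseChange, TensorProduct.smul_tmul']

/-- Bilinear maps out of base changes agree if they agree on pure tensors. -/
lemma induction_two {N : Type u} [AddCommGroup N] [Module k N] {P : K ⊗[k] M → K ⊗[k] N → Prop}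
    (h0 : ∀ y, P 0 y) (h0' : ∀ x, P x 0) (hadd : ∀ x x' y, P x y → P x' y → P (x + x') y)
    (hadd' : ∀ x y y', P x y → P x y' → P x (y + y'))
    (h : ∀ c m d n, P (c ⊗ₜ m) (d ⊗ₜ n)) (x : K ⊗[k] M) (y : K ⊗[k] N) : P x y := by
  induction x with
  | zero => exact h0 y
  | add x x' hx hx' => exact hadd _ _ _ hx hx'
  | tmul c m =>
    induction y with
    | zero => exact h0' _
    | add y y' hy hy' => exact hadd' _ _ _ hy hy'
    | tmul d n => exact h c m d n

/-- The base change of a bimodule. -/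
def baseChange (B : Bimod k A M) : Bimod K (K ⊗[k] A) (K ⊗[k] M) where
  l := actBaseChange K B.l
  r := actBaseChange K B.r
  l_one m := by
    induction m with
    | zero => simp
    | add x y hx hy => rw [map_add, hx, hy]
    | tmul c m => rw [Algebra.TensorProduct.one_def, actBaseChange_tmul, B.l_one, one_mul]
  r_one m := by
    induction m with
    | zero => simp
    | add x y hx hy => rw [map_add, hx, hy]
    | tmul c m => rw [Algebra.TensorProduct.one_def, actBaseChange_tmul, B.r_one, one_mul]
  l_mul a b m := by
    induction m with
    | zero => simp
    | add x y hx hy => simp only [map_add, hx, hy]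
    | tmul e m =>
      induction a, b using induction_two with
      | h0 => simp
      | h0' => simp
      | hadd x x' y hx hx' => simp only [add_mul, map_add, LinearMap.add_apply, hx, hx']
      | hadd' x y y' hx hx' => simp only [mul_add, map_add, LinearMap.add_apply, hx, hx']
      | h c a d b =>
        rw [Algebra.TensorProduct.tmul_mul_tmul, actBaseChange_tmul, actBaseChange_tmul,
          actBaseChange_tmul, B.l_mul, mul_assoc]
  r_mul a b m := by
    induction m with
    | zero => simp
    | add x y hx hy => simp only [map_add, hx, hy]
    | tmul e m =>
      induction a, b using induction_two with
      | h0 => simp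
      | h0' => simp
      | hadd x x' y hx hx' => simp only [add_mul, map_add, LinearMap.add_apply, hx, hx']
      | hadd' x y y' hx hx' => simp only [mul_add, map_add, LinearMap.add_apply, hx, hx']
      | h c a d b =>
        rw [Algebra.TensorProduct.tmul_mul_tmul, actBaseChange_tmul, actBaseChange_tmul,
          actBaseChange_tmul, B.r_mul, mul_comm c, mul_assoc]
  comm a b m := by
    induction m with
    | zero => simp
    | add x y hx hy => simp only [map_add, hx, hy]
    | tmul e m =>
      induction a, b using induction_two with
      | h0 => simp
      | h0' => simp
      | hadd x x' y hx hx' => simp only [map_add, LinearMap.add_apply, hx, hx']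
      | hadd' x y y' hx hx' => simp only [map_add, LinearMap.add_apply, hx, hx']
      | h c a d b =>
        simp only [actBaseChange_tmul, B.comm, mul_left_comm]

lemma IsDer.baseChange {B : Bimod k A M} {δ : A →ₗ[k] M} (hδ : B.IsDer δ) :
    (B.baseChange K).IsDer (δ.baseChange K) := fun a b => by
  induction a, b using induction_two with
  | h0 => simp
  | h0' => simp
  | hadd x x' y hx hx' => simp only [add_mul, map_add, LinearMap.add_apply, hx, hx']; abel
  | hadd' x y y' hx hx' => simp only [mul_add, map_add, LinearMap.add_apply, hx, hx']; abel
  | h c a d b =>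
    change δ.baseChange K _ = actBaseChange K B.l _ _ + actBaseChange K B.r _ _
    rw [Algebra.TensorProduct.tmul_mul_tmul, LinearMap.baseChange_tmul, LinearMap.baseChange_tmul,
      LinearMap.baseChange_tmul, actBaseChange_tmul, actBaseChange_tmul, hδ,
      TensorProduct.tmul_add, mul_comm d]

end BaseChange

/-- The bimodule structure along a homomorphism of algebras. -/
def comap {K R R' M : Type*} [Field K] [Ring R] [Algebra K R] [Ring R'] [Algebra K R']
    [AddCommGroup M] [Module K M] (B : Bimod K R M) (f : R' →ₐ[K] R) : Bimod K R' M where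
  l := B.l ∘ₗ f.toLinearMap
  r := B.r ∘ₗ f.toLinearMap
  l_one m := by simp [B.l_one]
  r_one m := by simp [B.r_one]
  l_mul a b m := by simp [B.l_mul]
  r_mul a b m := by simp [B.r_mul]
  comm a b m := B.comm _ _ _

/-- The bimodule `Hom_k(X, Y)`. -/
def hom (k A X Y : Type*) [Field k] [Ring A] [Algebra k A] [AddCommGroup X] [Module k X]
    [Module A X] [IsScalarTower k A X] [AddCommGroup Y] [Module k Y] [Module A Y]
    [IsScalarTower k A Y] : Bimod k A (X →ₗ[k] Y) where
  l := LinearMap.llcomp k X Y Y ∘ₗ (Algebra.lsmul k k Y).toLinearMap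
  r := (LinearMap.llcomp k X X Y).flip ∘ₗ (Algebra.lsmul k k X).toLinearMap
  l_one _ := LinearMap.ext fun _ => one_smul A _
  r_one m := LinearMap.ext fun x => congrArg m (one_smul A x)
  l_mul a b _ := LinearMap.ext fun _ => mul_smul a b _
  r_mul a b m := LinearMap.ext fun x => congrArg m (mul_smul a b x)
  comm _ _ _ := rfl

end Bimod

/-! ### Heredity: right exactness of Ext¹ in both arguments -/

section Lift

variable (k : Type u) [Field k] [Fintype k] {V : Type u} [Quiver.{u} V] [Fintype V]
  [∀ a b : V, Fintype (a ⟶ b)] (σ : QuiverAut V)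

local notation "kbar" => AlgebraicClosure k

/-- Derivations of the algebra of fixed points lift along surjections of bimodules. -/
lemma exists_lift_der (hQ : IsAcyclicQuiver V) {M M' : Type u} [AddCommGroup M] [Module k M]
    [AddCommGroup M'] [Module k M'] (B : Bimod k (FixedAlg k σ) M) (B' : Bimod k (FixedAlg k σ) M')
    (π : M →ₗ[k] M') (hπ : Surjective π)
    (hl : ∀ a m, π (B.l a m) = B'.l a (π m)) (hr : ∀ a m, π (B.r a m) = B'.r a (π m))
    {δ : FixedAlg k σ →ₗ[k] M'} (hδ : B'.IsDer δ) :
    ∃ δ' : FixedAlg k σ →ₗ[k] M, B.IsDer δ' ∧ ∀ a, π (δ' a) = δ a := by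
  let e := descent k σ hQ
  let BK := (B.baseChange kbar).comap e.symm.toAlgHom
  let BK' := (B'.baseChange kbar).comap e.symm.toAlgHom
  have hact : ∀ (f : FixedAlg k σ →ₗ[k] M →ₗ[k] M) (f' : FixedAlg k σ →ₗ[k] M' →ₗ[k] M'),
      (∀ a m, π (f a m) = f' a (π m)) → ∀ a m, π.baseChange kbar (Bimod.actBaseChange kbar f a m) =
        Bimod.actBaseChange kbar f' a (π.baseChange kbar m) := fun f f' h a m => by
    induction a, m using Bimod.induction_two with
    | h0 => simp
    | h0' => simp
    | hadd x x' y hx hx' => simp only [map_add, LinearMap.add_apply, hx, hx']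
    | hadd' x y y' hx hx' => simp only [map_add, hx, hx']
    | h c a d m =>
      rw [Bimod.actBaseChange_tmul, LinearMap.baseChange_tmul, LinearMap.baseChange_tmul,
        Bimod.actBaseChange_tmul, h]
  obtain ⟨δK, hδK, hlift⟩ := PathAlgebra.exists_lift_der BK BK' (π.baseChange kbar)
    (LinearMap.lTensor_surjective _ hπ) (fun a m => hact _ _ hl _ m) (fun a m => hact _ _ hr _ m)
    (δ := δ.baseChange kbar ∘ₗ e.symm.toLinearMap) fun a b => by
      change δ.baseChange kbar (e.symm (a * b)) = _
      rw [map_mul]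
      exact hδ.baseChange kbar _ _
  -- The lift over the path algebra is brought back by a k-linear retraction t of k → kbar. Fixed
  -- points act on kbar ⊗ M through the second factor only, so applying t preserves the derivation
  -- rule.
  obtain ⟨t, ht⟩ := (Algebra.linearMap k kbar).exists_leftInverse_of_injective
    (LinearMap.ker_eq_bot.2 (algebraMap k kbar).injective)
  have ht1 : t 1 = 1 := by
    have := LinearMap.congr_fun ht 1
    simpa using this
  let T : ∀ (M : Type u) [AddCommGroup M] [Module k M], kbar ⊗[k] M →ₗ[k] M := fun M _ _ =>
    (TensorProduct.lid k M).toLinearMap ∘ₗ t.rTensor M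
  have hT : ∀ (M : Type u) [AddCommGroup M] [Module k M] c (m : M), T M (c ⊗ₜ m) = t c • m :=
    fun M _ _ c m => by simp [T]
  have hTact : ∀ (f : FixedAlg k σ →ₗ[k] M →ₗ[k] M) a m,
      T M (Bimod.actBaseChange kbar f (1 ⊗ₜ a) m) = f a (T M m) := fun f a m => by
    induction m with
    | zero => simp
    | add x y hx hy => simp only [map_add, hx, hy]
    | tmul c m => rw [Bimod.actBaseChange_tmul, one_mul, hT, hT, map_smul]
  have hTπ : ∀ m, π (T M m) = T M' (π.baseChange kbar m) := fun m => by
    induction m with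
    | zero => simp
    | add x y hx hy => simp only [map_add, hx, hy]
    | tmul c m => rw [LinearMap.baseChange_tmul, hT, hT, map_smul]
  refine ⟨T M ∘ₗ δK.restrictScalars k ∘ₗ (fixedVal k σ).toLinearMap, fun a b => ?_, fun a => ?_⟩
  · change T M (δK (fixedVal k σ (a * b))) = B.l a (T M (δK (fixedVal k σ b))) +
      B.r b (T M (δK (fixedVal k σ a)))
    rw [map_mul, hδK, map_add, ← hTact, ← hTact, ← descent_symm_fixedVal k σ hQ,
      ← descent_symm_fixedVal k σ hQ]
    rfl
  · change π (T M (δK (fixedVal k σ a))) = δ a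
    rw [hTπ, hlift]
    change T M' (δ.baseChange kbar (e.symm (fixedVal k σ a))) = _
    rw [descent_symm_fixedVal, LinearMap.baseChange_tmul, hT, ht1, one_smul]

variable {k σ}
variable {X Y Z : Type u} [AddCommGroup X] [Module k X] [Module (FixedAlg k σ) X]
  [IsScalarTower k (FixedAlg k σ) X] [AddCommGroup Y] [Module k Y] [Module (FixedAlg k σ) Y]
  [IsScalarTower k (FixedAlg k σ) Y] [AddCommGroup Z] [Module k Z] [Module (FixedAlg k σ) Z]
  [IsScalarTower k (FixedAlg k σ) Z]

/-- The functor `Ext¹(X, -)` is right exact. -/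
lemma ExtZero.of_surjective (hQ : IsAcyclicQuiver V) (h : ExtZero k (FixedAlg k σ) X Y)
    (p : Y →ₗ[FixedAlg k σ] Z) (hp : Surjective p) : ExtZero k (FixedAlg k σ) X Z := fun δ hδ => by
  obtain ⟨t, ht⟩ := (p.restrictScalars k).exists_rightInverse_of_surjective
    (LinearMap.range_eq_top.2 hp)
  -- Composition with p is a surjection of bimodules, as p splits over k. The lift of δ is inner,
  -- hence so is δ.
  obtain ⟨δ', hδ', hp'⟩ := exists_lift_der k σ hQ (Bimod.hom k (FixedAlg k σ) X Y)
    (Bimod.hom k (FixedAlg k σ) X Z) (LinearMap.llcomp k X Y Z (p.restrictScalars k))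
    (fun g => ⟨t ∘ₗ g, LinearMap.ext fun x => LinearMap.congr_fun ht (g x)⟩)
    (fun a m => LinearMap.ext fun x => p.map_smul a (m x)) (fun a m => rfl)
    (δ := δ) fun a b => LinearMap.ext fun x => hδ a b x
  obtain ⟨s, hs⟩ := h δ' fun a b x => LinearMap.congr_fun (hδ' a b) x
  refine ⟨p.restrictScalars k ∘ₗ s, fun a x => ?_⟩
  have := LinearMap.congr_fun (hp' a) x
  change p (δ' a x) = δ a x at this
  rw [← this, hs, map_sub, p.map_smul]
  rfl

/-- The functor `Ext¹(-, Y)` is right exact. -/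
lemma ExtZero.of_injective (hQ : IsAcyclicQuiver V) (h : ExtZero k (FixedAlg k σ) X Y)
    (i : Z →ₗ[FixedAlg k σ] X) (hi : Injective i) : ExtZero k (FixedAlg k σ) Z Y := fun δ hδ => by
  obtain ⟨t, ht⟩ := (i.restrictScalars k).exists_leftInverse_of_injective
    (LinearMap.ker_eq_bot.2 hi)
  obtain ⟨δ', hδ', hp'⟩ := exists_lift_der k σ hQ (Bimod.hom k (FixedAlg k σ) X Y)
    (Bimod.hom k (FixedAlg k σ) Z Y) ((LinearMap.llcomp k Z X Y).flip (i.restrictScalars k))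
    (fun g => ⟨g ∘ₗ t, LinearMap.ext fun x => congrArg g (LinearMap.congr_fun ht x)⟩)
    (fun a m => rfl) (fun a m => LinearMap.ext fun x => congrArg m (i.map_smul a x).symm)
    (δ := δ) fun a b => LinearMap.ext fun x => hδ a b x
  obtain ⟨s, hs⟩ := h δ' fun a b x => LinearMap.congr_fun (hδ' a b) x
  refine ⟨s ∘ₗ i.restrictScalars k, fun a x => ?_⟩
  have := LinearMap.congr_fun (hp' a) x
  change δ' a (i x) = δ a x at this
  rw [← this, hs, ← i.map_smul]
  rfl

end Lift

/-! ## The Euler form and self-extensions -/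

section OrbitField

variable (k : Type u) [Field k] [Fintype k] {V : Type u} [Quiver.{u} V] [Fintype V]
  (σ : QuiverAut V)

local notation "kbar" => AlgebraicClosure k

variable {σ} in
lemma iff_of_orbit_eq {P : V → Prop} (hP : ∀ a, P (σ.hom.obj a) ↔ P a) {a b : V}
    (h : σ.orbit a = σ.orbit b) : P a ↔ P b := by
  obtain ⟨n, rfl⟩ : Equiv.Perm.SameCycle σ.vertexPerm a b := Quotient.exact h
  clear h
  induction n using Int.induction_on generalizing a with
  | zero => rfl
  | succ n ih =>
    rw [zpow_add_one, Equiv.Perm.mul_apply, ← ih]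
    exact (hP a).symm
  | pred n ih =>
    rw [zpow_sub_one, Equiv.Perm.mul_apply, ← ih]
    exact (iff_of_eq (congrArg P (σ.vertexPerm.apply_symm_apply a).symm)).trans (hP _)

lemma orbitField_apply (i : σ.Orbit) (f : orbitField k σ i) (a : {a : V // σ.orbit a = i}) :
    f.1 ⟨σ.hom.obj a.1, (σ.orbit_hom a.1).trans a.2⟩ = f.1 a ^ Fintype.card k := f.2 a

/-- By f_{σa} = f_a^q, vanishing at one vertex spreads over the whole orbit. This is what makes D_i
a field. -/
lemma orbitField_apply_ne_zero {i : σ.Orbit} {f : orbitField k σ i} (hf : f ≠ 0)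
    (a : {a : V // σ.orbit a = i}) : f.1 a ≠ 0 := fun ha => hf (Subtype.ext (funext fun b => by
  have := iff_of_orbit_eq (P := fun c => ∀ h : σ.orbit c = i, f.1 ⟨c, h⟩ = 0) (fun c => by
    constructor
    · intro H h
      have := H ((σ.orbit_hom c).trans h)
      rw [orbitField_apply k σ i f ⟨c, h⟩] at this
      exact eq_zero_of_pow_eq_zero this
    · intro H h
      have hc := (σ.orbit_hom c).symm.trans h
      rw [orbitField_apply k σ i f ⟨c, hc⟩, H hc, zero_pow Fintype.card_ne_zero])
    (a.2.trans b.2.symm)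
  exact this.1 (fun _ => ha) b.2))

instance (i : σ.Orbit) : Field (orbitField k σ i) :=
  { (inferInstance : CommRing (orbitField k σ i)) with
    inv := fun f => ⟨fun a => (f.1 a)⁻¹, fun a => by
      change (f.1 _)⁻¹ = (f.1 a)⁻¹ ^ _
      rw [f.2 a, inv_pow]⟩
    exists_pair_ne := by
      obtain ⟨a, rfl⟩ := Quotient.exists_rep i
      exact ⟨0, 1, fun h => zero_ne_one (congrFun (congrArg Subtype.val h)
        (⟨a, rfl⟩ : {b : V // σ.orbit b = σ.orbit a}))⟩
    mul_inv_cancel := fun f hf => Subtype.ext (funext fun a =>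
      mul_inv_cancel₀ (orbitField_apply_ne_zero k σ hf a))
    inv_zero := Subtype.ext (funext fun a => inv_zero)
    nnqsmul := _
    nnqsmul_def := fun _ _ => rfl
    qsmul := _
    qsmul_def := fun _ _ => rfl }

/-- The coefficient of the trivial path at `a`. -/
def trivCoeff (a : V) : PathAlgebra kbar V →ₗ[kbar] kbar :=
  (Finsupp.lapply ⟨a, a, Quiver.Path.nil⟩ : (PathOf V →₀ kbar) →ₗ[kbar] kbar)

lemma trivCoeff_monomial [DecidableEq (PathOf V)] (a : V) (p : PathOf V) (c : kbar) :
    trivCoeff k a (PathAlgebra.monomial p c) = if p = ⟨a, a, Quiver.Path.nil⟩ then c else 0 := by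
  change Finsupp.single p c _ = _
  rw [Finsupp.single_apply]

lemma trivCoeff_diag (i : σ.Orbit) (f : {a : V // σ.orbit a = i} → kbar)
    (a : {a : V // σ.orbit a = i}) : trivCoeff k a.1 (diag k σ i f) = f a := by
  classical
  rw [diag, map_sum, Finset.sum_eq_single a]
  · rw [trivCoeff_monomial, if_pos rfl]
  · intro b _ hb
    rw [trivCoeff_monomial, if_neg fun h => hb (Subtype.ext (congrArg (fun p => p.1) h))]
  · exact fun h => absurd (Finset.mem_univ a) h

lemma trivCoeff_frobFun (a : V) (x : PathAlgebra kbar V) :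
    trivCoeff k (σ.hom.obj a) (frobFun k σ x) = trivCoeff k a x ^ Fintype.card k := by
  classical
  induction x using PathAlgebra.induction_on with
  | h0 => rw [frobFun_zero, map_zero, map_zero, zero_pow Fintype.card_ne_zero]
  | hadd x y hx hy => rw [frobFun_add, map_add, map_add, hx, hy, pow_card_add]
  | hs p c =>
    rw [frobFun_monomial, trivCoeff_monomial, trivCoeff_monomial]
    have : σ.onPath p = ⟨σ.hom.obj a, σ.hom.obj a, Quiver.Path.nil⟩ ↔
        p = ⟨a, a, Quiver.Path.nil⟩ :=
      σ.pathPerm.injective.eq_iff (a := p) (b := ⟨a, a, Quiver.Path.nil⟩)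
    by_cases h : p = ⟨a, a, Quiver.Path.nil⟩
    · rw [if_pos h, if_pos (this.2 h)]
    · rw [if_neg h, if_neg fun h' => h (this.1 h'), zero_pow Fintype.card_ne_zero]

/-- The trivial path at a vertex is in the span of the corresponding orbit field. -/
lemma triv_mem_span_orbitEmb [∀ a b : V, Fintype (a ⟶ b)] (hQ : IsAcyclicQuiver V) (a : V) :
    PathAlgebra.triv kbar a ∈ Submodule.span kbar
      (Set.range fun f : orbitField k σ (σ.orbit a) => fixedVal k σ (orbitEmb k σ (σ.orbit a) f)) := by
  classical
  obtain ⟨n, hn, hσ⟩ := exists_pathPerm_pow σ hQ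
  refine Submodule.span_mono ?_ (path_mem_span_trace k σ hn ⟨a, a, Quiver.Path.nil⟩)
  rintro _ ⟨c, rfl⟩
  set t := pathTrace k σ n ⟨a, a, Quiver.Path.nil⟩ c.1 with ht
  have hfix : frobFun k σ t = t := frobFun_pathTrace k σ hσ _ c
  have hpow : ∀ j : ℕ, ∃ b, σ.orbit b = σ.orbit a ∧
      (σ.pathPerm ^ j) ⟨a, a, Quiver.Path.nil⟩ = ⟨b, b, Quiver.Path.nil⟩ := fun j => by
    induction j with
    | zero => exact ⟨a, rfl, rfl⟩
    | succ j ih =>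
      obtain ⟨b, hb, hj⟩ := ih
      refine ⟨σ.hom.obj b, (σ.orbit_hom b).trans hb, ?_⟩
      rw [pow_succ', Equiv.Perm.mul_apply, hj]
      rfl
  -- The trace involves only trivial paths of the orbit, so it is the diagonal element of its own
  -- coefficients; its invariance puts these in D_i.
  refine ⟨⟨fun b => trivCoeff k b.1 t, fun b => ?_⟩, ?_⟩
  · change trivCoeff k (σ.hom.obj b.1) t = _
    rw [← trivCoeff_frobFun k σ, hfix]
  · change diag k σ (σ.orbit a) (fun b => trivCoeff k b.1 t) = t
    have hdiag : ∀ b (c : kbar), σ.orbit b = σ.orbit a →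
        diag k σ (σ.orbit a) (fun d => trivCoeff k d.1 (PathAlgebra.monomial ⟨b, b, Quiver.Path.nil⟩ c)) =
          PathAlgebra.monomial ⟨b, b, Quiver.Path.nil⟩ c := fun b c hb => by
      rw [diag, Finset.sum_eq_single ⟨b, hb⟩]
      · rw [trivCoeff_monomial, if_pos rfl]
      · intro d _ hd
        rw [trivCoeff_monomial, if_neg fun h => hd (Subtype.ext (congrArg (fun p => p.1) h).symm)]
        exact Finsupp.single_zero _
      · exact fun h => absurd (Finset.mem_univ _) h
    have hsum : ∀ (s : Finset ℕ) (g : ℕ → PathAlgebra kbar V),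
        diag k σ (σ.orbit a) (fun d => trivCoeff k d.1 (∑ j ∈ s, g j)) =
          ∑ j ∈ s, diag k σ (σ.orbit a) (fun d => trivCoeff k d.1 (g j)) := fun s g => by
      simp only [diag, map_sum]
      rw [Finset.sum_comm]
      refine Finset.sum_congr rfl fun d _ => ?_
      exact Finsupp.single_finsetSum _ _ _
    rw [ht, pathTrace, hsum]
    refine Finset.sum_congr rfl fun j _ => ?_
    obtain ⟨b, hb, hj⟩ := hpow j
    rw [hj, hdiag b _ hb]

/-- Multiplication of a diagonal element by a trivial path. -/
lemma triv_mul_orbitEmb (a : V) (f : orbitField k σ (σ.orbit a)) :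
    PathAlgebra.triv kbar a * fixedVal k σ (orbitEmb k σ (σ.orbit a) f) =
      f.1 ⟨a, rfl⟩ • PathAlgebra.triv kbar a := by
  classical
  change _ * diag k σ (σ.orbit a) f.1 = _
  rw [diag, Finset.mul_sum, Finset.sum_eq_single ⟨a, rfl⟩]
  · rw [PathAlgebra.monomial_eq_smul, mul_smul_comm]
    exact congrArg _ (PathAlgebra.triv_mul_path _)
  · intro b _ hb
    rw [PathAlgebra.monomial_eq_smul, mul_smul_comm]
    refine (congrArg _ (PathAlgebra.path_mul_path_of_ne _ _ fun h => hb (Subtype.ext h))).trans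
      (smul_zero _)
  · exact fun h => absurd (Finset.mem_univ _) h

end OrbitField

/-! ### Vanishing of self-extensions after base change -/

section Inner

variable (k : Type u) [Field k] [Fintype k] {V : Type u} [Quiver.{u} V] [Fintype V]
  [∀ a b : V, Fintype (a ⟶ b)] (σ : QuiverAut V) (hQ : IsAcyclicQuiver V)
  (L : Type u) [AddCommGroup L] [Module k L] [Module (FixedAlg k σ) L]
  [IsScalarTower k (FixedAlg k σ) L]

local notation "kbar" => AlgebraicClosure k

/-- The endomorphisms of a representation as a bimodule. -/
def Bimod.ofEnd {K R W : Type*} [Field K] [Ring R] [Algebra K R] [AddCommGroup W] [Module K W]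
    (ρ : R →ₐ[K] Module.End K W) : Bimod K R (W →ₗ[K] W) where
  l := LinearMap.mk₂ K (fun a m => ρ a ∘ₗ m)
    (fun a b m => by rw [map_add]; rfl) (fun c a m => by rw [map_smul]; rfl)
    (fun a m n => LinearMap.comp_add _ _ _) (fun c a m => LinearMap.comp_smul _ _ _)
  r := LinearMap.mk₂ K (fun a m => m ∘ₗ ρ a)
    (fun a b m => by rw [map_add]; exact LinearMap.comp_add _ _ _)
    (fun c a m => by rw [map_smul]; exact LinearMap.comp_smul _ _ _)
    (fun a m n => rfl) (fun c a m => rfl)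
  l_one m := by rw [LinearMap.mk₂_apply, map_one]; rfl
  r_one m := by rw [LinearMap.mk₂_apply, map_one]; rfl
  l_mul a b m := by rw [LinearMap.mk₂_apply, map_mul]; rfl
  r_mul a b m := by rw [LinearMap.mk₂_apply, map_mul]; rfl
  comm a b m := rfl

/-- The action of the path algebra on the base change of a module. -/
def act : PathAlgebra kbar V →ₐ[kbar] Module.End kbar (kbar ⊗[k] L) :=
  ((LinearMap.tensorProductEnd k kbar L).comp
    (Algebra.TensorProduct.map (AlgHom.id kbar kbar) (Algebra.lsmul k k L))).comp
      (descent k σ hQ).symm.toAlgHom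

lemma act_fixedVal (a : FixedAlg k σ) (c : kbar) (x : L) :
    act k σ hQ L (fixedVal k σ a) (c ⊗ₜ x) = c ⊗ₜ (a • x) := by
  have : act k σ hQ L (fixedVal k σ a) = LinearMap.tensorProductEnd k kbar L
      (Algebra.TensorProduct.map (AlgHom.id kbar kbar) (Algebra.lsmul k k L)
        ((descent k σ hQ).symm (fixedVal k σ a))) := rfl
  rw [this, descent_symm_fixedVal, Algebra.TensorProduct.map_tmul]
  change ((1 : kbar) • (Algebra.lsmul k k L a).baseChange kbar) (c ⊗ₜ x) = _
  rw [one_smul, LinearMap.baseChange_tmul]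
  rfl

/-- The bimodule of endomorphisms of the base change of a module. -/
def actBimod : Bimod kbar (PathAlgebra kbar V) (kbar ⊗[k] L →ₗ[kbar] kbar ⊗[k] L) :=
  Bimod.ofEnd (act k σ hQ L)

/-- `K`-linear maps on the path algebra agree if they agree on fixed points. -/
lemma hom_ext_fixedVal (hQ : IsAcyclicQuiver V) {W : Type*} [AddCommGroup W] [Module kbar W]
    {f g : PathAlgebra kbar V →ₗ[kbar] W} (h : ∀ a : FixedAlg k σ, f (fixedVal k σ a) = g (fixedVal k σ a)) :
    f = g := by
  refine LinearMap.ext fun x => ?_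
  obtain ⟨y, rfl⟩ := (descent k σ hQ).surjective x
  induction y with
  | zero => simp
  | add x y hx hy => rw [map_add, map_add, map_add, hx, hy]
  | tmul c a => rw [descent_tmul, map_smul, map_smul, h]

/-- The coordinate functions of a tensor product of `k`-spaces. -/
def coordMap (M : Type u) [AddCommGroup M] [Module k M] (t : kbar →ₗ[k] k) : kbar ⊗[k] M →ₗ[k] M :=
  (TensorProduct.lid k M).toLinearMap ∘ₗ t.rTensor M

lemma coordMap_tmul (M : Type u) [AddCommGroup M] [Module k M] (t : kbar →ₗ[k] k) (c : kbar) (m : M) :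
    coordMap k M t (c ⊗ₜ m) = t c • m := by simp [coordMap]

/-- The expansion is allowed over any larger index set, so that one finite set can serve finitely
many tensors at once. -/
lemma exists_eq_sum_coordMap {ι : Type*} (κ : Module.Basis ι k kbar) {M : Type u} [AddCommGroup M]
    [Module k M] (z : kbar ⊗[k] M) : ∃ J₀ : Finset ι, ∀ J, J₀ ⊆ J →
      ∑ j ∈ J, κ j ⊗ₜ[k] coordMap k M (κ.coord j) z = z := by
  classical
  induction z with
  | zero => exact ⟨∅, fun J _ => by simp⟩
  | add x y hx hy =>
    obtain ⟨J₁, h₁⟩ := hx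
    obtain ⟨J₂, h₂⟩ := hy
    refine ⟨J₁ ∪ J₂, fun J hJ => ?_⟩
    simp only [map_add, TensorProduct.tmul_add, Finset.sum_add_distrib]
    rw [h₁ J (Finset.union_subset_left hJ), h₂ J (Finset.union_subset_right hJ)]
  | tmul c m =>
    refine ⟨(κ.repr c).support, fun J hJ => ?_⟩
    simp only [coordMap_tmul, ← TensorProduct.smul_tmul, ← TensorProduct.sum_tmul]
    congr 1
    conv_rhs => rw [← κ.linearCombination_repr c, Finsupp.linearCombination_apply,
      Finsupp.sum_of_support_subset _ hJ _ (fun i _ => by rw [zero_smul])]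
    rfl

variable {k σ L} in
/-- If `Ext¹(L, L) = 0`, then all derivations of the path algebra in the endomorphisms of the base
change of `L` are inner. -/
lemma ExtZero.exists_inner [Finite L] (h : ExtZero k (FixedAlg k σ) L L)
    {δ : PathAlgebra kbar V →ₗ[kbar] kbar ⊗[k] L →ₗ[kbar] kbar ⊗[k] L}
    (hδ : (actBimod k σ hQ L).IsDer δ) :
    ∃ s : kbar ⊗[k] L →ₗ[kbar] kbar ⊗[k] L, ∀ x z, δ x z = act k σ hQ L x (s z) - s (act k σ hQ L x z) := by
  classical
  have := finite_fixedAlg k σ hQ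
  have := Fintype.ofFinite (FixedAlg k σ)
  have := Fintype.ofFinite L
  let κ := Module.Basis.ofVectorSpace k kbar
  have hact : ∀ t a (z : kbar ⊗[k] L), coordMap k L t (act k σ hQ L (fixedVal k σ a) z) =
      a • coordMap k L t z := fun t a z => by
    induction z with
    | zero => simp
    | add x y hx hy => rw [map_add, map_add, hx, hy, map_add, smul_add]
    | tmul c m => rw [act_fixedVal, coordMap_tmul, coordMap_tmul, smul_comm]
  -- Each coordinate of δ over k is a derivation of A in End_k(L), hence inner. As A and L are
  -- finite, finitely many basis elements suffice, and the endomorphisms found for them combine to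
  -- S.
  let d : ∀ t : kbar →ₗ[k] k, FixedAlg k σ →ₗ[k] L →ₗ[k] L := fun t =>
    LinearMap.mk₂ k (fun a x => coordMap k L t (δ (fixedVal k σ a) (1 ⊗ₜ x)))
      (fun a b x => by simp only [map_add, LinearMap.add_apply])
      (fun c a x => by
        rw [map_smul, LinearMap.map_smul_of_tower, LinearMap.smul_apply, map_smul])
      (fun a x y => by simp only [TensorProduct.tmul_add, map_add])
      (fun c a x => by
        rw [TensorProduct.tmul_smul, LinearMap.map_smul_of_tower, map_smul])
  have hd : ∀ t a x, d t a x = coordMap k L t (δ (fixedVal k σ a) (1 ⊗ₜ x)) := fun _ _ _ => rfl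
  have hder : ∀ t, IsDer k (FixedAlg k σ) (d t) := fun t a b x => by
    have h1 := LinearMap.congr_fun (hδ (fixedVal k σ a) (fixedVal k σ b)) (1 ⊗ₜ x)
    change _ = act k σ hQ L (fixedVal k σ a) (δ (fixedVal k σ b) (1 ⊗ₜ x)) +
      δ (fixedVal k σ a) (act k σ hQ L (fixedVal k σ b) (1 ⊗ₜ x)) at h1
    rw [hd, hd, hd, map_mul, h1, map_add, hact, act_fixedVal]
  choose s hs using fun t => h (d t) (hder t)
  choose J₀ hJ₀ using fun z : kbar ⊗[k] L => exists_eq_sum_coordMap k κ z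
  let J := Finset.univ.biUnion fun p : FixedAlg k σ × L => J₀ (δ (fixedVal k σ p.1) (1 ⊗ₜ p.2))
  have hJ : ∀ a x, ∑ j ∈ J, κ j ⊗ₜ[k] d (κ.coord j) a x = δ (fixedVal k σ a) (1 ⊗ₜ x) :=
    fun a x => hJ₀ _ _ (Finset.subset_biUnion_of_mem
      (fun p : FixedAlg k σ × L => J₀ (δ (fixedVal k σ p.1) (1 ⊗ₜ p.2))) (Finset.mem_univ (a, x)))
  let S : kbar ⊗[k] L →ₗ[kbar] kbar ⊗[k] L := ∑ j ∈ J, κ j • (s (κ.coord j)).baseChange kbar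
  have hS : ∀ x, S (1 ⊗ₜ x) = ∑ j ∈ J, κ j ⊗ₜ[k] s (κ.coord j) x := fun x => by
    simp [S, LinearMap.sum_apply, TensorProduct.smul_tmul']
  have key : δ = (actBimod k σ hQ L).inner S := by
    refine hom_ext_fixedVal k σ hQ (W := kbar ⊗[k] L →ₗ[kbar] kbar ⊗[k] L) fun a => ?_
    refine TensorProduct.AlgebraTensorModule.curry_injective (LinearMap.ext_ring (LinearMap.ext fun x => ?_))
    change δ (fixedVal k σ a) (1 ⊗ₜ x) =
      act k σ hQ L (fixedVal k σ a) (S (1 ⊗ₜ x)) - S (act k σ hQ L (fixedVal k σ a) (1 ⊗ₜ x))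
    rw [act_fixedVal, hS, hS, map_sum, ← hJ, ← Finset.sum_sub_distrib]
    refine Finset.sum_congr rfl fun j _ => ?_
    rw [act_fixedVal, hs, TensorProduct.tmul_sub]
  exact ⟨S, fun x z => by rw [key]; rfl⟩

end Inner

/-! ### Dimension count for representations of a quiver -/

section Rep

variable {K : Type u} [Field K] {V : Type u} [Quiver.{u} V] [Fintype V]
  [∀ a b : V, Fintype (a ⟶ b)] {W : Type u} [AddCommGroup W] [Module K W]
  (ρ : PathAlgebra K V →ₐ[K] Module.End K W)

/-- The space of a representation at a vertex. -/
abbrev repAt (a : V) : Submodule K W := LinearMap.range (ρ (PathAlgebra.triv K a))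

lemma ρ_triv_idem (a : V) (z : W) :
    ρ (PathAlgebra.triv K a) (ρ (PathAlgebra.triv K a) z) = ρ (PathAlgebra.triv K a) z := by
  classical
  have h := PathAlgebra.triv_mul_path (K := K) (Quiver.Path.nil (a := a))
  change ((ρ _ * ρ _ : Module.End K W)) z = _
  rw [← map_mul]
  exact congrArg (fun x => ρ x z) h

/-- The map of a representation at an arrow. -/
def repMap {a b : V} (f : a ⟶ b) : repAt ρ a →ₗ[K] repAt ρ b :=
  (ρ (PathAlgebra.triv K b)).rangeRestrict ∘ₗ ρ (PathAlgebra.arrow K f) ∘ₗ (repAt ρ a).subtype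

lemma rep_rangeRestrict_coe (a : V) (z : repAt ρ a) :
    (ρ (PathAlgebra.triv K a)).rangeRestrict z = z := by
  obtain ⟨_, z, rfl⟩ := z
  exact Subtype.ext (ρ_triv_idem ρ a z)

/-- The commutator with the maps of a representation. -/
def repComm : (∀ a : V, repAt ρ a →ₗ[K] repAt ρ a) →ₗ[K]
    ∀ r : QuiverAut.ArrowOf V, repAt ρ r.1 →ₗ[K] repAt ρ r.2.1 where
  toFun s r := repMap ρ r.2.2 ∘ₗ s r.1 - s r.2.1 ∘ₗ repMap ρ r.2.2
  map_add' s t := funext fun r => by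
    simp only [Pi.add_apply, LinearMap.comp_add, LinearMap.add_comp]
    abel
  map_smul' c s := funext fun r => by
    simp only [Pi.smul_apply, LinearMap.comp_smul, LinearMap.smul_comp, smul_sub, RingHom.id_apply]

/-- A family of maps on the arrows defines a derivation in End(W). If that is the inner derivation
of s, the diagonal blocks e_a s e_a form a preimage. -/
lemma repComm_surjective (h : ∀ δ, (Bimod.ofEnd ρ).IsDer δ → ∃ s, δ = (Bimod.ofEnd ρ).inner s) :
    Surjective (repComm ρ) := fun t => by
  have hcomp : ∀ x y z, ρ x (ρ y z) = ρ (x * y) z := fun x y z => by rw [map_mul]; rfl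
  obtain ⟨δ, hδ, -, hf⟩ := PathAlgebra.exists_der (Bimod.ofEnd ρ)
    (fun a b f => (repAt ρ b).subtype ∘ₗ t ⟨a, b, f⟩ ∘ₗ (ρ (PathAlgebra.triv K a)).rangeRestrict)
    (fun a b f => LinearMap.ext fun z => congrArg Subtype.val (rep_rangeRestrict_coe ρ b _))
    (fun a b f => LinearMap.ext fun z => congrArg (fun z => (t ⟨a, b, f⟩ z).1)
      (rep_rangeRestrict_coe ρ a ((ρ (PathAlgebra.triv K a)).rangeRestrict z)))
  obtain ⟨s, hs⟩ := h δ hδ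
  refine ⟨fun a => (ρ (PathAlgebra.triv K a)).rangeRestrict ∘ₗ s ∘ₗ (repAt ρ a).subtype,
    funext fun r => LinearMap.ext fun z => ?_⟩
  obtain ⟨a, b, f⟩ := r
  have h1 := LinearMap.congr_fun (hf a b f) z.1
  rw [hs] at h1
  change ρ (PathAlgebra.arrow K f) (s z.1) - s (ρ (PathAlgebra.arrow K f) z.1) =
    (t ⟨a, b, f⟩ ((ρ (PathAlgebra.triv K a)).rangeRestrict z.1) : W) at h1
  rw [rep_rangeRestrict_coe] at h1
  refine Subtype.ext ?_
  change ρ (PathAlgebra.triv K b) (ρ (PathAlgebra.arrow K f) (ρ (PathAlgebra.triv K a) (s z.1))) -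
    ρ (PathAlgebra.triv K b) (s (ρ (PathAlgebra.triv K b) (ρ (PathAlgebra.arrow K f) z.1))) = _
  have h2 : PathAlgebra.arrow K f * PathAlgebra.triv K a = PathAlgebra.arrow K f :=
    PathAlgebra.path_mul_triv _
  have h3 : PathAlgebra.triv K b * PathAlgebra.arrow K f = PathAlgebra.arrow K f :=
    PathAlgebra.triv_mul_path _
  rw [hcomp (PathAlgebra.arrow K f), h2, hcomp _ _ z.1, h3, ← map_sub, h1]
  exact congrArg Subtype.val (rep_rangeRestrict_coe ρ b _)

/-- If all derivations in the endomorphisms of a representation are inner, then the quadratic form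
of the quiver is positive on its dimension vector. -/
lemma sum_finrank_repAt_lt [Nontrivial W] [FiniteDimensional K W]
    (h : ∀ δ, (Bimod.ofEnd ρ).IsDer δ → ∃ s, δ = (Bimod.ofEnd ρ).inner s) :
    ∑ r : QuiverAut.ArrowOf V, Module.finrank K (repAt ρ r.1) * Module.finrank K (repAt ρ r.2.1) <
      ∑ a : V, Module.finrank K (repAt ρ a) * Module.finrank K (repAt ρ a) := by
  have h1 := (repComm ρ).finrank_range_add_finrank_ker
  rw [LinearMap.range_eq_top.2 (repComm_surjective ρ h), finrank_top, Module.finrank_pi_fintype,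
    Module.finrank_pi_fintype] at h1
  simp only [Module.finrank_linearMap] at h1
  rw [← h1]
  -- The identity commutes with all arrows; this non-zero element of the kernel makes the inequality
  -- strict.
  have hker : (fun a => LinearMap.id) ∈ LinearMap.ker (repComm ρ) := by
    refine LinearMap.mem_ker.2 (funext fun r => ?_)
    exact sub_self _
  have hne : (⟨_, hker⟩ : LinearMap.ker (repComm ρ)) ≠ 0 := fun h0 => by
    obtain ⟨z, hz⟩ := exists_ne (0 : W)
    have h2 : ρ 1 z = 0 := by
      rw [PathAlgebra.one_eq_sum_triv, map_sum, LinearMap.sum_apply]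
      refine Finset.sum_eq_zero fun a _ => ?_
      exact congrArg Subtype.val (LinearMap.congr_fun (congrFun (congrArg Subtype.val h0) a)
        ((ρ (PathAlgebra.triv K a)).rangeRestrict z))
    rw [map_one] at h2
    exact hz h2
  have : Nontrivial (LinearMap.ker (repComm ρ)) := ⟨⟨_, _, hne⟩⟩
  exact Nat.lt_add_of_pos_right (Module.finrank_pos (R := K) (M := LinearMap.ker (repComm ρ)))

end Rep

/-! ### Dimension vectors under base change and positivity of the Euler form -/

section DimVec

variable (k : Type u) [Field k] [Fintype k] {V : Type u} [Quiver.{u} V] [Fintype V]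
  [∀ a b : V, Fintype (a ⟶ b)] (σ : QuiverAut V) (hQ : IsAcyclicQuiver V)
  (L : Type u) [AddCommGroup L] [Module k L] [Module (FixedAlg k σ) L]
  [IsScalarTower k (FixedAlg k σ) L]

local notation "kbar" => AlgebraicClosure k

/-- An element of `e_i L` from an element of `L`. -/
def toVertex (i : σ.Orbit) (x : L) : VertexSpace k σ L i := ⟨idem k σ i • x, x, rfl⟩

lemma toVertex_coe (i : σ.Orbit) (z : VertexSpace k σ L i) : toVertex k σ L i z.1 = z := by
  obtain ⟨_, x, rfl⟩ := z
  exact Subtype.ext (idem_smul_orbitEmb_smul k σ i 1 x)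

lemma toVertex_orbitEmb_smul (i : σ.Orbit) (f : orbitField k σ i) (z : VertexSpace k σ L i) :
    toVertex k σ L i (orbitEmb k σ i f • z.1) = f • z := toVertex_coe k σ L i (f • z)

instance [Finite L] (i : σ.Orbit) : Finite (VertexSpace k σ L i) :=
  inferInstanceAs (Finite (DistribSMul.toAddMonoidHom L (idem k σ i)).range)

/-- The scalars of `k` in an orbit field. -/
def scalarOrbit (i : σ.Orbit) (c : k) : orbitField k σ i :=
  ⟨fun _ => algebraMap k kbar c, fun _ => by
    rw [← map_pow, FiniteField.pow_card]⟩

lemma orbitEmb_scalar (i : σ.Orbit) (c : k) :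
    orbitEmb k σ i (scalarOrbit k σ i c) = c • idem k σ i := by
  refine fixedVal_injective k σ ?_
  rw [map_smul]
  change diag k σ i _ = c • diag k σ i _
  rw [diag, diag, Finset.smul_sum]
  refine Finset.sum_congr rfl fun a _ => ?_
  rw [PathAlgebra.smul_monomial, Algebra.smul_def]
  exact congrArg _ (mul_one _).symm

lemma toVertex_smul (i : σ.Orbit) (c : k) (x : L) :
    toVertex k σ L i (c • x) = scalarOrbit k σ i c • toVertex k σ L i x := by
  refine Subtype.ext ?_
  change idem k σ i • c • x = orbitEmb k σ i (scalarOrbit k σ i c) • idem k σ i • x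
  rw [orbitEmb_scalar, smul_assoc, smul_smul, idem_def, ← orbitEmb_mul, one_mul, smul_comm]

/-- A `kbar`-linear form on `kbar ⊗ L` from an element of a dual basis of `e_i L`. -/
def vertexForm (a : V) (g : VertexSpace k σ L (σ.orbit a) →ₗ[orbitField k σ (σ.orbit a)]
    orbitField k σ (σ.orbit a)) : kbar ⊗[k] L →ₗ[kbar] kbar :=
  TensorProduct.AlgebraTensorModule.lift
    (LinearMap.toSpanSingleton kbar (L →ₗ[k] kbar)
      { toFun := fun x => (g (toVertex k σ L _ x)).1 ⟨a, rfl⟩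
        map_add' := fun x y => by
          have : toVertex k σ L (σ.orbit a) (x + y) = toVertex k σ L _ x + toVertex k σ L _ y :=
            Subtype.ext (smul_add _ _ _)
          rw [this, map_add]
          rfl
        map_smul' := fun c x => by
          rw [toVertex_smul, map_smul, RingHom.id_apply]
          exact (Algebra.smul_def c _).symm })

lemma vertexForm_tmul (a : V) (g : VertexSpace k σ L (σ.orbit a) →ₗ[orbitField k σ (σ.orbit a)]
    orbitField k σ (σ.orbit a)) (c : kbar) (x : L) : vertexForm k σ L a g (c ⊗ₜ x) =
      c * (g (toVertex k σ L _ x)).1 ⟨a, rfl⟩ := rfl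

/-- Replace e_a by a variable element of the path algebra and multiply the right side by its
coefficient at e_a: two linear forms result. They agree on the image of D_i, whose span contains
e_a. -/
lemma vertexForm_act_triv (a : V) (g : VertexSpace k σ L (σ.orbit a) →ₗ[orbitField k σ (σ.orbit a)]
    orbitField k σ (σ.orbit a)) (z : VertexSpace k σ L (σ.orbit a)) :
    vertexForm k σ L a g (act k σ hQ L (PathAlgebra.triv kbar a) (1 ⊗ₜ z.1)) =
      (g z).1 ⟨a, rfl⟩ := by
  classical
  let T : PathAlgebra kbar V →ₗ[kbar] kbar := vertexForm k σ L a g ∘ₗ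
    (LinearMap.applyₗ (1 ⊗ₜ z.1) : (kbar ⊗[k] L →ₗ[kbar] kbar ⊗[k] L) →ₗ[kbar] kbar ⊗[k] L) ∘ₗ
      (act k σ hQ L).toLinearMap
  have h : Set.EqOn T ((g z).1 ⟨a, rfl⟩ • trivCoeff k a : PathAlgebra kbar V →ₗ[kbar] kbar) (Submodule.span kbar
      (Set.range fun f : orbitField k σ (σ.orbit a) => fixedVal k σ (orbitEmb k σ (σ.orbit a) f))) := by
    refine LinearMap.eqOn_span ?_
    rintro _ ⟨f, rfl⟩
    change vertexForm k σ L a g (act k σ hQ L (fixedVal k σ _) (1 ⊗ₜ z.1)) =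
      (g z).1 ⟨a, rfl⟩ * trivCoeff k (⟨a, rfl⟩ : {b // σ.orbit b = σ.orbit a}).1 (diag k σ _ f.1)
    rw [act_fixedVal, vertexForm_tmul, toVertex_orbitEmb_smul, map_smul, trivCoeff_diag, one_mul,
      mul_comm]
    rfl
  refine (h (triv_mem_span_orbitEmb k σ hQ a)).trans ?_
  change _ * trivCoeff k a (PathAlgebra.monomial ⟨a, a, Quiver.Path.nil⟩ 1) = _
  rw [trivCoeff_monomial, if_pos rfl, mul_one]

lemma act_triv_orbitEmb (a : V) (f : orbitField k σ (σ.orbit a)) (x : L) :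
    act k σ hQ L (PathAlgebra.triv kbar a) (1 ⊗ₜ (orbitEmb k σ _ f • x)) =
      f.1 ⟨a, rfl⟩ • act k σ hQ L (PathAlgebra.triv kbar a) (1 ⊗ₜ x) := by
  rw [← act_fixedVal k σ hQ]
  change (act k σ hQ L _ * act k σ hQ L _) _ = _
  rw [← map_mul, triv_mul_orbitEmb, map_smul]
  rfl

/-- The dimensions of the spaces of the base change as a representation of the quiver. -/
lemma finrank_repAt [Finite L] (a : V) :
    Module.finrank kbar (repAt (act k σ hQ L) a) = dimVec k σ L (σ.orbit a) := by
  classical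
  let D := orbitField k σ (σ.orbit a)
  let b := Module.finBasis D (VertexSpace k σ L (σ.orbit a))
  -- A D_i-basis of e_i L gives a basis of e_a (kbar ⊗ L): independent by the dual forms
  -- `vertexForm`, spanning because e_a turns elements of D_i into scalars.
  let w := fun j => act k σ hQ L (PathAlgebra.triv kbar a) (1 ⊗ₜ (b j).1)
  have hlin : LinearIndependent kbar w := by
    refine LinearIndependent.of_pairwise_dual_eq_zero_one w
      (fun j => vertexForm k σ L a (b.coord j)) (fun i j hij => ?_) (fun i => ?_)
    · simp only [w]
      rw [vertexForm_act_triv, Module.Basis.coord_apply, b.repr_self, Finsupp.single_eq_of_ne hij]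
      rfl
    · simp only [w]
      rw [vertexForm_act_triv, Module.Basis.coord_apply, b.repr_self, Finsupp.single_eq_same]
      rfl
  have hspan : Submodule.span kbar (Set.range w) = repAt (act k σ hQ L) a := by
    refine le_antisymm (Submodule.span_le.2 ?_) ?_
    · rintro _ ⟨j, rfl⟩
      exact ⟨_, rfl⟩
    · rintro _ ⟨z, rfl⟩
      induction z with
      | zero => rw [map_zero]; exact zero_mem _
      | add x y hx hy => rw [map_add]; exact add_mem hx hy
      | tmul c x =>
        have h1 : (c ⊗ₜ[k] x : kbar ⊗[k] L) = c • (1 ⊗ₜ x) := by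
          rw [TensorProduct.smul_tmul', smul_eq_mul, mul_one]
        rw [h1, map_smul]
        refine Submodule.smul_mem _ _ ?_
        have h2 := act_triv_orbitEmb k σ hQ L a 1 x
        have h3 : (1 : orbitField k σ (σ.orbit a)).1 ⟨a, rfl⟩ = 1 := rfl
        rw [h3, one_smul] at h2
        rw [← h2]
        have h4 : orbitEmb k σ (σ.orbit a) 1 • x = ∑ j, orbitEmb k σ _ (b.repr (toVertex k σ L _ x) j) •
            (b j).1 := by
          have := congrArg Subtype.val (b.sum_repr (toVertex k σ L _ x))
          refine Eq.trans this.symm ?_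
          exact map_sum (AddSubgroup.subtype _) _ _
        rw [h4, TensorProduct.tmul_sum, map_sum]
        refine Submodule.sum_mem _ fun j _ => ?_
        rw [act_triv_orbitEmb]
        exact Submodule.smul_mem _ _ (Submodule.subset_span ⟨j, rfl⟩)
  rw [← hspan, finrank_span_eq_card hlin, Fintype.card_fin]
  rfl

lemma sum_fiber {X Y : Type u} [Fintype X] [Fintype Y] (f : X → Y) (g : Y → ℕ) :
    ∑ x, g (f x) = ∑ y, Nat.card {x // f x = y} * g y := by
  classical
  rw [← Finset.sum_fiberwise_of_maps_to (s := Finset.univ) (t := Finset.univ) (g := f)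
    (fun _ _ => Finset.mem_univ _)]
  refine Finset.sum_congr rfl fun y _ => ?_
  rw [Finset.sum_congr rfl (g := fun _ => g y) (fun x hx => by rw [(Finset.mem_filter.1 hx).2]),
    Finset.sum_const, smul_eq_mul, Nat.card_eq_fintype_card, Fintype.card_subtype]

/-- The Euler form is positive on dimension vectors of non-zero modules without
self-extensions. -/
lemma ExtZero.euler_pos (hQ : IsAcyclicQuiver V) [Finite L] [Nontrivial L] (h : ExtZero k (FixedAlg k σ) L L) :
    0 < σ.euler (fun i => (dimVec k σ L i : ℤ)) (fun i => (dimVec k σ L i : ℤ)) := by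
  have : Nontrivial (kbar ⊗[k] L) := inferInstance
  have : Module.Finite k L := Module.Finite.of_finite
  have h1 := sum_finrank_repAt_lt (act k σ hQ L) fun δ hδ => by
    obtain ⟨s, hs⟩ := h.exists_inner hQ hδ
    exact ⟨s, LinearMap.ext fun x => LinearMap.ext fun z => hs x z⟩
  simp only [finrank_repAt] at h1
  -- Grouping vertices and arrows by σ-orbits produces the factors ε_i and ε_ρ of the Euler form.
  rw [sum_fiber σ.orbit (fun i => dimVec k σ L i * dimVec k σ L i),
    show ∑ r : QuiverAut.ArrowOf V, dimVec k σ L (σ.orbit r.1) * dimVec k σ L (σ.orbit r.2.1) = _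
      from sum_fiber σ.arrowOrbit (fun r => dimVec k σ L (σ.tail r) * dimVec k σ L (σ.head r))] at h1
  rw [QuiverAut.euler, sub_pos]
  simp only [mul_assoc]
  exact_mod_cast h1

end DimVec

/-! ### The Euler form on the fundamental set -/

section Fundamental

variable {V : Type u} [Quiver.{u} V] [Fintype V] [∀ a b : V, Fintype (a ⟶ b)] (σ : QuiverAut V)

lemma euler_single_sum (x : σ.Orbit → ℤ) (y : σ.Orbit → ℤ) [DecidableEq σ.Orbit] :
    ∑ i, y i * σ.euler x (Pi.single i 1) = σ.euler x y := by
  simp only [QuiverAut.euler, mul_sub, Finset.mul_sum, Finset.sum_sub_distrib]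
  congr 1
  · rw [Finset.sum_comm]
    refine Finset.sum_congr rfl fun i _ => ?_
    rw [Finset.sum_eq_single i]
    · rw [Pi.single_eq_same]; ring
    · intro j _ hj
      rw [Pi.single_eq_of_ne hj.symm]; ring
    · exact fun h => absurd (Finset.mem_univ _) h
  · rw [Finset.sum_comm]
    refine Finset.sum_congr rfl fun r _ => ?_
    rw [Finset.sum_eq_single (σ.head r)]
    · rw [Pi.single_eq_same]; ring
    · intro j _ hj
      rw [Pi.single_eq_of_ne hj.symm]; ring
    · exact fun h => absurd (Finset.mem_univ _) h

lemma euler_single_sum' (x : σ.Orbit → ℤ) (y : σ.Orbit → ℤ) [DecidableEq σ.Orbit] :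
    ∑ i, y i * σ.euler (Pi.single i 1) x = σ.euler y x := by
  simp only [QuiverAut.euler, mul_sub, Finset.mul_sum, Finset.sum_sub_distrib]
  congr 1
  · rw [Finset.sum_comm]
    refine Finset.sum_congr rfl fun i _ => ?_
    rw [Finset.sum_eq_single i]
    · rw [Pi.single_eq_same]; ring
    · intro j _ hj
      rw [Pi.single_eq_of_ne hj.symm]; ring
    · exact fun h => absurd (Finset.mem_univ _) h
  · rw [Finset.sum_comm]
    refine Finset.sum_congr rfl fun r _ => ?_
    rw [Finset.sum_eq_single (σ.tail r)]
    · rw [Pi.single_eq_same]; ring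
    · intro j _ hj
      rw [Pi.single_eq_of_ne hj.symm]; ring
    · exact fun h => absurd (Finset.mem_univ _) h

/-- The Euler form is non-positive on the fundamental set. -/
lemma euler_le_zero_of_mem_fundamentalSet {α : σ.Orbit → ℕ} (hα : α ∈ σ.fundamentalSet) :
    σ.euler (fun i => (α i : ℤ)) (fun i => (α i : ℤ)) ≤ 0 := by
  classical
  -- The sum ∑ α_i (α, i) equals (α, α) = 2⟨α, α⟩.
  have h := Finset.sum_nonpos fun i (_ : i ∈ Finset.univ) =>
    mul_nonpos_of_nonneg_of_nonpos (Int.natCast_nonneg (α i)) (hα.2 i)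
  simp only [QuiverAut.symEuler, mul_add, Finset.sum_add_distrib] at h
  have h1 := euler_single_sum σ (fun i => (α i : ℤ)) (fun i => (α i : ℤ))
  have h2 := euler_single_sum' σ (fun i => (α i : ℤ)) (fun i => (α i : ℤ))
  have h3 : ∑ i, (α i : ℤ) * σ.euler (fun i => (α i : ℤ)) (Pi.single i 1) +
      ∑ i, (α i : ℤ) * σ.euler (Pi.single i 1) (fun i => (α i : ℤ)) ≤ 0 := by
    convert h
  rw [h1, h2] at h3
  omega

end Fundamental

/-! ## Hall numbers and primitive elements -/

section IsoClass

variable {A : Type u} [Ring A]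

lemma nonempty_equiv_rep_isoClass (M : Type u) [AddCommGroup M] [Module A M] [Finite M] :
    Nonempty ((isoClass (A := A) M).rep ≃ₗ[A] M) :=
  Quotient.mk_out (s := isoSetoid A) ⟨ModuleCat.of A M, ‹Finite M›⟩

lemma subsingleton_rep_isoClass_punit : Subsingleton (isoClass (A := A) PUnit).rep := by
  obtain ⟨e⟩ := nonempty_equiv_rep_isoClass (A := A) PUnit
  exact e.toEquiv.subsingleton

lemma isoClass_ne_punit (M : Type u) [AddCommGroup M] [Module A M] [Finite M] [Nontrivial M] :
    isoClass (A := A) M ≠ isoClass PUnit := fun h => by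
  obtain ⟨e⟩ := nonempty_equiv_rep_isoClass (A := A) M
  rw [h] at e
  have := subsingleton_rep_isoClass_punit (A := A)
  exact not_subsingleton M e.toEquiv.symm.subsingleton

instance (m : IsoClass A) : Finite (Submodule A m.rep) :=
  Finite.of_injective (fun X : Submodule A m.rep => (X : Set m.rep)) SetLike.coe_injective

lemma hallNumber_isoClass (m : IsoClass A) (M N : Type u) [AddCommGroup M] [Module A M] [Finite M]
    [AddCommGroup N] [Module A N] [Finite N] :
    hallNumber m (isoClass M) (isoClass N) = Nat.card {X : Submodule A m.rep //
      Nonempty (X ≃ₗ[A] N) ∧ Nonempty ((m.rep ⧸ X) ≃ₗ[A] M)} := by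
  obtain ⟨e⟩ := nonempty_equiv_rep_isoClass (A := A) M
  obtain ⟨f⟩ := nonempty_equiv_rep_isoClass (A := A) N
  refine Nat.card_congr (Equiv.subtypeEquivRight fun X => and_congr ?_ ?_)
  · exact ⟨fun ⟨g⟩ => ⟨g.trans f⟩, fun ⟨g⟩ => ⟨g.trans f.symm⟩⟩
  · exact ⟨fun ⟨g⟩ => ⟨g.trans e⟩, fun ⟨g⟩ => ⟨g.trans e.symm⟩⟩

lemma autCard_ne_zero (m : IsoClass A) : autCard m ≠ 0 := by
  have : Finite (m.rep ≃ₗ[A] m.rep) := Finite.of_injective _ LinearEquiv.toEquiv_injective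
  exact Nat.card_pos.ne'

end IsoClass

/-! ### Primitivity in terms of Hall numbers -/

section Coefficients

variable (k : Type u) [Field k] [Fintype k] {V : Type u} [Quiver.{u} V] [Fintype V]
  [∀ a b : V, Fintype (a ⟶ b)] (σ : QuiverAut V)

open Classical in
lemma comulOn_coeff (C : Set (Iso k σ)) (x : Hall k σ) (X Y : Iso k σ) :
    finsuppTensorFinsupp' ℂ (Iso k σ) (Iso k σ) (comulOn k σ C x) (X, Y) =
      if X ∈ C ∧ Y ∈ C then ∑ m ∈ x.support, x m * (v k ^ eulerIso k σ X Y *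
        ((autCard X : ℂ) * (autCard Y : ℂ) / (autCard m : ℂ)) * (hallNumber m X Y : ℂ)) else 0 := by
  rw [comulOn, Finsupp.linearCombination_apply, Finsupp.sum, map_sum, Finsupp.finsetSum_apply]
  have key : ∀ m, finsuppTensorFinsupp' ℂ (Iso k σ) (Iso k σ)
      (∑ p ∈ (finite_hallNumber_ne_zero m).toFinset with p.1 ∈ C ∧ p.2 ∈ C,
        (v k ^ eulerIso k σ p.1 p.2 * ((autCard p.1 : ℂ) * (autCard p.2 : ℂ) / (autCard m : ℂ)) *
          (hallNumber m p.1 p.2 : ℂ)) • ((Finsupp.single p.1 1 : Hall k σ) ⊗ₜ[ℂ]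
            (Finsupp.single p.2 1 : Hall k σ))) (X, Y) =
      if X ∈ C ∧ Y ∈ C then v k ^ eulerIso k σ X Y * ((autCard X : ℂ) * (autCard Y : ℂ) /
        (autCard m : ℂ)) * (hallNumber m X Y : ℂ) else 0 := fun m => by
    simp only [map_sum, map_smul, finsuppTensorFinsupp'_single_tmul_single, Finsupp.finsetSum_apply,
      Finsupp.smul_apply, mul_one, smul_eq_mul, Finsupp.single_apply, mul_ite, mul_zero]
    rw [Finset.sum_ite_eq' _ (X, Y)]
    have hmem : (X, Y) ∈ ((finite_hallNumber_ne_zero m).toFinset.filter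
        fun p => p.1 ∈ C ∧ p.2 ∈ C) ↔ hallNumber m X Y ≠ 0 ∧ (X ∈ C ∧ Y ∈ C) :=
      Finset.mem_filter.trans (and_congr (Set.Finite.mem_toFinset _) Iff.rfl)
    rw [if_congr hmem rfl rfl]
    by_cases hC : X ∈ C ∧ Y ∈ C
    · rw [if_pos hC]
      by_cases hF : hallNumber m X Y = 0
      · rw [hF, Nat.cast_zero, mul_zero, ite_self]
      · rw [if_pos ⟨hF, hC⟩]
    · rw [if_neg hC, if_neg fun h => hC h.2]
  simp only [map_smul, Finsupp.smul_apply, key, smul_eq_mul]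
  split_ifs
  · rfl
  · simp

open Classical in
lemma primPart_coeff (x : Hall k σ) (X Y : Iso k σ) :
    finsuppTensorFinsupp' ℂ (Iso k σ) (Iso k σ) (primPart k σ x) (X, Y) =
      (if isoClass PUnit = Y then x X else 0) + (if isoClass PUnit = X then x Y else 0) := by
  rw [primPart, LinearMap.add_apply, LinearMap.flip_apply, TensorProduct.mk_apply,
    TensorProduct.mk_apply, map_add, Finsupp.add_apply, finsuppTensorFinsupp'_apply_apply,
    finsuppTensorFinsupp'_apply_apply, hallOne, Finsupp.single_apply, Finsupp.single_apply]
  simp only [mul_ite, ite_mul, mul_one, mul_zero, one_mul, zero_mul]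

variable {k σ}

/-- The Hall relations satisfied by a primitive element. -/
lemma sum_hallNumber_eq_zero {α : σ.Orbit → ℕ} {x : Hall k σ} (hx : x ∈ prim k σ α) {X Y : Iso k σ}
    (hX : X ≠ isoClass PUnit) (hY : Y ≠ isoClass PUnit) :
    ∑ m ∈ x.support, x m / (autCard m : ℂ) * (hallNumber m X Y : ℂ) = 0 := by
  classical
  have h : comulOn k σ Set.univ x = primPart k σ x := hx.2
  have h1 := comulOn_coeff k σ Set.univ x X Y
  rw [h, primPart_coeff, if_neg hX.symm, if_neg hY.symm, add_zero,
    if_pos ⟨Set.mem_univ _, Set.mem_univ _⟩] at h1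
  have hv : v k ≠ 0 := by
    rw [v, Complex.ofReal_ne_zero, Real.sqrt_ne_zero']
    exact_mod_cast Fintype.card_pos
  have hne : v k ^ eulerIso k σ X Y * ((autCard X : ℂ) * (autCard Y : ℂ)) ≠ 0 :=
    mul_ne_zero (zpow_ne_zero _ hv) (mul_ne_zero (Nat.cast_ne_zero.2 (autCard_ne_zero X))
      (Nat.cast_ne_zero.2 (autCard_ne_zero Y)))
  refine (mul_eq_zero.1 (Eq.trans ?_ h1.symm)).resolve_left hne
  rw [Finset.mul_sum]
  exact Finset.sum_congr rfl fun m _ => by ring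

/-- At pairs of regular modules Δ_R(x) and Δ(x) have the same coefficients. At all other pairs
Δ_R(x) has coefficient 0, and so does x ⊗ 1 + 1 ⊗ x, because x is supported on regular modules and 0
is regular. -/
lemma mem_regPrim {α : σ.Orbit → ℕ} {x : Hall k σ} (hx : x ∈ prim k σ α)
    (hreg : ∀ m ∈ x.support, IsRegularModule k m.rep) : x ∈ regPrim k σ α := by
  classical
  have hsupp : x ∈ Finsupp.supported ℂ ℂ (regIso k σ) := fun m hm => hreg m hm
  refine ⟨⟨hsupp, hx.1⟩, ?_⟩
  have h : comulOn k σ Set.univ x = primPart k σ x := hx.2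
  have h0 : isoClass PUnit ∈ regIso k σ := fun N N' _ hN => by
    have := subsingleton_rep_isoClass_punit (A := FixedAlg k σ)
    exact absurd (inferInstanceAs (Subsingleton N)) (not_subsingleton_iff_nontrivial.2 hN.1)
  refine (finsuppTensorFinsupp' ℂ (Iso k σ) (Iso k σ)).injective (Finsupp.ext fun ⟨X, Y⟩ => ?_)
  rw [comulOn_coeff]
  by_cases hXY : X ∈ regIso k σ ∧ Y ∈ regIso k σ
  · rw [if_pos hXY, ← h, comulOn_coeff, if_pos ⟨Set.mem_univ _, Set.mem_univ _⟩]
  · have hz : ∀ {Z}, Z ∉ regIso k σ → x Z = 0 := fun hZ =>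
      Finsupp.notMem_support_iff.1 fun h' => hZ (hreg _ h')
    rw [if_neg hXY, primPart_coeff]
    split_ifs with h1 h2 h2
    · exact absurd ⟨h2 ▸ h0, h1 ▸ h0⟩ hXY
    · rw [hz fun hX => hXY ⟨hX, h1 ▸ h0⟩, add_zero]
    · rw [hz fun hY => hXY ⟨h2 ▸ h0, hY⟩, add_zero]
    · rw [add_zero]

lemma mem_kerRegIntegral {α : σ.Orbit → ℕ} {x : Hall k σ} (hx : x ∈ regPrim k σ α)
    (h : ∑ m ∈ x.support, x m / (autCard m : ℂ) = 0) : x ∈ kerRegIntegral k σ α := by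
  refine ⟨⟨x, hx.1⟩, LinearMap.mem_ker.2 ?_, rfl⟩
  change integral k σ x = 0
  rw [integral, Finsupp.linearCombination_apply, ← h]
  exact Finset.sum_congr rfl fun m _ => mul_one_div _ _

end Coefficients

/-! ### Vanishing of homomorphisms, and regularity -/

section Vanishing

open scoped ModuleCat

variable {k : Type u} [Field k] [Fintype k] {V : Type u} [Quiver.{u} V] [Fintype V]
  [∀ a b : V, Fintype (a ⟶ b)] {σ : QuiverAut V}

/-- A finite set of isoclasses, all with non-zero self-extensions, that satisfies the Hall relations
for a family of non-zero weights. -/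
structure IsHallFamily (S : Finset (Iso k σ)) (c : Iso k σ → ℂ) : Prop where
  ne_zero : ∀ m ∈ S, c m ≠ 0
  relation : ∀ X Y : Iso k σ, X ≠ isoClass PUnit → Y ≠ isoClass PUnit →
    ∑ m ∈ S, c m * (hallNumber m X Y : ℂ) = 0
  not_extZero : ∀ m ∈ S, ¬ ExtZero k (FixedAlg k σ) m.rep m.rep

variable {S : Finset (Iso k σ)} {c : Iso k σ → ℂ}

/-- The relation at (X, Y) would consist of a single non-zero term. -/
lemma IsHallFamily.false_of_unique (hS : IsHallFamily S c) {X Y : Iso k σ}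
    (hX : X ≠ isoClass PUnit) (hY : Y ≠ isoClass PUnit) {m : Iso k σ} (hm : m ∈ S)
    (h : hallNumber m X Y ≠ 0) (hu : ∀ m' ∈ S, hallNumber m' X Y ≠ 0 → m' = m) : False := by
  have h1 := hS.relation X Y hX hY
  rw [Finset.sum_eq_single_of_mem m hm fun m' hm' hne => by
    rw [of_not_not fun h' => hne (hu m' hm' h'), Nat.cast_zero, mul_zero]] at h1
  exact mul_ne_zero (hS.ne_zero m hm) (Nat.cast_ne_zero.2 h) h1

/-- Two-term filtrations detected by Hall numbers. -/
lemma exists_of_hallNumber_ne_zero {A : Type u} [Ring A] {m : IsoClass A} {M N : Type u}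
    [AddCommGroup M] [Module A M] [Finite M] [AddCommGroup N] [Module A N] [Finite N]
    (h : hallNumber m (isoClass M) (isoClass N) ≠ 0) :
    ∃ (i : N →ₗ[A] m.rep) (p : m.rep →ₗ[A] M), Injective i ∧ Exact i p ∧ Surjective p := by
  rw [hallNumber_isoClass] at h
  obtain ⟨⟨X, ⟨e⟩, ⟨f⟩⟩⟩ := (Nat.card_ne_zero.1 h).1
  refine ⟨X.subtype ∘ₗ e.symm.toLinearMap, f.toLinearMap ∘ₗ X.mkQ,
    X.injective_subtype.comp e.symm.injective, fun x => ?_, f.surjective.comp X.mkQ_surjective⟩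
  change f (X.mkQ x) = 0 ↔ ∃ y, X.subtype (e.symm y) = x
  rw [f.map_eq_zero_iff, Submodule.mkQ_apply, Submodule.Quotient.mk_eq_zero]
  exact ⟨fun hx => ⟨e ⟨x, hx⟩, by rw [e.symm_apply_apply]; rfl⟩, fun ⟨y, hy⟩ => hy ▸ (e.symm y).2⟩

lemma hallNumber_ne_zero {A : Type u} [Ring A] {m : IsoClass A} {M N : Type u}
    [AddCommGroup M] [Module A M] [Finite M] [AddCommGroup N] [Module A N] [Finite N]
    (X : Submodule A m.rep) (e : X ≃ₗ[A] N) (f : (m.rep ⧸ X) ≃ₗ[A] M) :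
    hallNumber m (isoClass M) (isoClass N) ≠ 0 := by
  rw [hallNumber_isoClass]
  exact Nat.card_ne_zero.2 ⟨⟨⟨X, ⟨e⟩, ⟨f⟩⟩⟩, inferInstance⟩

/-- The image I of a non-zero f satisfies Ext¹(I, M') = 0 for all M' in S, by heredity, so at most
one member of S is an extension of I by the kernel. The kernel is non-zero, since an embedding of M
in N would give Ext¹(M, M) = 0. -/
lemma IsHallFamily.hom_eq_zero (hS : IsHallFamily S c) (hQ : IsAcyclicQuiver V) {N : Type u}
    [AddCommGroup N] [Module (FixedAlg k σ) N] [Module k N] [IsScalarTower k (FixedAlg k σ) N]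
    [Finite N] (h : ∀ m ∈ S, ExtZero k (FixedAlg k σ) N m.rep) {m : Iso k σ} (hm : m ∈ S)
    (f : m.rep →ₗ[FixedAlg k σ] N) : f = 0 := by
  by_contra hf
  have hr : Nontrivial (LinearMap.range f) :=
    Submodule.nontrivial_iff_ne_bot.2 fun h0 => hf (LinearMap.range_eq_bot.1 h0)
  have hk : Nontrivial (LinearMap.ker f) := Submodule.nontrivial_iff_ne_bot.2 fun h0 =>
    hS.not_extZero m hm ((h m hm).of_injective hQ f (LinearMap.ker_eq_bot.1 h0))
  have hI : ∀ m' ∈ S, ExtZero k (FixedAlg k σ) (LinearMap.range f) m'.rep := fun m' hm' =>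
    (h m' hm').of_injective hQ (LinearMap.range f).subtype (Submodule.injective_subtype _)
  refine hS.false_of_unique (isoClass_ne_punit (LinearMap.range f))
    (isoClass_ne_punit (LinearMap.ker f)) hm
    (hallNumber_ne_zero (LinearMap.ker f) (LinearEquiv.refl _ _) f.quotKerEquivRange)
    fun m' hm' h' => ?_
  obtain ⟨i, p, hi, hip, hp⟩ := exists_of_hallNumber_ne_zero h'
  exact IsoClass.eq_of_equiv (nonempty_equiv_of_extZero_left (k := k) i p hi hip hp
    (LinearMap.ker f).subtype f.rangeRestrict (Submodule.injective_subtype _)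
    (fun x => ⟨fun hx => ⟨⟨x, congrArg Subtype.val hx⟩, rfl⟩, fun ⟨y, hy⟩ =>
      Subtype.ext (hy ▸ y.2)⟩)
    f.surjective_rangeRestrict (hI m' hm') (hI m hm))

/-- The dual argument, with the image and the cokernel of f; a surjection from N onto M would give
Ext¹(M, M) = 0. -/
lemma IsHallFamily.hom_eq_zero' (hS : IsHallFamily S c) (hQ : IsAcyclicQuiver V) {N : Type u}
    [AddCommGroup N] [Module (FixedAlg k σ) N] [Module k N] [IsScalarTower k (FixedAlg k σ) N]
    [Finite N] (h : ∀ m ∈ S, ExtZero k (FixedAlg k σ) m.rep N) {m : Iso k σ} (hm : m ∈ S)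
    (f : N →ₗ[FixedAlg k σ] m.rep) : f = 0 := by
  by_contra hf
  have hr : Nontrivial (LinearMap.range f) :=
    Submodule.nontrivial_iff_ne_bot.2 fun h0 => hf (LinearMap.range_eq_bot.1 h0)
  have hk : Nontrivial (m.rep ⧸ LinearMap.range f) := Submodule.Quotient.nontrivial_iff.2 fun h0 =>
    hS.not_extZero m hm ((h m hm).of_surjective hQ f (LinearMap.range_eq_top.1 h0))
  have : Finite (m.rep ⧸ LinearMap.range f) := Finite.of_surjective _ (Submodule.mkQ_surjective _)
  have hI : ∀ m' ∈ S, ExtZero k (FixedAlg k σ) m'.rep (LinearMap.range f) := fun m' hm' =>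
    (h m' hm').of_surjective hQ f.rangeRestrict f.surjective_rangeRestrict
  refine hS.false_of_unique (isoClass_ne_punit (m.rep ⧸ LinearMap.range f))
    (isoClass_ne_punit (LinearMap.range f)) hm
    (hallNumber_ne_zero (LinearMap.range f) (LinearEquiv.refl _ _) (LinearEquiv.refl _ _))
    fun m' hm' h' => ?_
  obtain ⟨i, p, hi, hip, hp⟩ := exists_of_hallNumber_ne_zero h'
  exact IsoClass.eq_of_equiv (nonempty_equiv_of_extZero_right (k := k) i p hi hip hp
    (LinearMap.range f).subtype (LinearMap.range f).mkQ (Submodule.injective_subtype _)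
    (LinearMap.exact_subtype_mkQ _) (Submodule.mkQ_surjective _) (hI m' hm') (hI m hm))

/-- If Hom(-, τM) vanishes on S, so does Ext¹(M, -), and `IsHallFamily.hom_eq_zero` returns the
vanishing of Hom(-, M). The induction carries all members of S together, as that lemma requires. -/
lemma IsHallFamily.hom_postprojective (hS : IsHallFamily S c) (hQ : IsAcyclicQuiver V)
    {P : ModuleCat.{u} (FixedAlg k σ)} (hP : IsIndecPostprojective k P) :
    ∀ m ∈ S, ∀ f : m.rep →ₗ[FixedAlg k σ] P, f = 0 := by
  induction hP with
  | projective P _ _ _ => exact fun m hm => hS.hom_eq_zero hQ (fun m _ => extZero_of_projective) hm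
  | step N M _ _ ht _ ih =>
    obtain ⟨P₁, P₀, f, p, h₁, h₀, hp₁, hp₀, -, hfp, hp, ⟨e⟩⟩ := ht
    refine fun m hm => hS.hom_eq_zero hQ (fun m hm => extZero_of_hom_dualCoker f p hfp hp
      fun g => ?_) hm
    have := ih m hm (e.symm.toLinearMap ∘ₗ g)
    exact LinearMap.ext fun x => e.symm.injective ((LinearMap.congr_fun this x).trans
      e.symm.map_zero.symm)

/-- Here the induction moves from M to τM: the vanishing of Hom(M, -) on S gives that of Ext¹(-,
τM), hence of Hom(τM, -). -/
lemma IsHallFamily.hom_preinjective (hS : IsHallFamily S c) (hQ : IsAcyclicQuiver V)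
    {J : ModuleCat.{u} (FixedAlg k σ)} (hJ : IsIndecPreinjective k J) :
    ∀ m ∈ S, ∀ f : J →ₗ[FixedAlg k σ] m.rep, f = 0 := by
  induction hJ with
  | injective J _ _ hj => exact fun m hm => hS.hom_eq_zero' hQ (fun m _ => extZero_of_injective hj) hm
  | step N M _ _ ht _ ih =>
    obtain ⟨P₁, P₀, f, p, h₁, h₀, hp₁, hp₀, -, hfp, hp, ⟨e⟩⟩ := ht
    exact fun m hm => hS.hom_eq_zero' hQ (fun m hm => extZero_dualCoker f p hfp hp e (ih m hm)) hm

/-- The projection onto a postprojective summand and the inclusion of a preinjective one would be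
non-zero homomorphisms. -/
lemma IsHallFamily.isRegularModule (hS : IsHallFamily S c) (hQ : IsAcyclicQuiver V) {m : Iso k σ}
    (hm : m ∈ S) : IsRegularModule k m.rep := fun N N' hN hi => by
  obtain ⟨z, hz⟩ := @exists_ne _ hi.1 (0 : N)
  refine ⟨fun hP => hz ?_, fun hJ => hz ?_⟩
  · have := LinearMap.congr_fun (hS.hom_postprojective hQ hP m hm (N.projectionOnto N' hN)) z.1
    exact (Submodule.projectionOnto_apply_left hN z).symm.trans this
  · exact Subtype.ext (LinearMap.congr_fun (hS.hom_preinjective hQ hJ m hm N.subtype) z)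

lemma isHallFamily_support (hQ : IsAcyclicQuiver V) {α : σ.Orbit → ℕ} (hα : α ∈ σ.fundamentalSet)
    {x : Hall k σ} (hx : x ∈ prim k σ α) :
    IsHallFamily x.support fun m => x m / (autCard m : ℂ) where
  ne_zero m hm := div_ne_zero (Finsupp.mem_support_iff.1 hm) (Nat.cast_ne_zero.2 (autCard_ne_zero m))
  relation _ _ hX hY := sum_hallNumber_eq_zero hx hX hY
  not_extZero m hm h := by
    have hd : dimVec k σ m.rep = α := hx.1 hm
    obtain ⟨⟨i, hi⟩⟩ := hα.1.nonempty
    have : Nontrivial m.rep := by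
      by_contra hn
      rw [not_nontrivial_iff_subsingleton] at hn
      have : Subsingleton (VertexSpace k σ m.rep i) :=
        ⟨fun a b => Subtype.ext (Subsingleton.elim a.1 b.1)⟩
      exact hi ((congrFun hd i).symm.trans Module.finrank_zero_of_subsingleton)
    have h1 := h.euler_pos k σ m.rep hQ
    rw [hd] at h1
    exact (euler_le_zero_of_mem_fundamentalSet σ hα).not_gt h1

end Vanishing

/-! ## The integral of a primitive element -/

section Corner

variable {A : Type u} [Ring A] (e : A)

/-- The largest submodule on which `e` acts as the identity. -/
def cornerSub (L : Type u) [AddCommGroup L] [Module A L] : Submodule A L where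
  carrier := {x | ∀ a : A, e • a • x = a • x}
  add_mem' hx hy a := by rw [smul_add, smul_add, hx a, hy a]
  zero_mem' a := by rw [smul_zero, smul_zero]
  smul_mem' b x hx a := by rw [smul_smul a b, hx]

lemma smul_of_mem_cornerSub {L : Type u} [AddCommGroup L] [Module A L] {x : L}
    (hx : x ∈ cornerSub e L) : e • x = x := by simpa using hx 1

/-- Through f, e is the identity on the submodule W, so W lies in the corner. Through g, e kills L /
W, so any w = e w in the corner lies in W. -/
lemma eq_cornerSub {L L' : Type u} [AddCommGroup L] [Module A L] [AddCommGroup L'] [Module A L']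
    (h' : ∀ x : L', e • x ∈ cornerSub e L') {W : Submodule A L} (f : W ≃ₗ[A] cornerSub e L')
    (g : (L ⧸ W) ≃ₗ[A] (L' ⧸ cornerSub e L')) : W = cornerSub e L := by
  refine le_antisymm (fun w hw a => ?_) fun w hw => ?_
  · have h1 : e • (⟨a • w, W.smul_mem a hw⟩ : W) = ⟨a • w, W.smul_mem a hw⟩ := f.injective (by
      rw [map_smul]
      exact Subtype.ext (smul_of_mem_cornerSub e (f _).2))
    exact congrArg Subtype.val h1
  · rw [← smul_of_mem_cornerSub e hw, ← Submodule.Quotient.mk_eq_zero]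
    refine g.injective ?_
    rw [Submodule.Quotient.mk_smul, map_smul, map_zero]
    obtain ⟨z, hz⟩ := Submodule.Quotient.mk_surjective _ (g (Submodule.Quotient.mk w))
    rw [← hz, ← Submodule.Quotient.mk_smul, Submodule.Quotient.mk_eq_zero]
    exact h' z

instance {L : Type u} [AddCommGroup L] [Module A L] [Finite L] (W : Submodule A L) :
    Finite (L ⧸ W) := Finite.of_surjective _ W.mkQ_surjective

/-- The isoclasses of the factors of the filtration given by `cornerSub`. -/
def cornerPair (m : IsoClass A) : IsoClass A × IsoClass A :=
  (isoClass (m.rep ⧸ cornerSub e m.rep), isoClass (cornerSub e m.rep))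

lemma isoClass_eq_iff {M N : Type u} [AddCommGroup M] [Module A M] [Finite M] [AddCommGroup N]
    [Module A N] [Finite N] : isoClass (A := A) M = isoClass N ↔ Nonempty (M ≃ₗ[A] N) :=
  Quotient.eq (r := isoSetoid A)

open Classical in
lemma hallNumber_cornerPair {m m' : IsoClass A} (h' : ∀ x : m'.rep, e • x ∈ cornerSub e m'.rep) :
    hallNumber m (cornerPair e m').1 (cornerPair e m').2 =
      if cornerPair e m = cornerPair e m' then 1 else 0 := by
  have hiff : cornerPair e m = cornerPair e m' ↔ _ :=
    Prod.mk_inj.trans (and_congr isoClass_eq_iff isoClass_eq_iff)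
  rw [cornerPair, hallNumber_isoClass]
  have key : ∀ W : {X : Submodule A m.rep // Nonempty (X ≃ₗ[A] cornerSub e m'.rep) ∧
      Nonempty ((m.rep ⧸ X) ≃ₗ[A] (m'.rep ⧸ cornerSub e m'.rep))}, W.1 = cornerSub e m.rep :=
    fun ⟨W, ⟨f⟩, ⟨g⟩⟩ => eq_cornerSub e h' f g
  split_ifs with h
  · exact Nat.card_eq_one_iff_unique.2 ⟨⟨fun W W' => Subtype.ext ((key W).trans (key W').symm)⟩,
      ⟨⟨_, (hiff.1 h).2, (hiff.1 h).1⟩⟩⟩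
  · refine Nat.card_eq_zero.2 (Or.inl ⟨fun W => h (hiff.2 ?_)⟩)
    rw [← key W]
    exact ⟨W.2.2, W.2.1⟩

end Corner

/-! ### The filtration at a sink of the support -/

section Integral

variable {k : Type u} [Field k] [Fintype k] {V : Type u} [Quiver.{u} V] [Fintype V]
  [∀ a b : V, Fintype (a ⟶ b)] {σ : QuiverAut V}

/-- The Hall relations for a filtration given by an idempotent. -/
lemma IsHallFamily.sum_eq_zero {S : Finset (Iso k σ)} {c : Iso k σ → ℂ} (hS : IsHallFamily S c)
    (e : FixedAlg k σ) (h : ∀ m ∈ S, ∀ x : m.rep, e • x ∈ cornerSub e m.rep)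
    (h₀ : ∀ m ∈ S, ∃ x : m.rep, e • x ≠ 0) (h₁ : ∀ m ∈ S, ∃ x : m.rep, e • x ≠ x) :
    ∑ m ∈ S, c m = 0 := by
  classical
  have hrel : ∀ p ∈ S.image (cornerPair e), ∑ m ∈ S, c m * (hallNumber m p.1 p.2 : ℂ) = 0 := by
    intro p hp
    obtain ⟨m, hm, rfl⟩ := Finset.mem_image.1 hp
    obtain ⟨x, hx⟩ := h₀ m hm
    obtain ⟨y, hy⟩ := h₁ m hm
    have : Nontrivial (cornerSub e m.rep) := ⟨⟨e • x, h m hm x⟩, 0, fun h => hx (congrArg Subtype.val h)⟩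
    have : Nontrivial (m.rep ⧸ cornerSub e m.rep) := Submodule.Quotient.nontrivial_iff.2 fun ht =>
      hy (smul_of_mem_cornerSub e (ht ▸ Submodule.mem_top))
    exact hS.relation _ _ (isoClass_ne_punit _) (isoClass_ne_punit _)
  -- Add the relations over all pairs that occur; after exchanging the sums, each m is counted
  -- exactly once, at its own pair.
  rw [← Finset.sum_eq_zero hrel, Finset.sum_comm]
  refine Finset.sum_congr rfl fun m hm => ?_
  rw [← Finset.mul_sum, Finset.sum_congr rfl (g := fun p => if cornerPair e m = p then (1 : ℂ) else 0)
    fun p hp => ?_, Finset.sum_ite_eq, if_pos (Finset.mem_image_of_mem _ hm), mul_one]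
  obtain ⟨m', hm', rfl⟩ := Finset.mem_image.1 hp
  rw [hallNumber_cornerPair e (h m' hm')]
  split_ifs <;> simp

variable (k σ)

local notation "kbar" => AlgebraicClosure k

lemma diag_mul_path {j : σ.Orbit} (f : {a : V // σ.orbit a = j} → kbar) {a b : V}
    (p : Quiver.Path a b) (h : σ.orbit b ≠ j) : diag k σ j f * PathAlgebra.path p = 0 := by
  rw [diag, Finset.sum_mul]
  refine Finset.sum_eq_zero fun c _ => ?_
  rw [PathAlgebra.path, PathAlgebra.monomial_mul_monomial, PathAlgebra.pathMul_of_ne, smul_zero]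
  exact fun hbc : b = c.1 => h (hbc ▸ c.2)

lemma path_mul_diag {i : σ.Orbit} (f : {a : V // σ.orbit a = i} → kbar) {a b : V}
    (p : Quiver.Path a b) (h : σ.orbit a ≠ i) : PathAlgebra.path p * diag k σ i f = 0 := by
  rw [diag, Finset.mul_sum]
  refine Finset.sum_eq_zero fun c _ => ?_
  rw [PathAlgebra.path, PathAlgebra.monomial_mul_monomial, PathAlgebra.pathMul_of_ne, smul_zero]
  exact fun hbc : c.1 = a => h (hbc ▸ c.2)

/-- In the path algebra, e_j y e_i involves only paths from the orbit i to the orbit j. -/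
lemma idem_mul_mul_idem {i j : σ.Orbit} (h : ∀ (a b : V), Quiver.Path a b → σ.orbit a = i →
    σ.orbit b ≠ j) (x : FixedAlg k σ) : idem k σ j * (x * idem k σ i) = 0 := by
  refine fixedVal_injective k σ ?_
  rw [map_mul, map_mul, map_zero]
  generalize fixedVal k σ x = y
  have : (LinearMap.mulLeft kbar (fixedVal k σ (idem k σ j))) ∘ₗ
      (LinearMap.mulRight kbar (fixedVal k σ (idem k σ i))) = 0 := by
    refine PathAlgebra.hom_ext fun a b p => ?_
    change diag k σ j _ * (PathAlgebra.path p * diag k σ i _) = 0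
    by_cases ha : σ.orbit a = i
    · rw [← mul_assoc, diag_mul_path k σ _ p (h a b p ha), zero_mul]
    · rw [path_mul_diag k σ _ p ha, mul_zero]
  exact LinearMap.congr_fun this y

lemma idem_mul_idem_of_ne {i j : σ.Orbit} (h : i ≠ j) : idem k σ i * idem k σ j = 0 := by
  refine fixedVal_injective k σ ?_
  rw [map_mul, map_zero]
  change diag k σ i _ * diag k σ j _ = 0
  conv_lhs => rw [diag.eq_1 k σ j, Finset.mul_sum]
  refine Finset.sum_eq_zero fun a _ => ?_
  exact diag_mul_path k σ _ (Quiver.Path.nil (a := a.1)) fun ha => h (ha.symm.trans a.2)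

lemma sum_idem : ∑ i, idem k σ i = 1 := by
  classical
  refine fixedVal_injective k σ ?_
  rw [map_sum, map_one, PathAlgebra.one_eq_sum_triv,
    ← Finset.sum_fiberwise_of_maps_to (t := Finset.univ) (g := σ.orbit) fun _ _ => Finset.mem_univ _]
  refine Finset.sum_congr rfl fun i _ => ?_
  change diag k σ i _ = _
  rw [diag, Finset.sum_subtype _ (p := fun a => σ.orbit a = i) (fun a => by simp)]
  rfl

variable {k σ}

lemma exists_idem_smul_ne_zero {L : Type u} [AddCommGroup L] [Module (FixedAlg k σ) L]
    {i : σ.Orbit} (h : dimVec k σ L i ≠ 0) : ∃ x : L, idem k σ i • x ≠ 0 := by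
  by_contra! h0
  have : Subsingleton (VertexSpace k σ L i) := ⟨fun a b => Subtype.ext (by
    obtain ⟨_, a, rfl⟩ := a
    obtain ⟨_, b, rfl⟩ := b
    exact (h0 a).trans (h0 b).symm)⟩
  exact h Module.finrank_zero_of_subsingleton

lemma idem_smul_eq_zero {L : Type u} [AddCommGroup L] [Module (FixedAlg k σ) L] [Finite L]
    {i : σ.Orbit} (h : dimVec k σ L i = 0) (x : L) : idem k σ i • x = 0 := by
  have : Finite (VertexSpace k σ L i) :=
    inferInstanceAs (Finite (DistribSMul.toAddMonoidHom L (idem k σ i)).range)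
  have : Subsingleton (VertexSpace k σ L i) :=
    Module.finrank_zero_iff (R := orbitField k σ i).1 h
  have h0 : (⟨idem k σ i • x, x, rfl⟩ : VertexSpace k σ L i) = 0 :=
    Subsingleton.elim (α := VertexSpace k σ L i) _ _
  exact congrArg Subtype.val h0

/-- An element of the fundamental set is not supported at a single vertex. -/
lemma exists_ne_of_mem_fundamentalSet (hQ : IsAcyclicQuiver V) {α : σ.Orbit → ℕ}
    (hα : α ∈ σ.fundamentalSet) {i : σ.Orbit} (hi : α i ≠ 0) : ∃ j, j ≠ i ∧ α j ≠ 0 := by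
  by_contra! h
  -- With support {i} all arrow terms vanish, as no arrow joins vertices of one orbit, and ⟨α, α⟩ =
  -- ε_i α_i² > 0.
  refine (euler_le_zero_of_mem_fundamentalSet σ hα).not_gt ?_
  rw [QuiverAut.euler, Finset.sum_eq_zero (s := (Finset.univ : Finset σ.ArrowOrbit)) fun r _ => ?_,
    sub_zero, Finset.sum_eq_single_of_mem i (Finset.mem_univ i) fun j _ hj => by simp [h j hj]]
  · have h1 : 0 < σ.eps i := by
      obtain ⟨a, rfl⟩ := Quotient.exists_rep i
      have : Nonempty {b : V // σ.orbit b = Quotient.mk _ a} := ⟨⟨a, rfl⟩⟩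
      exact Nat.card_pos
    have h2 := Nat.pos_of_ne_zero hi
    positivity
  · obtain ⟨⟨a, b, f⟩, rfl⟩ := Quotient.exists_rep r
    change _ * (α (σ.orbit a) : ℤ) * (α (σ.orbit b) : ℤ) = 0
    by_cases ha : σ.orbit a = i
    · by_cases hb : σ.orbit b = i
      · exact absurd (QuiverAut.depth_eq_of_orbit_eq σ (ha.trans hb.symm)) (depth_lt hQ f).ne
      · rw [h _ hb, Nat.cast_zero, mul_zero]
    · rw [h _ ha, Nat.cast_zero, mul_zero, zero_mul]

/-- An orbit i of maximal depth in the support of α is a sink there, so e_i M is a submodule of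
every M in S. It is non-zero as α_i ≠ 0, and proper because the support contains another orbit j. -/
lemma IsHallFamily.sum_weight_eq_zero (hQ : IsAcyclicQuiver V) {S : Finset (Iso k σ)}
    {c : Iso k σ → ℂ} (hS : IsHallFamily S c) {α : σ.Orbit → ℕ} (hα : α ∈ σ.fundamentalSet)
    (hd : ∀ m ∈ S, dimVec k σ m.rep = α) : ∑ m ∈ S, c m = 0 := by
  classical
  obtain ⟨⟨i₀, hi₀⟩⟩ := hα.1.nonempty
  obtain ⟨i, hi, hmax⟩ := Finset.exists_max_image (Finset.univ.filter fun i => α i ≠ 0)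
    (fun i => depth (Quotient.out i)) ⟨i₀, Finset.mem_filter.2 ⟨Finset.mem_univ _, hi₀⟩⟩
  replace hi := (Finset.mem_filter.1 hi).2
  obtain ⟨j, hji, hj⟩ := exists_ne_of_mem_fundamentalSet hQ hα hi
  have hdepth : ∀ a, depth (Quotient.out (σ.orbit a)) = depth a := fun a =>
    QuiverAut.depth_eq_of_orbit_eq σ (Quotient.out_eq _)
  refine hS.sum_eq_zero (idem k σ i) (fun m hm x a => ?_)
    (fun m hm => exists_idem_smul_ne_zero (by rwa [hd m hm])) (fun m hm => ?_)
  · conv_rhs => rw [← one_smul (FixedAlg k σ) (a • idem k σ i • x), ← sum_idem, Finset.sum_smul]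
    rw [Finset.sum_eq_single_of_mem i (Finset.mem_univ i)]
    intro l _ hl
    by_cases h0 : α l = 0
    · exact idem_smul_eq_zero (by rw [hd m hm, h0]) _
    · rw [smul_smul a, smul_smul, idem_mul_mul_idem, zero_smul]
      intro b b' p hb hb'
      have h1 := hmax l (Finset.mem_filter.2 ⟨Finset.mem_univ _, h0⟩)
      rw [← hb, ← hb', hdepth, hdepth] at h1
      rcases depth_lt_of_path hQ p with h2 | h2
      · exact hl (by rw [← hb, ← hb', h2])
      · exact h1.not_gt h2
  · obtain ⟨x, hx⟩ := exists_idem_smul_ne_zero (L := m.rep) (i := j) (by rwa [hd m hm])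
    refine ⟨idem k σ j • x, fun h => hx ?_⟩
    rw [← h, smul_smul, idem_mul_idem_of_ne k σ hji.symm, zero_smul]

end Integral

end HallPrim

end

theorem mainTheorem6 {k : Type u} [Field k] [Fintype k] {V : Type u} [Quiver.{u} V] [Fintype V]
    [∀ a b : V, Fintype (a ⟶ b)] (σ : HallPrim.QuiverAut V)
    (hQ : HallPrim.IsAcyclicQuiver V)
    (α : σ.Orbit → ℕ) (hα : α ∈ σ.fundamentalSet) :
    (∀ x ∈ HallPrim.prim k σ α, ∀ m ∈ x.support,
      HallPrim.IsRegularModule k m.rep ∧ HallPrim.Iso.dim k σ m = α) ∧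
    HallPrim.prim k σ α ≤ HallPrim.regPrim k σ α ⊓ HallPrim.kerRegIntegral k σ α := by
  have hreg : ∀ x ∈ HallPrim.prim k σ α, ∀ m ∈ x.support, HallPrim.IsRegularModule k m.rep :=
    fun x hx m hm => (HallPrim.isHallFamily_support hQ hα hx).isRegularModule hQ hm
  refine ⟨fun x hx m hm => ⟨hreg x hx m hm, hx.1 hm⟩, fun x hx => ?_⟩
  have h1 := HallPrim.mem_regPrim hx (hreg x hx)
  exact ⟨h1, HallPrim.mem_kerRegIntegral h1
    ((HallPrim.isHallFamily_support hQ hα hx).sum_weight_eq_zero hQ hα fun m hm => hx.1 hm)⟩
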